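/- **Conventions.** All vector spaces are over $\mathbb C$. For a vector space $V$, $V((z,\bar z,|z|^{\mathbb R}))$ is the space of formal sums $\sum_{s,\bar s\in\mathbb R}v_{s,\bar s}z^s\bar z^{\bar s}$ ($v_{s,\bar s}\in V$) such that $v_{s,\bar s}=0$ unless $s-\bar s\in\mathbb Z$, for every $H\in\mathbb R$ only finitely many $v_{s,\bar s}\ne0$ have $s+\bar s\le H$, and there is $N\in\mathbb R$ with $v_{s,\bar s}=0$ unless $s,\bar s\ge N$. Let $F_{0,1,\infty}$ be the space of real analytic functions $f:\mathbb{C}P^1\setminus\{0,1,\infty\}\to\mathbb C$ with conformal singularities at $0,1,\infty$: for each $\alpha\in\{0,1,\infty\}$ and each holomorphic chart $\chi$ at $\alpha$ with $\chi(\alpha)=0$, the function $f\circ\chi^{-1}$ is, on some annulus $0<|z|<R$, the sum of an absolutely convergent series $j(\chi,f)\in\mathbb C((z,\bar z,|z|^{\mathbb R}))$. Let $\mathrm{GCor}_2$ be the span of the functions $z_1^{\alpha}\bar z_1^{\beta}f(z_2/z_1)$ on $\{z_1\neq z_2,\ z_1,z_2\neq 0\}$ with $f\in F_{0,1,\infty}$,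 $\alpha,\beta\in\mathbb R$, $\alpha-\beta\in\mathbb Z$; its elements $\mu$ have formal expansions $\mu|_{|z_1|>|z_2|}$, $\mu|_{|z_2|>|z_1-z_2|}$ (in $z_0=z_1-z_2$ and $z_2$) and $\mu|_{|z_2|>|z_1|}$, defined linearly from $j(z,f)$, $j(1-z^{-1},f)$ and $j(z^{-1},f)$ respectively. A *full vertex algebra* is an $\mathbb R^2$-graded vector space $F=\bigoplus_{h,\bar h}F_{h,\bar h}$ with a vector $\mathbf 1\in F_{0,0}$ and a linear map $a\mapsto Y(a,\underline z)=\sum_{r,s\in\mathbb R}a(r,s)z^{-r-1}\bar z^{-s-1}$, $a(r,s)\in\mathrm{End}\,F$, such that, for all $a,b,c\in F$: (1) $Y(a,\underline z)b\in F((z,\bar z,|z|^{\mathbb R}))$; (2) $F_{h,\bar h}=0$ unless $h-\bar h\in\mathbb Z$; (3) $Y(a,\underline z)\mathbf 1\in F[[z,\bar z]]$ and $a(-1,-1)\mathbf 1=a$; (4) $Y(\mathbf 1,\underline z)=\mathrm{id}$; (5) for every $u\in F^\vee=\bigoplus F_{h,\bar h}^*$ there is $\mu\in\mathrm{GCor}_2$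 with $u(Y(a,\underline z_1)Y(b,\underline z_2)c)=\mu|_{|z_1|>|z_2|}$, $u(Y(Y(a,\underline z_0)b,\underline z_2)c)=\mu|_{|z_2|>|z_1-z_2|}$, $u(Y(b,\underline z_2)Y(a,\underline z_1)c)=\mu|_{|z_2|>|z_1|}$; (6) $F_{h,\bar h}(r,s)F_{h',\bar h'}\subset F_{h+h'-r-1,\bar h+\bar h'-s-1}$. A *module* of a full vertex algebra $F$ is an $\mathbb R^2$-graded vector space $M$ with a linear map $Y_M$ from $F$ to formal series with coefficients in $\mathrm{End}\,M$ satisfying the analogues of (1), (4), (5), (6). A *homomorphism* of full vertex algebras is a linear map $f$ with $f(\mathbf 1)=\mathbf 1$ and $f(a(r,s)b)=f(a)(r,s)f(b)$ for all $a,b,r,s$. A *subalgebra* is a graded subspace that contains $\mathbf 1$ and is closed under all products $a(r,s)b$. The tensor product $F^1\otimes F^2$ carries the vector $\mathbf 1\otimes\mathbf 1$, the tensor product grading and $Y(a\otimes b,\underline z)=Y^1(a,\underline z)\otimes Y^2(b,\underline z)$. **Statement.** Let $F$ be a full vertex algebra and let $D,\bar D\in\mathrm{End}\,F$ be given by $Da=a(-2,-1)\mathbf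 1$, $\bar Da=a(-1,-2)\mathbf 1$. (i) $\ker\bar D$ and $\ker D$ are subalgebras of $F$, and are themselves full vertex algebras. For $a\in\ker\bar D$ one has $a(r,s)=0$ unless $s=-1$ and $r\in\mathbb Z$, so that $Y(a,\underline z)=\sum_{n\in\mathbb Z}a(n,-1)z^{-n-1}$. With these operators, $\ker\bar D$ is a vertex algebra and $F$ is a module over the vertex algebra $\ker\bar D$ (both in the usual sense: truncation, vacuum and, for the algebra, creation axioms and the Borcherds identity). Also, $F$ is a module of the full vertex algebra $\ker\bar D$. (ii) The tensor product $\ker\bar D\otimes\ker D$ is a full vertex algebra, and the linear map $\ker\bar D\otimes\ker D\to F$, $a\otimes b\mapsto a(-1,-1)b$, is a homomorphism of full vertex algebras. -/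

import Mathlib

open scoped TensorProduct

noncomputable section

namespace FullVA

/-! ### Formal series in `z`, `z̄`, `|z|^ℝ` and conformal singularities -/

/-- The formal sum `∑ c s t · z^s z̄^t` belongs to `V((z, z̄, |z|^ℝ))`. -/
structure IsFormal {V : Type*} [Zero V] (c : ℝ → ℝ → V) : Prop where
  integral : ∀ s t, c s t ≠ 0 → ∃ n : ℤ, s - t = n
  finite : ∀ H : ℝ, {p : ℝ × ℝ | c p.1 p.2 ≠ 0 ∧ p.1 + p.2 ≤ H}.Finite
  bounded : ∃ N : ℝ, ∀ s t, c s t ≠ 0 → N ≤ s ∧ N ≤ t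

/-- The function `z^s z̄^t = z^(s-t) |z|^(2t)`, used for `s - t ∈ ℤ` and `z ≠ 0` only. -/
def mono (s t : ℝ) (z : ℂ) : ℂ := z ^ ⌊s - t⌋ * ((‖z‖ ^ (2 * t) : ℝ) : ℂ)

/-- `∑ c s t · z^s z̄^t` is a series in `ℂ((z, z̄, |z|^ℝ))` which is absolutely convergent
around `0` and whose sum is `g z` on some annulus `0 < |z| < R`. -/
def IsExpansionAtZero (c : ℝ → ℝ → ℂ) (g : ℂ → ℂ) : Prop :=
  IsFormal c ∧ ∃ R : ℝ, 0 < R ∧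
    Summable (fun p : ℝ × ℝ => ‖c p.1 p.2‖ * R ^ (p.1 + p.2)) ∧
    ∀ z : ℂ, z ≠ 0 → ‖z‖ < R → HasSum (fun p : ℝ × ℝ => c p.1 p.2 * mono p.1 p.2 z) (g z)

/-- `f` has a conformal singularity at the finite point `α`: for every chart of `ℂP¹` at `α`, with
inverse `ψ` (a germ at `0` of a locally biholomorphic map with `ψ 0 = α`), `f ∘ ψ` is the sum of
a series in `ℂ((z, z̄, |z|^ℝ))` absolutely convergent around `0`. -/
def ConformalAt (f : ℂ → ℂ) (α : ℂ) : Prop :=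
  ∀ ψ : ℂ → ℂ, AnalyticAt ℂ ψ 0 → ψ 0 = α → deriv ψ 0 ≠ 0 →
    ∃ c, IsExpansionAtZero c (fun z => f (ψ z))

/-- `f` has a conformal singularity at `∞`; the inverse of a chart of `ℂP¹` at `∞` is `1 / φ`
with `φ` a germ at `0` of a locally biholomorphic map with `φ 0 = 0`. -/
def ConformalAtInfty (f : ℂ → ℂ) : Prop :=
  ∀ φ : ℂ → ℂ, AnalyticAt ℂ φ 0 → φ 0 = 0 → deriv φ 0 ≠ 0 →
    ∃ c, IsExpansionAtZero c (fun z => f (φ z)⁻¹)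

/-- The space `F_{0,1,∞}` of real analytic functions on `ℂP¹ \ {0, 1, ∞}` with possible conformal
singularities at `0, 1, ∞` (the values of `f` at `0` and `1` are irrelevant). -/
structure IsF01Infty (f : ℂ → ℂ) : Prop where
  analytic : AnalyticOnNhd ℝ f {0, 1}ᶜ
  at_zero : ConformalAt f 0
  at_one : ConformalAt f 1
  at_infty : ConformalAtInfty f

/-! ### Generalized two-point correlation functions and their expansions -/

/-- `Y₂ = {(z₁, z₂) | z₁ ≠ z₂, z₁ ≠ 0, z₂ ≠ 0}`. -/
def Y₂ : Set (ℂ × ℂ) := {w | w.1 ≠ w.2 ∧ w.1 ≠ 0 ∧ w.2 ≠ 0}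

/-- Formal series in two pairs of variables: `e p p' q q'` is the coefficient of
`x^p x̄^p' y^q ȳ^q'`. -/
abbrev Series₂ : Type := ℝ → ℝ → ℝ → ℝ → ℂ

open Classical in
/-- The series `z₁^α z̄₁^β · c(z₂/z₁)` in `(x, y) = (z₁, z₂)`. -/
def expand12 (α β : ℝ) (c : ℝ → ℝ → ℂ) : Series₂ := fun p p' q q' =>
  if p + q = α ∧ p' + q' = β then c q q' else 0

open Classical in
/-- The series `z₁^α z̄₁^β · c(z₁/z₂)` in `(x, y) = (z₁, z₂)`. -/
def expand21 (α β : ℝ) (c : ℝ → ℝ → ℂ) : Series₂ := fun p p' q q' =>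
  if p + q = α ∧ p' + q' = β then c (-q) (-q') else 0

open Classical in
/-- The series `z₂^α z̄₂^β · ∑ i j, C(α,i) C(β,j) (z₀/z₂)^i (z̄₀/z̄₂)^j · c(-z₀/z₂)` in
`(x, y) = (z₀, z₂)`. The sum has finitely many nonzero terms if `IsFormal c`. -/
def expand20 (α β : ℝ) (c : ℝ → ℝ → ℂ) : Series₂ := fun p p' q q' =>
  if p + q = α ∧ p' + q' = β then
    ∑ᶠ ij : ℕ × ℕ, ((Ring.choose α ij.1 * Ring.choose β ij.2 : ℝ) : ℂ) *
      ((-1 : ℂ) ^ ⌊(p - ij.1) - (p' - ij.2)⌋ * c (p - ij.1) (p' - ij.2))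
  else 0

/-- The space `GCor₂` together with the three linear expansion maps: the linear span of all
quadruples consisting of a generator `z₁^α z̄₁^β f(z₂/z₁)` of `GCor₂` (with `f ∈ F_{0,1,∞}`,
`α - β ∈ ℤ`) and its expansions in `|z₁| > |z₂|`, in `|z₂| > |z₁ - z₂|` and in `|z₂| > |z₁|`.
These use the charts `z`, `1 - z⁻¹` and `z⁻¹` of `ℂP¹` at `0`, `1` and `∞`. -/
def gcorExpansions : Submodule ℂ ((Y₂ → ℂ) × Series₂ × Series₂ × Series₂) :=
  Submodule.span ℂ {x | ∃ (α β : ℝ) (f : ℂ → ℂ) (c₀ c₁ cInf : ℝ → ℝ → ℂ),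
    (∃ n : ℤ, α - β = n) ∧ IsF01Infty f ∧
    IsExpansionAtZero c₀ f ∧
    IsExpansionAtZero c₁ (fun z => f (1 - z)⁻¹) ∧
    IsExpansionAtZero cInf (fun z => f z⁻¹) ∧
    x = (fun w => mono α β w.1.1 * f (w.1.2 / w.1.1),
      expand12 α β c₀, expand20 α β c₁, expand21 α β cInf)}

/-- `μ ∈ GCor₂`, with `μ|_{|z₁|>|z₂|} = e₁₂`, `μ|_{|z₂|>|z₁-z₂|} = e₂₀`, `μ|_{|z₂|>|z₁|} = e₂₁`. -/
def HasExpansions (μ : Y₂ → ℂ) (e₁₂ e₂₀ e₂₁ : Series₂) : Prop :=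
  (μ, e₁₂, e₂₀, e₂₁) ∈ gcorExpansions

/-! ### Full vertex algebras and their modules -/

/-- `u` belongs to `M^∨ = ⨁ (M_{h,h̄})^*`. -/
def IsGradedDual {M : Type*} [AddCommGroup M] [Module ℂ M] (gr : ℝ × ℝ → Submodule ℂ M)
    (u : M →ₗ[ℂ] ℂ) : Prop :=
  {p : ℝ × ℝ | ∃ x ∈ gr p, u x ≠ 0}.Finite

/-- The series `Y(a, z) m = ∑ a(r, s) m · z^(-r-1) z̄^(-s-1)`. -/
def series {A M : Type*} [AddCommGroup A] [Module ℂ A] [AddCommGroup M] [Module ℂ M]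
    (Y : ℝ → ℝ → A →ₗ[ℂ] M →ₗ[ℂ] M) (a : A) (m : M) : ℝ → ℝ → M :=
  fun p p' => Y (-p - 1) (-p' - 1) a m

/-- The data underlying a full vertex algebra: a family of homogeneous subspaces `F_{h,h̄}`, the
products `a(r, s) b = mode r s a b`, and a vector `𝟏`. -/
structure FullVertexData (F : Type*) [AddCommGroup F] [Module ℂ F] where
  gr : ℝ × ℝ → Submodule ℂ F
  mode : ℝ → ℝ → F →ₗ[ℂ] F →ₗ[ℂ] F
  vac : F

variable {F : Type*} [AddCommGroup F] [Module ℂ F]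

/-- Full vertex algebras. -/
structure FullVertexData.IsFullVertexAlgebra (X : FullVertexData F) : Prop where
  internal : DirectSum.IsInternal X.gr
  vac_mem : X.vac ∈ X.gr (0, 0)
  fv1 : ∀ a b, IsFormal (series X.mode a b)
  fv2 : ∀ h h' : ℝ, X.gr (h, h') ≠ ⊥ → ∃ n : ℤ, h - h' = n
  fv3_regular : ∀ a p p', series X.mode a X.vac p p' ≠ 0 → ∃ m n : ℕ, p = m ∧ p' = n
  fv3_limit : ∀ a, X.mode (-1) (-1) a X.vac = a
  fv4_id : ∀ b, X.mode (-1) (-1) X.vac b = b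
  fv4_zero : ∀ r s b, (r, s) ≠ ((-1 : ℝ), (-1 : ℝ)) → X.mode r s X.vac b = 0
  fv5 : ∀ a b c u, IsGradedDual X.gr u → ∃ μ : Y₂ → ℂ, HasExpansions μ
    (fun p p' q q' => u (X.mode (-p - 1) (-p' - 1) a (X.mode (-q - 1) (-q' - 1) b c)))
    (fun p p' q q' => u (X.mode (-q - 1) (-q' - 1) (X.mode (-p - 1) (-p' - 1) a b) c))
    (fun p p' q q' => u (X.mode (-q - 1) (-q' - 1) b (X.mode (-p - 1) (-p' - 1) a c)))
  fv6 : ∀ r s h h' k k', ∀ a ∈ X.gr (h, h'), ∀ b ∈ X.gr (k, k'),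
    X.mode r s a b ∈ X.gr (h + k - r - 1, h' + k' - s - 1)

/-- The graded space `(M, gr)` with the operators `a(r, s) = Y r s a` is a module of the full
vertex algebra `X`. -/
structure FullVertexData.IsModule (X : FullVertexData F)
    {M : Type*} [AddCommGroup M] [Module ℂ M] (gr : ℝ × ℝ → Submodule ℂ M)
    (Y : ℝ → ℝ → F →ₗ[ℂ] M →ₗ[ℂ] M) : Prop where
  internal : DirectSum.IsInternal gr
  fm1 : ∀ a m, IsFormal (series Y a m)
  fm2_id : ∀ m, Y (-1) (-1) X.vac m = m
  fm2_zero : ∀ r s m, (r, s) ≠ ((-1 : ℝ), (-1 : ℝ)) → Y r s X.vac m = 0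
  fm3 : ∀ a b m u, IsGradedDual gr u → ∃ μ : Y₂ → ℂ, HasExpansions μ
    (fun p p' q q' => u (Y (-p - 1) (-p' - 1) a (Y (-q - 1) (-q' - 1) b m)))
    (fun p p' q q' => u (Y (-q - 1) (-q' - 1) (X.mode (-p - 1) (-p' - 1) a b) m))
    (fun p p' q q' => u (Y (-q - 1) (-q' - 1) b (Y (-p - 1) (-p' - 1) a m)))
  fm4 : ∀ r s h h' k k', ∀ a ∈ X.gr (h, h'), ∀ m ∈ gr (k, k'),
    Y r s a m ∈ gr (h + k - r - 1, h' + k' - s - 1)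

/-- Homomorphisms of full vertex algebras. -/
structure IsHom {G : Type*} [AddCommGroup G] [Module ℂ G] (X : FullVertexData F)
    (X' : FullVertexData G) (f : F →ₗ[ℂ] G) : Prop where
  map_vac : f X.vac = X'.vac
  map_mode : ∀ r s a b, f (X.mode r s a b) = X'.mode r s (f a) (f b)

/-- `D a = a(-2, -1) 𝟏`. -/
def FullVertexData.D (X : FullVertexData F) : F →ₗ[ℂ] F := (X.mode (-2) (-1)).flip X.vac

/-- `D̄ a = a(-1, -2) 𝟏`. -/
def FullVertexData.Dbar (X : FullVertexData F) : F →ₗ[ℂ] F := (X.mode (-1) (-2)).flip X.vac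

/-- `S` is a (graded) subalgebra. -/
structure FullVertexData.IsSubalgebra (X : FullVertexData F) (S : Submodule ℂ F) : Prop where
  graded : S = ⨆ p, S ⊓ X.gr p
  vac_mem : X.vac ∈ S
  mode_mem : ∀ r s, ∀ a ∈ S, ∀ b ∈ S, X.mode r s a b ∈ S

/-- The structure induced on a subalgebra. -/
def FullVertexData.restrict (X : FullVertexData F) (S : Submodule ℂ F) (hS : X.IsSubalgebra S) :
    FullVertexData S where
  gr p := (X.gr p).comap S.subtype
  mode r s := LinearMap.mk₂ ℂ (fun a b : S => (⟨X.mode r s a b, hS.mode_mem r s a a.2 b b.2⟩ : S))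
    (fun _ _ _ => by ext; simp) (fun _ _ _ => by ext; simp)
    (fun _ _ _ => by ext; simp) (fun _ _ _ => by ext; simp)
  vac := ⟨X.vac, hS.vac_mem⟩

/-! ### Tensor products -/

section Tensor

variable {F₁ F₂ : Type*} [AddCommGroup F₁] [Module ℂ F₁] [AddCommGroup F₂] [Module ℂ F₂]

/-- The contribution `a(p₁, p₂) c ⊗ b(r - 1 - p₁, s - 1 - p₂) d` to `(a ⊗ b)(r, s) (c ⊗ d)`. -/
def tensorTerm (X₁ : FullVertexData F₁) (X₂ : FullVertexData F₂) (r s : ℝ) (p : ℝ × ℝ) :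
    F₁ ⊗[ℂ] F₂ →ₗ[ℂ] F₁ ⊗[ℂ] F₂ →ₗ[ℂ] F₁ ⊗[ℂ] F₂ :=
  TensorProduct.map₂ (X₁.mode p.1 p.2) (X₂.mode (r - 1 - p.1) (s - 1 - p.2))

theorem tensorTerm_finite (X₁ : FullVertexData F₁) (X₂ : FullVertexData F₂)
    (h₁ : ∀ a b, IsFormal (series X₁.mode a b)) (h₂ : ∀ a b, IsFormal (series X₂.mode a b))
    (r s : ℝ) (x y : F₁ ⊗[ℂ] F₂) :
    (Function.support fun p => tensorTerm X₁ X₂ r s p x y).Finite := by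
  induction x with
  | zero => simp
  | add x x' hx hx' =>
    refine (hx.union hx').subset ?_
    simp only [map_add, LinearMap.add_apply]
    exact Function.support_add _ _
  | tmul a b =>
    induction y with
    | zero => simp
    | add y y' hy hy' =>
      refine (hy.union hy').subset ?_
      simp only [map_add]
      exact Function.support_add _ _
    | tmul c d =>
      obtain ⟨N, hN⟩ := (h₂ b d).bounded
      have hfin := (h₁ a c).finite (-2 * N - r - s - 2)
      have hinj : Function.Injective (fun p : ℝ × ℝ => ((-p.1 - 1, -p.2 - 1) : ℝ × ℝ)) := by
        rintro ⟨p, q⟩ ⟨p', q'⟩ h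
        simp only [Prod.mk.injEq] at h ⊢
        constructor <;> linarith [h.1, h.2]
      refine (hfin.preimage hinj.injOn).subset ?_
      rintro ⟨p, q⟩ hp
      simp only [Function.mem_support, tensorTerm, TensorProduct.map₂_apply_tmul] at hp
      have ha : X₁.mode p q a c ≠ 0 := fun h => hp (by simp [h])
      have hb : X₂.mode (r - 1 - p) (s - 1 - q) b d ≠ 0 := fun h => hp (by simp [h])
      have e1 : -(-p - 1) - 1 = p := by ring
      have e2 : -(-q - 1) - 1 = q := by ring
      have e3 : -(-r + p) - 1 = r - 1 - p := by ring
      have e4 : -(-s + q) - 1 = s - 1 - q := by ring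
      have hb' := hN (-r + p) (-s + q) (by simp only [series, e3, e4]; exact hb)
      refine ⟨by simp only [series, e1, e2]; exact ha, ?_⟩
      dsimp only
      linarith [hb'.1, hb'.2]

/-- The tensor product, with `Y(a ⊗ b, z) = Y(a, z) ⊗ Y(b, z)`. The condition (FV1) on the two
factors makes the sum defining each coefficient finite. -/
def tensor (X₁ : FullVertexData F₁) (X₂ : FullVertexData F₂)
    (h₁ : ∀ a b, IsFormal (series X₁.mode a b)) (h₂ : ∀ a b, IsFormal (series X₂.mode a b)) :
    FullVertexData (F₁ ⊗[ℂ] F₂) where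
  gr p := ⨆ q : ℝ × ℝ,
    LinearMap.range (TensorProduct.map (X₁.gr q).subtype (X₂.gr (p - q)).subtype)
  mode r s := LinearMap.mk₂ ℂ (fun x y => ∑ᶠ p : ℝ × ℝ, tensorTerm X₁ X₂ r s p x y)
    (fun x x' y => by
      simp only [map_add, LinearMap.add_apply]
      exact finsum_add_distrib (tensorTerm_finite X₁ X₂ h₁ h₂ r s x y)
        (tensorTerm_finite X₁ X₂ h₁ h₂ r s x' y))
    (fun k x y => by
      simp only [map_smul, LinearMap.smul_apply]
      exact (smul_finsum k _).symm)
    (fun x y y' => by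
      simp only [map_add]
      exact finsum_add_distrib (tensorTerm_finite X₁ X₂ h₁ h₂ r s x y)
        (tensorTerm_finite X₁ X₂ h₁ h₂ r s x y'))
    (fun k x y => by
      simp only [map_smul]
      exact (smul_finsum k _).symm)
  vac := X₁.vac ⊗ₜ[ℂ] X₂.vac

end Tensor

/-- The linear map `S ⊗ T → F`, `a ⊗ b ↦ a(-1, -1) b`. -/
def FullVertexData.productMap (X : FullVertexData F) (S T : Submodule ℂ F) :
    S ⊗[ℂ] T →ₗ[ℂ] F :=
  TensorProduct.lift ((X.mode (-1) (-1)).compl₁₂ S.subtype T.subtype)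

/-! ### Vertex algebras and their modules -/

/-- `M` with `Y_M(a, z) = ∑ a_n z^(-n-1)`, `a_n = YM n a`, satisfies the axioms (truncation,
vacuum, Borcherds identity) of a module over `(V, Y, 𝟏)`. All sums in the Borcherds identity are
finite because of the truncation property (of `Y` and `YM`). -/
structure IsVertexModule {V M : Type*} [AddCommGroup V] [Module ℂ V] [AddCommGroup M] [Module ℂ M]
    (Y : ℤ → V →ₗ[ℂ] V →ₗ[ℂ] V) (vac : V) (YM : ℤ → V →ₗ[ℂ] M →ₗ[ℂ] M) : Prop where
  truncation : ∀ a m, ∃ N : ℤ, ∀ n ≥ N, YM n a m = 0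
  vacuum_id : ∀ m, YM (-1) vac m = m
  vacuum_zero : ∀ n m, n ≠ -1 → YM n vac m = 0
  borcherds : ∀ (k l n : ℤ) (a b : V) (m : M),
    ∑ᶠ i : ℕ, Ring.choose l i • YM (l + n - i) (Y (k + i) a b) m =
      ∑ᶠ i : ℕ, ((-1 : ℤ) ^ i * Ring.choose k i) •
        (YM (l + k - i) a (YM (n + i) b m) -
          ((-1 : ℂ) ^ k) • YM (n + k - i) b (YM (l + i) a m))

/-- Vertex algebras over `ℂ`, with `Y(a, z) = ∑ a_n z^(-n-1)`, `a_n = Y n a`. -/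
structure IsVertexAlgebra {V : Type*} [AddCommGroup V] [Module ℂ V]
    (Y : ℤ → V →ₗ[ℂ] V →ₗ[ℂ] V) (vac : V) : Prop extends IsVertexModule Y vac Y where
  creation_regular : ∀ a, ∀ n ≥ 0, Y n a vac = 0
  creation_limit : ∀ a, Y (-1) a vac = a

end FullVA

end

/-!
The two-point functions of a full vertex algebra are graded, so only their homogeneous components
matter. A component of bidegree `(α, β)` is a function `F(z₁, z₂) = z₁^α z̄₁^β f(z₂/z₁)` with
`f ∈ F_{0,1,∞}`, and its three expansions are the expansions at `z = 0` of `F(1, z)`, `F(1 + z, 1)`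
and `F(z, 1)` (`IsCorrelation`). An expansion determines the germ of its sum and conversely
(`IsExpansionAtZero.unique`), and `f`, being real analytic on the connected set `ℂ \ {0, 1}`, is
determined by its germ at a puncture. Hence each of the three series determines the other two.

For `b = 𝟏` the series in `|z₁| > |z₂|` is constant, so the one in `|z₂| > |z₁ - z₂|` is a binomial
series; comparing coefficients gives `Y(D̄a, z) = ∂̄ Y(a, z)` (`mode_Dbar`). If `D̄a = 0`, only the
modes `a(n, -1)`, `n ∈ ℤ`, survive. For such `a` and arbitrary `b`, the function `F(z, 1)` is
holomorphic near `0`, hence on `ℂ \ {0, 1}` by the identity theorem applied to the Cauchy-Riemann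
equation, and it has poles at `0`, `1`, `∞`. The residues of `z^l (z - 1)^k F(z, 1)` add up to zero
(`residue_theorem`), which is the Borcherds identity (`borcherds`). It shows that `ker D̄` is a
subalgebra and a vertex algebra, and that `F` is a module over it. The axioms of a full vertex algebra
pass to graded subalgebras because elements of the graded dual extend, and everything about `ker D`
follows by exchanging `z` and `z̄`.

For `a ∈ ker D̄` and `b ∈ ker D` a descending induction with the Borcherds identity gives
`a(n, -1) b = 0` for `n ≥ 0`. Hence the fields commute (`mode_comm`) and
`Y(a(-1, -1) b, z) = Y(a, z) Y(b, z)` (`mode_product`), which makes `a ⊗ b ↦ a(-1, -1) b`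
a homomorphism.

The substantial axiom for `ker D̄ ⊗ ker D` is the existence of correlation functions. A functional on
the tensor product need not be a sum of tensor products of functionals, but by the Borcherds identity the
coefficients of given bidegree of a holomorphic two-point function span a finite dimensional space
(`hasFiniteSpan`). In coordinates of these spaces the required functions are finite sums of products
of correlation functions of the two factors (`tensor_isCorrelation`).
-/

namespace FullVA

open Filter Topology

/-! ### The monomials `z^s z̄^t` -/

theorem mono_eq {s t : ℝ} {n : ℤ} (h : s - t = n) (z : ℂ) :
    mono s t z = z ^ n * ((‖z‖ ^ (2 * t) : ℝ) : ℂ) := by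
  simp [mono, h]

theorem norm_mono {s t : ℝ} (h : ∃ n : ℤ, s - t = n) {z : ℂ} (hz : z ≠ 0) :
    ‖mono s t z‖ = ‖z‖ ^ (s + t) := by
  obtain ⟨n, h⟩ := h
  have hz' : 0 < ‖z‖ := norm_pos_iff.2 hz
  rw [mono_eq h, norm_mul, norm_zpow, Complex.norm_real, Real.norm_of_nonneg (by positivity),
    ← Real.rpow_intCast, ← Real.rpow_add hz', ← h]
  congr 1
  ring

theorem mono_add {s t s' t' : ℝ} (h : ∃ n : ℤ, s - t = n) (h' : ∃ n : ℤ, s' - t' = n) {z : ℂ}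
    (hz : z ≠ 0) : mono (s + s') (t + t') z = mono s t z * mono s' t' z := by
  obtain ⟨n, h⟩ := h
  obtain ⟨n', h'⟩ := h'
  have hz' : 0 < ‖z‖ := norm_pos_iff.2 hz
  have e : s + s' - (t + t') = ((n + n' : ℤ) : ℝ) := by push_cast; linarith
  rw [mono_eq h, mono_eq h', mono_eq e, zpow_add₀ hz, mul_add, Real.rpow_add hz']
  push_cast
  ring

theorem mono_mul {s t : ℝ} (h : ∃ n : ℤ, s - t = n) (z w : ℂ) :
    mono s t (z * w) = mono s t z * mono s t w := by
  obtain ⟨n, h⟩ := h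
  rw [mono_eq h, mono_eq h, mono_eq h, mul_zpow, norm_mul,
    Real.mul_rpow (norm_nonneg _) (norm_nonneg _)]
  push_cast
  ring

theorem mono_ne_zero {s t : ℝ} {z : ℂ} (hz : z ≠ 0) : mono s t z ≠ 0 := by
  have : 0 < ‖z‖ := norm_pos_iff.2 hz
  refine mul_ne_zero (zpow_ne_zero _ hz) ?_
  exact_mod_cast (Real.rpow_pos_of_pos this _).ne'

theorem mono_inv {s t : ℝ} (h : ∃ n : ℤ, s - t = n) {z : ℂ} (hz : z ≠ 0) :
    mono s t z⁻¹ * mono s t z = 1 := by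
  rw [← mono_mul h, inv_mul_cancel₀ hz]
  simp [mono]

theorem mono_int_zero (n : ℤ) (z : ℂ) : mono n 0 z = z ^ n := by
  simp [mono]

theorem mono_zero_zero (z : ℂ) : mono 0 0 z = 1 := by
  simp [mono]

/-- Complex conjugation of the variable exchanges the two exponents. -/
theorem mono_conj {s t : ℝ} (h : ∃ n : ℤ, s - t = n) {z : ℂ} (hz : z ≠ 0) :
    mono s t (starRingEnd ℂ z) = mono t s z := by
  obtain ⟨n, h⟩ := h
  have hz' : 0 < ‖z‖ := norm_pos_iff.2 hz
  have hs : 2 * s = 2 * t + 2 * (n : ℝ) := by linarith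
  have e : t - s = ((-n : ℤ) : ℝ) := by push_cast; linarith
  rw [mono_eq h, mono_eq e, RCLike.norm_conj, hs, Real.rpow_add hz', ← map_zpow₀]
  have key : z ^ n * starRingEnd ℂ (z ^ n) = ((‖z‖ ^ (2 * (n : ℝ)) : ℝ) : ℂ) := by
    rw [Complex.mul_conj, Complex.normSq_eq_norm_sq, norm_zpow, mul_comm 2 (n : ℝ),
      Real.rpow_mul hz'.le, Real.rpow_intCast, Real.rpow_two]
  rw [zpow_neg]
  push_cast at key ⊢
  rw [← key]
  field_simp [zpow_ne_zero n hz]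

/-- Polar coordinates. -/
theorem mono_polar {s t : ℝ} {n : ℤ} (h : s - t = n) {r : ℝ} (hr : 0 < r) {w : ℂ} (hw : ‖w‖ = 1) :
    mono s t (r * w) = ((r ^ (s + t) : ℝ) : ℂ) * w ^ n := by
  rw [mono_mul ⟨n, h⟩, mono_eq h, mono_eq h, hw, Complex.norm_real, Real.norm_of_nonneg hr.le]
  have : s + t = n + 2 * t := by linarith
  rw [this, Real.rpow_add hr, Real.rpow_intCast]
  simp

theorem analyticAt_mono (s t : ℝ) {z : ℂ} (hz : z ≠ 0) : AnalyticAt ℝ (mono s t) z := by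
  have h1 : AnalyticAt ℝ (fun z : ℂ => z ^ ⌊s - t⌋) z :=
    (analyticAt_id.zpow (𝕜 := ℂ) hz).restrictScalars
  have h2 : AnalyticAt ℝ (fun z : ℂ => Complex.normSq z) z := by
    have hre : AnalyticAt ℝ (fun z : ℂ => z.re) z := Complex.reCLM.analyticAt z
    have him : AnalyticAt ℝ (fun z : ℂ => z.im) z := Complex.imCLM.analyticAt z
    simpa only [Complex.normSq_apply] using! (hre.mul hre).add (him.mul him)
  have hpos : 0 < Complex.normSq z := Complex.normSq_pos.2 hz
  have hlog : AnalyticAt ℝ (fun z : ℂ => Real.log (Complex.normSq z)) z :=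
    (analyticAt_log hpos).comp h2
  have h3 : AnalyticAt ℝ (fun z : ℂ => Real.exp (t * Real.log (Complex.normSq z))) z :=
    (analyticAt_const.fun_mul hlog).rexp'
  have h4 : AnalyticAt ℝ (fun z : ℂ => ((‖z‖ ^ (2 * t) : ℝ) : ℂ)) z := by
    refine AnalyticAt.congr ((Complex.ofRealCLM.analyticAt _).comp h3) ?_
    filter_upwards [isOpen_ne.mem_nhds hz] with w hw
    have hw' : 0 < ‖w‖ := norm_pos_iff.2 hw
    simp only [Function.comp, Complex.ofRealCLM_apply]
    rw [Complex.normSq_eq_norm_sq, Real.rpow_def_of_pos hw', Real.log_pow]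
    congr 2
    push_cast
    ring
  exact h1.mul h4

/-! ### Formal series -/

theorem IsFormal.zero {V : Type*} [Zero V] : IsFormal (fun _ _ => 0 : ℝ → ℝ → V) :=
  ⟨by simp, by simp, 0, by simp⟩

theorem IsFormal.of_support {V W : Type*} [Zero V] [Zero W] {c : ℝ → ℝ → V} {d : ℝ → ℝ → W}
    (hc : IsFormal c) (h : ∀ s t, d s t ≠ 0 → c s t ≠ 0) : IsFormal d :=
  ⟨fun s t hd => hc.integral s t (h s t hd),
    fun H => (hc.finite H).subset fun _ hp => ⟨h _ _ hp.1, hp.2⟩,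
    hc.bounded.imp fun _ hN s t hd => hN s t (h s t hd)⟩

theorem IsFormal.add {V : Type*} [AddCommGroup V] {c d : ℝ → ℝ → V}
    (hc : IsFormal c) (hd : IsFormal d) : IsFormal (fun s t => c s t + d s t) := by
  have key : ∀ s t, c s t + d s t ≠ 0 → c s t ≠ 0 ∨ d s t ≠ 0 := by
    intro s t h
    by_contra! h'
    exact h (by rw [h'.1, h'.2, add_zero])
  refine ⟨fun s t h => ?_, fun H => ?_, ?_⟩
  · rcases key s t h with h | h
    · exact hc.integral s t h
    · exact hd.integral s t h
  · refine ((hc.finite H).union (hd.finite H)).subset fun p hp => ?_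
    exact (key _ _ hp.1).imp (fun h => ⟨h, hp.2⟩) (fun h => ⟨h, hp.2⟩)
  · obtain ⟨N, hN⟩ := hc.bounded
    obtain ⟨N', hN'⟩ := hd.bounded
    refine ⟨min N N', fun s t h => ?_⟩
    rcases key s t h with h | h
    · exact ⟨(min_le_left _ _).trans (hN s t h).1, (min_le_left _ _).trans (hN s t h).2⟩
    · exact ⟨(min_le_right _ _).trans (hN' s t h).1, (min_le_right _ _).trans (hN' s t h).2⟩

theorem IsFormal.swap {V : Type*} [Zero V] {c : ℝ → ℝ → V} (hc : IsFormal c) :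
    IsFormal (fun s t => c t s) := by
  refine ⟨fun s t h => ?_, fun H => ?_, ?_⟩
  · obtain ⟨n, hn⟩ := hc.integral t s h
    exact ⟨-n, by push_cast; linarith⟩
  · refine ((hc.finite H).preimage (f := Prod.swap) Prod.swap_injective.injOn).subset ?_
    rintro ⟨s, t⟩ ⟨h1, h2⟩
    exact ⟨h1, by simpa [add_comm] using h2⟩
  · obtain ⟨N, hN⟩ := hc.bounded
    exact ⟨N, fun s t h => (hN t s h).symm⟩

/-- The product of two formal series, with coefficients in `ℂ`. -/
noncomputable def conv (c d : ℝ → ℝ → ℂ) : ℝ → ℝ → ℂ := fun s t =>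
  ∑ᶠ p : ℝ × ℝ, c p.1 p.2 * d (s - p.1) (t - p.2)

theorem IsFormal.conv_support_finite {c d : ℝ → ℝ → ℂ} (hc : IsFormal c) (hd : IsFormal d)
    (s t : ℝ) :
    (Function.support fun p : ℝ × ℝ => c p.1 p.2 * d (s - p.1) (t - p.2)).Finite := by
  obtain ⟨N, hN⟩ := hd.bounded
  refine (hc.finite (s + t - 2 * N)).subset fun p hp => ?_
  have h1 := left_ne_zero_of_mul hp
  have h2 := hN _ _ (right_ne_zero_of_mul hp)
  exact ⟨h1, by linarith [h2.1, h2.2]⟩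

theorem exists_of_conv_ne_zero {c d : ℝ → ℝ → ℂ} {s t : ℝ} (h : conv c d s t ≠ 0) :
    ∃ p : ℝ × ℝ, c p.1 p.2 ≠ 0 ∧ d (s - p.1) (t - p.2) ≠ 0 := by
  by_contra! h'
  refine h (finsum_eq_zero_of_forall_eq_zero fun p => ?_)
  by_cases hp : c p.1 p.2 = 0
  · rw [hp, zero_mul]
  · rw [h' p hp, mul_zero]

theorem IsFormal.conv {c d : ℝ → ℝ → ℂ} (hc : IsFormal c) (hd : IsFormal d) :
    IsFormal (conv c d) := by
  obtain ⟨N, hN⟩ := hc.bounded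
  obtain ⟨N', hN'⟩ := hd.bounded
  refine ⟨fun s t h => ?_, fun H => ?_, N + N', fun s t h => ?_⟩
  · obtain ⟨p, h1, h2⟩ := exists_of_conv_ne_zero h
    obtain ⟨n, hn⟩ := hc.integral _ _ h1
    obtain ⟨m, hm⟩ := hd.integral _ _ h2
    exact ⟨n + m, by push_cast; linarith⟩
  · refine (((hc.finite (H - 2 * N')).prod (hd.finite (H - 2 * N))).image
      (fun x : (ℝ × ℝ) × (ℝ × ℝ) => x.1 + x.2)).subset ?_
    rintro ⟨s, t⟩ ⟨h, hH⟩
    obtain ⟨p, h1, h2⟩ := exists_of_conv_ne_zero h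
    have b1 := hN _ _ h1
    have b2 := hN' _ _ h2
    dsimp only at hH
    refine ⟨(p, (s - p.1, t - p.2)), ⟨⟨h1, ?_⟩, ⟨h2, ?_⟩⟩, by ext <;> simp⟩
    · linarith [b2.1, b2.2]
    · dsimp only
      linarith [b1.1, b1.2]
  · obtain ⟨p, h1, h2⟩ := exists_of_conv_ne_zero h
    have b1 := hN _ _ h1
    have b2 := hN' _ _ h2
    constructor <;> linarith [b1.1, b1.2, b2.1, b2.2]

/-! ### Convergent expansions at the origin -/

theorem summable_of_radius_le {c : ℝ → ℝ → ℂ} (hc : IsFormal c) {r R : ℝ} (hr : 0 < r)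
    (hrR : r ≤ R) (h : Summable (fun p : ℝ × ℝ => ‖c p.1 p.2‖ * R ^ (p.1 + p.2))) :
    Summable (fun p : ℝ × ℝ => ‖c p.1 p.2‖ * r ^ (p.1 + p.2)) := by
  obtain ⟨N, hN⟩ := hc.bounded
  have hR := hr.trans_le hrR
  refine Summable.of_nonneg_of_le (fun p => by positivity) (fun p => ?_)
    (h.mul_left ((r / R) ^ (2 * N)))
  by_cases h0 : c p.1 p.2 = 0
  · simp [h0]
  have hb := hN _ _ h0
  have e : r ^ (p.1 + p.2) = (r / R) ^ (p.1 + p.2) * R ^ (p.1 + p.2) := by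
    rw [← Real.mul_rpow (by positivity) hR.le, div_mul_cancel₀ _ hR.ne']
  have : (r / R) ^ (p.1 + p.2) ≤ (r / R) ^ (2 * N) :=
    Real.rpow_le_rpow_of_exponent_ge (by positivity) ((div_le_one hR).2 hrR)
      (by linarith [hb.1, hb.2])
  rw [e]
  calc ‖c p.1 p.2‖ * ((r / R) ^ (p.1 + p.2) * R ^ (p.1 + p.2))
      = (r / R) ^ (p.1 + p.2) * (‖c p.1 p.2‖ * R ^ (p.1 + p.2)) := by ring
    _ ≤ _ := by gcongr

theorem norm_coeff_mul_mono {c : ℝ → ℝ → ℂ} (hc : IsFormal c) {z : ℂ} (hz : z ≠ 0) (p : ℝ × ℝ) :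
    ‖c p.1 p.2 * mono p.1 p.2 z‖ = ‖c p.1 p.2‖ * ‖z‖ ^ (p.1 + p.2) := by
  by_cases h0 : c p.1 p.2 = 0
  · simp [h0]
  · rw [norm_mul, norm_mono (hc.integral _ _ h0) hz]

theorem hasSum_of_eq {ι : Type*} {f g : ι → ℂ} {a : ℂ} (h : HasSum f a) (e : ∀ x, f x = g x) :
    HasSum g a :=
  funext e ▸ h

theorem IsExpansionAtZero.congr {c : ℝ → ℝ → ℂ} {g h : ℂ → ℂ} (hg : IsExpansionAtZero c g)
    (hgh : ∀ᶠ z in 𝓝[≠] 0, g z = h z) : IsExpansionAtZero c h := by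
  obtain ⟨hc, R, hR, hs, hz⟩ := hg
  rw [eventually_nhdsWithin_iff, Metric.eventually_nhds_iff] at hgh
  obtain ⟨ε, hε, hgh⟩ := hgh
  refine ⟨hc, min R ε, by positivity, summable_of_radius_le hc (by positivity) (min_le_left _ _) hs,
    fun z h0 hlt => ?_⟩
  rw [← hgh (by simpa using hlt.trans_le (min_le_right _ _)) h0]
  exact hz z h0 (hlt.trans_le (min_le_left _ _))

theorem IsExpansionAtZero.add {c d : ℝ → ℝ → ℂ} {g h : ℂ → ℂ} (hg : IsExpansionAtZero c g)
    (hh : IsExpansionAtZero d h) :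
    IsExpansionAtZero (fun s t => c s t + d s t) (fun z => g z + h z) := by
  obtain ⟨hc, R, hR, hs, hz⟩ := hg
  obtain ⟨hd, R', hR', hs', hz'⟩ := hh
  refine ⟨hc.add hd, min R R', by positivity, ?_, fun z h0 hlt => ?_⟩
  · refine Summable.of_nonneg_of_le (fun p => by positivity) (fun p => ?_)
      ((summable_of_radius_le hc (by positivity) (min_le_left R R') hs).add
        (summable_of_radius_le hd (by positivity) (min_le_right R R') hs'))
    rw [← add_mul]
    gcongr
    exact norm_add_le _ _
  · simp only [add_mul]
    exact (hz z h0 (hlt.trans_le (min_le_left _ _))).add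
      (hz' z h0 (hlt.trans_le (min_le_right _ _)))

theorem IsExpansionAtZero.const_mul {c : ℝ → ℝ → ℂ} {g : ℂ → ℂ} (k : ℂ)
    (hg : IsExpansionAtZero c g) :
    IsExpansionAtZero (fun s t => k * c s t) (fun z => k * g z) := by
  obtain ⟨hc, R, hR, hs, hz⟩ := hg
  refine ⟨hc.of_support fun s t h => right_ne_zero_of_mul h, R, hR, ?_, fun z h0 hlt => ?_⟩
  · simpa only [norm_mul, mul_assoc] using hs.mul_left ‖k‖
  · simpa only [mul_assoc] using (hz z h0 hlt).mul_left k

theorem IsExpansionAtZero.zero : IsExpansionAtZero (fun _ _ => 0) (fun _ => 0) :=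
  ⟨IsFormal.zero, 1, one_pos, by simp, fun z _ _ => by
    simp⟩

/-- Exchange of `z` and `z̄`. -/
theorem IsExpansionAtZero.swap {c : ℝ → ℝ → ℂ} {g : ℂ → ℂ} (hg : IsExpansionAtZero c g) :
    IsExpansionAtZero (fun s t => c t s) (fun z => g (starRingEnd ℂ z)) := by
  obtain ⟨hc, R, hR, hs, hz⟩ := hg
  refine ⟨hc.swap, R, hR, ?_, fun z h0 hlt => ?_⟩
  · rw [← (Equiv.prodComm ℝ ℝ).summable_iff] at hs
    refine hs.congr fun p => ?_
    simp [add_comm]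
  · have := hz (starRingEnd ℂ z) (by simpa using h0) (by simpa using hlt)
    rw [← (Equiv.prodComm ℝ ℝ).hasSum_iff] at this
    refine hasSum_of_eq this fun p => ?_
    dsimp
    by_cases h : c p.2 p.1 = 0
    · simp [h]
    · rw [mono_conj (hc.integral _ _ h) h0]

theorem IsExpansionAtZero.mul {c d : ℝ → ℝ → ℂ} {g h : ℂ → ℂ} (hg : IsExpansionAtZero c g)
    (hh : IsExpansionAtZero d h) : IsExpansionAtZero (conv c d) (fun z => g z * h z) := by
  obtain ⟨hc, R₁, hR₁, hs₁, hz₁⟩ := hg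
  obtain ⟨hd, R₂, hR₂, hs₂, hz₂⟩ := hh
  set R := min R₁ R₂ with hRdef
  have hR : 0 < R := by positivity
  have hs₁ := summable_of_radius_le hc hR (min_le_left R₁ R₂) hs₁
  have hs₂ := summable_of_radius_le hd hR (min_le_right R₁ R₂) hs₂
  -- the change of variables `(P, p) ↦ (p, P - p)`
  let e : (ℝ × ℝ) × (ℝ × ℝ) ≃ (ℝ × ℝ) × (ℝ × ℝ) :=
    { toFun := fun x => (x.2, x.1 - x.2)
      invFun := fun x => (x.1 + x.2, x.1)
      left_inv := fun x => by simp
      right_inv := fun x => by simp }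
  refine ⟨hc.conv hd, R, hR, ?_, fun z h0 hlt => ?_⟩
  · have H := hs₁.mul_of_nonneg hs₂ (fun p => by positivity) (fun p => by positivity)
    rw [← e.summable_iff] at H
    have H' : Summable fun x : (ℝ × ℝ) × (ℝ × ℝ) =>
        ‖c x.2.1 x.2.2 * d (x.1.1 - x.2.1) (x.1.2 - x.2.2)‖ * R ^ (x.1.1 + x.1.2) := by
      refine H.congr fun x => ?_
      have : R ^ (x.1.1 + x.1.2) =
          R ^ (x.2.1 + x.2.2) * R ^ (x.1.1 - x.2.1 + (x.1.2 - x.2.2)) := by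
        rw [← Real.rpow_add hR]
        congr 1
        ring
      rw [norm_mul, this]
      simp only [Function.comp, e, Equiv.coe_fn_mk, Prod.fst_sub, Prod.snd_sub]
      ring
    refine Summable.of_nonneg_of_le (fun p => by positivity) (fun p => ?_) H'.prod
    have hf := hc.conv_support_finite hd p.1 p.2
    have hsn : Summable fun q : ℝ × ℝ => ‖c q.1 q.2 * d (p.1 - q.1) (p.2 - q.2)‖ :=
      summable_of_hasFiniteSupport (hf.subset fun q hq => by simpa using hq)
    dsimp only
    rw [tsum_mul_right]
    gcongr
    rw [FullVA.conv, ← tsum_eq_finsum (L := SummationFilter.unconditional _) hf]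
    exact norm_tsum_le_tsum_norm hsn
  · have hz' : 0 < ‖z‖ := norm_pos_iff.2 h0
    have A := hz₁ z h0 (hlt.trans_le (min_le_left _ _))
    have B := hz₂ z h0 (hlt.trans_le (min_le_right _ _))
    have A' : Summable fun p : ℝ × ℝ => ‖c p.1 p.2 * mono p.1 p.2 z‖ := by
      simp only [norm_coeff_mul_mono hc h0]
      exact summable_of_radius_le hc hz' hlt.le hs₁
    have B' : Summable fun p : ℝ × ℝ => ‖d p.1 p.2 * mono p.1 p.2 z‖ := by
      simp only [norm_coeff_mul_mono hd h0]
      exact summable_of_radius_le hd hz' hlt.le hs₂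
    have H : HasSum (fun x : (ℝ × ℝ) × (ℝ × ℝ) => c x.1.1 x.1.2 * mono x.1.1 x.1.2 z *
        (d x.2.1 x.2.2 * mono x.2.1 x.2.2 z)) (g z * h z) :=
      HasSum.mul (f := fun p : ℝ × ℝ => c p.1 p.2 * mono p.1 p.2 z)
        (g := fun p : ℝ × ℝ => d p.1 p.2 * mono p.1 p.2 z) A B
        (summable_mul_of_summable_norm (f := fun p : ℝ × ℝ => c p.1 p.2 * mono p.1 p.2 z)
          (g := fun p : ℝ × ℝ => d p.1 p.2 * mono p.1 p.2 z) A' B')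
    rw [← e.hasSum_iff] at H
    have H' : HasSum (fun x : (ℝ × ℝ) × (ℝ × ℝ) =>
        c x.2.1 x.2.2 * d (x.1.1 - x.2.1) (x.1.2 - x.2.2) * mono x.1.1 x.1.2 z) (g z * h z) := by
      refine hasSum_of_eq H fun x => ?_
      simp only [Function.comp, e, Equiv.coe_fn_mk, Prod.fst_sub, Prod.snd_sub]
      by_cases h1 : c x.2.1 x.2.2 = 0
      · simp [h1]
      by_cases h2 : d (x.1.1 - x.2.1) (x.1.2 - x.2.2) = 0
      · simp [h2]
      have := mono_add (hc.integral _ _ h1) (hd.integral _ _ h2) h0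
      rw [add_sub_cancel, add_sub_cancel] at this
      rw [this]
      ring
    refine H'.prod_fiberwise fun P => ?_
    have hf := hc.conv_support_finite hd P.1 P.2
    have S : HasSum (fun q : ℝ × ℝ => c q.1 q.2 * d (P.1 - q.1) (P.2 - q.2))
        (FullVA.conv c d P.1 P.2) := by
      rw [FullVA.conv, ← tsum_eq_finsum (L := SummationFilter.unconditional _) hf]
      exact (summable_of_hasFiniteSupport hf).hasSum
    exact S.mul_right (mono P.1 P.2 z)

/-- The substitution `z ↦ -z`. -/
theorem IsExpansionAtZero.comp_neg {c : ℝ → ℝ → ℂ} {g : ℂ → ℂ} (hg : IsExpansionAtZero c g) :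
    IsExpansionAtZero (fun s t => (-1) ^ ⌊s - t⌋ * c s t) (fun z => g (-z)) := by
  obtain ⟨hc, R, hR, hs, hz⟩ := hg
  refine ⟨hc.of_support fun s t h => right_ne_zero_of_mul h, R, hR, ?_, fun z h0 hlt => ?_⟩
  · simpa using hs
  · have := hz (-z) (by simpa using h0) (by simpa using hlt)
    refine hasSum_of_eq this fun p => ?_
    by_cases h : c p.1 p.2 = 0
    · simp [h]
    rw [← neg_one_mul z, mono_mul (hc.integral _ _ h)]
    simp [mono]
    ring

open Classical in
/-- A monomial is its own expansion. -/
theorem isExpansionAtZero_mono {α β : ℝ} (h : ∃ n : ℤ, α - β = n) :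
    IsExpansionAtZero (fun s t => if s = α ∧ t = β then 1 else 0) (mono α β) := by
  have key : ∀ s t : ℝ, (if s = α ∧ t = β then (1 : ℂ) else 0) ≠ 0 → s = α ∧ t = β := by
    intro s t hst
    by_contra h'
    exact hst (if_neg h')
  refine ⟨⟨fun s t hst => ?_, fun H => ?_, min α β, fun s t hst => ?_⟩, 1, one_pos, ?_, ?_⟩
  · obtain ⟨rfl, rfl⟩ := key s t hst
    exact h
  · refine (Set.finite_singleton (α, β)).subset ?_
    rintro ⟨s, t⟩ ⟨hst, -⟩
    obtain ⟨rfl, rfl⟩ := key s t hst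
    rfl
  · obtain ⟨rfl, rfl⟩ := key s t hst
    exact ⟨min_le_left _ _, min_le_right _ _⟩
  · refine summable_of_hasFiniteSupport ((Set.finite_singleton (α, β)).subset ?_)
    rintro ⟨s, t⟩ hst
    have := key s t (by simpa using left_ne_zero_of_mul hst)
    simp [this.1, this.2]
  · intro z _ _
    have := hasSum_single (f := fun p : ℝ × ℝ =>
      (if p.1 = α ∧ p.2 = β then (1 : ℂ) else 0) * mono p.1 p.2 z) (α, β) (by
        rintro ⟨s, t⟩ hne
        rw [if_neg (by rintro ⟨rfl, rfl⟩; exact hne rfl), zero_mul])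
    simpa using this

open Classical in
theorem conv_single {α β : ℝ} (c : ℝ → ℝ → ℂ) (s t : ℝ) :
    conv (fun s t => if s = α ∧ t = β then 1 else 0) c s t = c (s - α) (t - β) := by
  rw [conv, finsum_eq_single _ (α, β)]
  · simp
  · rintro ⟨s, t⟩ hne
    rw [if_neg (by rintro ⟨rfl, rfl⟩; exact hne rfl), zero_mul]

theorem IsExpansionAtZero.mono_mul {c : ℝ → ℝ → ℂ} {g : ℂ → ℂ} (hg : IsExpansionAtZero c g)
    {α β : ℝ} (h : ∃ n : ℤ, α - β = n) :
    IsExpansionAtZero (fun s t => c (s - α) (t - β)) (fun z => mono α β z * g z) := by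
  classical
  have := (isExpansionAtZero_mono h).mul hg
  rwa [funext₂ (conv_single c)] at this

/-! ### Uniqueness of expansions -/

/-- Distinct integral powers are linearly independent as functions on the unit circle. -/
theorem eq_zero_of_sum_mul_zpow_eq_zero {ι : Type*} {T : Finset ι} {n : ι → ℤ} {e : ι → ℂ}
    (hn : Set.InjOn n T) (h : ∀ w : ℂ, ‖w‖ = 1 → ∑ i ∈ T, e i * w ^ n i = 0) :
    ∀ i ∈ T, e i = 0 := by
  let φ : ℤ → (Circle →* ℂ) := fun k => Circle.coeHom.comp (zpowGroupHom k)
  have hφ : Function.Injective φ := by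
    intro k l hkl
    have h1 : ((Circle.exp 1 ^ k : Circle) : ℂ) = ((Circle.exp 1 ^ l : Circle) : ℂ) :=
      DFunLike.congr_fun hkl (Circle.exp 1)
    have h2 : Circle.exp (k * 1) = Circle.exp (l * 1) := by
      have := Circle.ext h1
      rwa [← Circle.exp_zsmul, ← Circle.exp_zsmul, zsmul_eq_mul, zsmul_eq_mul] at this
    obtain ⟨m, hm⟩ := Circle.exp_eq_exp.1 h2
    by_contra hne
    have hm0 : m ≠ 0 := by
      rintro rfl
      apply hne
      simpa using hm
    refine irrational_pi.ne_rat ((k - l : ℤ) / (2 * m : ℤ) : ℚ) ?_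
    have : (m : ℝ) ≠ 0 := by exact_mod_cast hm0
    push_cast
    field_simp
    linarith
  have hind := (linearIndependent_monoidHom Circle ℂ).comp φ hφ
  have hind2 : LinearIndepOn ℂ (fun k : ℤ => (φ k : Circle → ℂ)) (T.image n : Set ℤ) :=
    hind.linearIndepOn _
  classical
  intro i hi
  have := linearIndepOn_finset_iff.1 hind2
    (fun k => ∑ j ∈ T with n j = k, e j) (by
      funext w
      have hw := h w (Circle.norm_coe w)
      rw [← Finset.sum_fiberwise_of_maps_to (t := T.image n) (g := n)
        (fun x hx => Finset.mem_image_of_mem _ hx)] at hw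
      rw [Finset.sum_apply, Pi.zero_apply, ← hw]
      refine Finset.sum_congr rfl fun k _ => ?_
      rw [Pi.smul_apply, smul_eq_mul, Finset.sum_mul]
      refine Finset.sum_congr rfl fun j hj => ?_
      rw [(Finset.mem_filter.1 hj).2]
      change e j * w ^ k = e j * ((w ^ k : Circle) : ℂ)
      rw [Circle.coe_zpow]) (n i) (Finset.mem_image_of_mem _ hi)
  have hs : (T.filter fun j => n j = n i) = {i} := by
    ext j
    simp only [Finset.mem_filter, Finset.mem_singleton]
    exact ⟨fun hj => hn hj.1 hi hj.2, by rintro rfl; exact ⟨hi, rfl⟩⟩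
  simpa [hs] using this

theorem IsExpansionAtZero.eq_zero {c : ℝ → ℝ → ℂ} (h : IsExpansionAtZero c (fun _ => 0))
    (s t : ℝ) : c s t = 0 := by
  obtain ⟨hc, R, hR, hs, hz⟩ := h
  by_contra hst
  -- a nonzero coefficient of lowest total degree
  obtain ⟨p₀, ⟨hp₀, -⟩, hmin⟩ := (hc.finite (s + t)).exists_minimalFor
    (fun p => p.1 + p.2) _ ⟨(s, t), hst, le_rfl⟩
  set H := p₀.1 + p₀.2 with hH
  have hmin' : ∀ p : ℝ × ℝ, c p.1 p.2 ≠ 0 → H ≤ p.1 + p.2 := by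
    intro p hp
    by_contra! hlt
    have hle : H ≤ s + t := by
      by_contra! h'
      exact absurd (hmin (j := (s, t)) ⟨hst, le_rfl⟩ h'.le) (not_le.2 h')
    exact absurd (hmin (j := p) ⟨hp, hlt.le.trans hle⟩ hlt.le) (not_le.2 hlt)
  set T := (hc.finite H).toFinset with hT
  have hTmem : ∀ p, p ∈ T ↔ c p.1 p.2 ≠ 0 ∧ p.1 + p.2 = H := by
    intro p
    rw [hT, Set.Finite.mem_toFinset]
    exact ⟨fun hp => ⟨hp.1, le_antisymm hp.2 (hmin' p hp.1)⟩, fun hp => ⟨hp.1, hp.2.le⟩⟩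
  refine hp₀ (eq_zero_of_sum_mul_zpow_eq_zero (T := T) (n := fun p => ⌊p.1 - p.2⌋)
    (e := fun p => c p.1 p.2) ?_ ?_ p₀ ((hTmem p₀).2 ⟨hp₀, rfl⟩))
  · intro p hp q hq hpq
    rw [Finset.mem_coe, hTmem] at hp hq
    obtain ⟨n, hn⟩ := hc.integral _ _ hp.1
    obtain ⟨m, hm⟩ := hc.integral _ _ hq.1
    simp only [hn, hm, Int.floor_intCast] at hpq
    subst hpq
    ext <;> linarith [hp.2, hq.2]
  · intro w hw
    classical
    let f₀ : ℝ × ℝ → ℂ := fun p => if p ∈ T then c p.1 p.2 * w ^ ⌊p.1 - p.2⌋ else 0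
    have hsum : ∑' p, f₀ p = ∑ p ∈ T, c p.1 p.2 * w ^ ⌊p.1 - p.2⌋ := by
      rw [tsum_eq_sum (s := T) (fun p hp => if_neg hp)]
      exact Finset.sum_congr rfl fun p hp => if_pos hp
    rw [← hsum]
    have hw0 : w ≠ 0 := norm_ne_zero_iff.1 (by rw [hw]; exact one_ne_zero)
    -- rescale the vanishing sum on the ray through `w` by `r ^ (-H)` and let `r` tend to zero
    let f : ℝ → ℝ × ℝ → ℂ := fun r p => c p.1 p.2 * mono p.1 p.2 (r * w) * ((r ^ (-H) : ℝ) : ℂ)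
    have hlt : ∀ᶠ r : ℝ in 𝓝[>] 0, 0 < r ∧ r < R := by
      filter_upwards [Ioo_mem_nhdsGT hR] with r hr using hr
    have hf0 : ∀ᶠ r : ℝ in 𝓝[>] 0, ∑' p, f r p = 0 := by
      filter_upwards [hlt] with r hr
      have h0 : (r * w : ℂ) ≠ 0 := mul_ne_zero (by exact_mod_cast hr.1.ne') hw0
      have := (hz (r * w) h0 (by simpa [hw, abs_of_pos hr.1] using hr.2)).mul_right
        (((r ^ (-H) : ℝ) : ℂ))
      rw [zero_mul] at this
      exact this.tsum_eq
    have hval : ∀ r : ℝ, 0 < r → ∀ p : ℝ × ℝ, c p.1 p.2 ≠ 0 →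
        f r p = c p.1 p.2 * w ^ ⌊p.1 - p.2⌋ * ((r ^ (p.1 + p.2 - H) : ℝ) : ℂ) := by
      intro r hr p hp
      obtain ⟨n, hn⟩ := hc.integral _ _ hp
      simp only [f]
      rw [mono_polar hn hr hw, hn, Int.floor_intCast, sub_eq_add_neg (p.1 + p.2),
        Real.rpow_add hr (p.1 + p.2) (-H)]
      push_cast
      ring
    have hlim : Tendsto (fun r => ∑' p, f r p) (𝓝[>] 0) (𝓝 (∑' p, f₀ p)) := by
      refine tendsto_tsum_of_dominated_convergence
        (bound := fun p : ℝ × ℝ => ‖c p.1 p.2‖ * R ^ (p.1 + p.2) * R ^ (-H)) (hs.mul_right _) ?_ ?_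
      · intro p
        by_cases hp : c p.1 p.2 = 0
        · simp [f, f₀, hp]
        have hev : (fun r : ℝ => c p.1 p.2 * w ^ ⌊p.1 - p.2⌋ * ((r ^ (p.1 + p.2 - H) : ℝ) : ℂ))
            =ᶠ[𝓝[>] 0] fun r => f r p := by
          filter_upwards [hlt] with r hr using (hval r hr.1 p hp).symm
        refine Tendsto.congr' hev ?_
        by_cases hpT : p ∈ T
        · simp [f₀, hpT, ((hTmem p).1 hpT).2]
        · have hpos : 0 < p.1 + p.2 - H := by
            have h1 := hmin' p hp
            have h2 : p.1 + p.2 ≠ H := fun h2 => hpT ((hTmem p).2 ⟨hp, h2⟩)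
            have := lt_of_le_of_ne h1 (Ne.symm h2)
            linarith
          have : Tendsto (fun r : ℝ => r ^ (p.1 + p.2 - H)) (𝓝[>] 0) (𝓝 0) := by
            have h3 := (Real.continuousAt_rpow_const 0 _ (Or.inr hpos.le)).tendsto
            rw [Real.zero_rpow hpos.ne'] at h3
            exact h3.mono_left nhdsWithin_le_nhds
          have h4 := (Complex.continuous_ofReal.tendsto _).comp this
          simpa [f₀, hpT] using h4.const_mul (c p.1 p.2 * w ^ ⌊p.1 - p.2⌋)
      · filter_upwards [hlt] with r hr p
        by_cases hp : c p.1 p.2 = 0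
        · simp only [f, hp]
          simp
        rw [hval r hr.1 p hp, norm_mul, norm_mul, norm_zpow, hw, one_zpow, mul_one,
          Complex.norm_real, Real.norm_of_nonneg (Real.rpow_nonneg hr.1.le _), mul_assoc,
          ← Real.rpow_add hR, ← sub_eq_add_neg]
        have := hmin' p hp
        gcongr
        · exact hr.1.le
        · exact hr.2.le
    refine tendsto_nhds_unique hlim (Tendsto.congr' ?_ tendsto_const_nhds)
    filter_upwards [hf0] with r hr using hr.symm

/-- An expansion is determined by the germ of its sum. -/
theorem IsExpansionAtZero.unique {c d : ℝ → ℝ → ℂ} {g h : ℂ → ℂ} (hg : IsExpansionAtZero c g)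
    (hh : IsExpansionAtZero d h) (hgh : ∀ᶠ z in 𝓝[≠] 0, g z = h z) : c = d := by
  have := (hg.add (hh.const_mul (-1))).congr (h := fun _ => 0) (by
    filter_upwards [hgh] with z hz
    rw [hz]
    ring)
  funext s t
  have := this.eq_zero s t
  linear_combination this

/-! ### The binomial series -/

/-- The coefficients of `(1 + z)^α (1 + z̄)^β`. -/
noncomputable def binom (α β : ℝ) : ℝ → ℝ → ℂ := fun s t =>
  Function.extend (fun p : ℕ × ℕ => ((p.1 : ℝ), (p.2 : ℝ)))
    (fun p => ((Ring.choose α p.1 * Ring.choose β p.2 : ℝ) : ℂ)) 0 (s, t)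

theorem natCast_prod_injective :
    Function.Injective (fun p : ℕ × ℕ => ((p.1 : ℝ), (p.2 : ℝ))) := by
  rintro ⟨i, j⟩ ⟨i', j'⟩ h
  simpa using h

theorem binom_natCast (α β : ℝ) (i j : ℕ) :
    binom α β i j = ((Ring.choose α i * Ring.choose β j : ℝ) : ℂ) :=
  natCast_prod_injective.extend_apply (fun p : ℕ × ℕ =>
    ((Ring.choose α p.1 * Ring.choose β p.2 : ℝ) : ℂ)) 0 (i, j)

theorem binom_eq_zero (α β : ℝ) (p : ℝ × ℝ)
    (h : p ∉ Set.range (fun p : ℕ × ℕ => ((p.1 : ℝ), (p.2 : ℝ)))) : binom α β p.1 p.2 = 0 := by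
  rw [binom, Function.extend_apply' _ _ _ (by simpa [Set.mem_range] using h)]
  rfl

theorem exists_of_binom_ne_zero {α β s t : ℝ} (h : binom α β s t ≠ 0) :
    ∃ i j : ℕ, s = i ∧ t = j := by
  by_contra! h'
  refine h (binom_eq_zero α β (s, t) ?_)
  rintro ⟨⟨i, j⟩, hij⟩
  rw [Prod.mk.injEq] at hij
  exact h' i j hij.1.symm hij.2.symm

theorem hasSum_binomial (α : ℝ) {z : ℂ} (hz : ‖z‖ < 1) :
    HasSum (fun i : ℕ => ((Ring.choose α i : ℝ) : ℂ) * z ^ i) ((1 + z) ^ (α : ℂ)) := by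
  have := (Complex.one_add_cpow_hasFPowerSeriesOnBall_zero (a := (α : ℂ))).hasSum (y := z)
    (by simpa [enorm_eq_nnnorm, ← NNReal.coe_lt_coe] using hz)
  simpa only [zero_add, binomialSeries_apply, List.ofFn_const, List.prod_replicate, smul_eq_mul,
    Complex.ofReal_choose] using this

/-- Near `1`, the monomial is given by the principal branch of the power function. -/
theorem mono_one_add {α β : ℝ} (h : ∃ n : ℤ, α - β = n) {z : ℂ} (hz : ‖z‖ < 1) :
    mono α β (1 + z) = (1 + z) ^ (α : ℂ) * starRingEnd ℂ ((1 + z) ^ (β : ℂ)) := by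
  obtain ⟨n, hn⟩ := h
  have h1 : 1 + z ≠ 0 := by
    intro h
    have : z = -1 := by linear_combination h
    rw [this] at hz
    simp at hz
  have hα : (α : ℂ) = n + β := by
    rw [← Complex.ofReal_intCast, ← hn]
    push_cast
    ring
  rw [mono_eq hn, hα, Complex.cpow_add _ _ h1, Complex.cpow_intCast, mul_assoc, Complex.mul_conj,
    Complex.normSq_eq_norm_sq, Complex.norm_cpow_real, mul_comm 2 β,
    Real.rpow_mul (norm_nonneg _), Real.rpow_two]

theorem isExpansionAtZero_binom {α β : ℝ} (h : ∃ n : ℤ, α - β = n) :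
    IsExpansionAtZero (binom α β) (fun z => mono α β (1 + z)) := by
  refine ⟨⟨fun s t hst => ?_, fun H => ?_, 0, fun s t hst => ?_⟩, 1 / 2, by norm_num, ?_, ?_⟩
  · obtain ⟨i, j, rfl, rfl⟩ := exists_of_binom_ne_zero hst
    exact ⟨i - j, by push_cast; ring⟩
  · refine ((Set.finite_Iic (⌈H⌉₊, ⌈H⌉₊)).image
      (fun p : ℕ × ℕ => ((p.1 : ℝ), (p.2 : ℝ)))).subset ?_
    rintro ⟨s, t⟩ ⟨hst, hle⟩
    obtain ⟨i, j, rfl, rfl⟩ := exists_of_binom_ne_zero hst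
    dsimp only at hle
    have hi : (0 : ℝ) ≤ i := i.cast_nonneg
    have hj : (0 : ℝ) ≤ j := j.cast_nonneg
    have hH := Nat.le_ceil H
    refine ⟨(i, j), ⟨?_, ?_⟩, rfl⟩
    · exact_mod_cast (show (i : ℝ) ≤ ⌈H⌉₊ by linarith)
    · exact_mod_cast (show (j : ℝ) ≤ ⌈H⌉₊ by linarith)
  · obtain ⟨i, j, rfl, rfl⟩ := exists_of_binom_ne_zero hst
    exact ⟨i.cast_nonneg, j.cast_nonneg⟩
  · rw [← natCast_prod_injective.summable_iff (fun p hp => by rw [binom_eq_zero α β p hp]; simp)]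
    have hs : ∀ γ : ℝ, Summable fun i : ℕ => ‖((Ring.choose γ i : ℝ) : ℂ) * (1 / 2 : ℂ) ^ i‖ :=
      fun γ => (hasSum_binomial γ (by norm_num)).summable.norm
    refine ((hs α).mul_of_nonneg (hs β) (fun i => norm_nonneg _) (fun i => norm_nonneg _)).congr
      fun p => ?_
    simp only [Function.comp, binom_natCast]
    rw [Real.rpow_add (by norm_num), Real.rpow_natCast, Real.rpow_natCast]
    simp
    ring
  · intro z hz0 hz
    dsimp only
    have hz1 : ‖z‖ < 1 := hz.trans (by norm_num)
    rw [← natCast_prod_injective.hasSum_iff (fun p hp => by rw [binom_eq_zero α β p hp]; simp),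
      mono_one_add h hz1]
    have hA := hasSum_binomial α hz1
    have hB := (hasSum_binomial β hz1).star
    have := HasSum.mul (f := fun i : ℕ => ((Ring.choose α i : ℝ) : ℂ) * z ^ i)
      (g := fun i : ℕ => star (((Ring.choose β i : ℝ) : ℂ) * z ^ i)) hA hB
      (summable_mul_of_summable_norm (f := fun i : ℕ => ((Ring.choose α i : ℝ) : ℂ) * z ^ i)
      (g := fun i : ℕ => star (((Ring.choose β i : ℝ) : ℂ) * z ^ i)) hA.summable.norm
        hB.summable.norm)
    refine hasSum_of_eq this fun p => ?_
    simp only [Function.comp, binom_natCast]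
    have hm : mono (p.1 : ℝ) (p.2 : ℝ) z = z ^ p.1 * starRingEnd ℂ z ^ p.2 := by
      have h1 := mono_add (s := p.1) (t := 0) (s' := 0) (t' := p.2) ⟨p.1, by simp⟩
        ⟨-p.2, by simp⟩ hz0
      have h2 := mono_int_zero p.1 z
      have h3 := mono_int_zero p.2 (starRingEnd ℂ z)
      rw [mono_conj ⟨p.2, by simp⟩ hz0] at h3
      rw [add_zero, zero_add] at h1
      push_cast at h2 h3
      rw [h1, h2, h3, zpow_natCast, zpow_natCast]
    rw [hm]
    simp
    ring

/-! ### The algebra `F_{0,1,∞}` -/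

theorem IsF01Infty.zero : IsF01Infty (fun _ => 0) :=
  ⟨fun _ _ => analyticAt_const, fun _ _ _ _ => ⟨_, .zero⟩, fun _ _ _ _ => ⟨_, .zero⟩,
    fun _ _ _ _ => ⟨_, .zero⟩⟩

theorem IsF01Infty.add {f g : ℂ → ℂ} (hf : IsF01Infty f) (hg : IsF01Infty g) :
    IsF01Infty (fun z => f z + g z) where
  analytic z hz := (hf.analytic z hz).fun_add (hg.analytic z hz)
  at_zero ψ h h' h'' :=
    let ⟨_, hc⟩ := hf.at_zero ψ h h' h''
    let ⟨_, hd⟩ := hg.at_zero ψ h h' h''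
    ⟨_, hc.add hd⟩
  at_one ψ h h' h'' :=
    let ⟨_, hc⟩ := hf.at_one ψ h h' h''
    let ⟨_, hd⟩ := hg.at_one ψ h h' h''
    ⟨_, hc.add hd⟩
  at_infty ψ h h' h'' :=
    let ⟨_, hc⟩ := hf.at_infty ψ h h' h''
    let ⟨_, hd⟩ := hg.at_infty ψ h h' h''
    ⟨_, hc.add hd⟩

theorem IsF01Infty.mul {f g : ℂ → ℂ} (hf : IsF01Infty f) (hg : IsF01Infty g) :
    IsF01Infty (fun z => f z * g z) where
  analytic z hz := (hf.analytic z hz).fun_mul (hg.analytic z hz)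
  at_zero ψ h h' h'' :=
    let ⟨_, hc⟩ := hf.at_zero ψ h h' h''
    let ⟨_, hd⟩ := hg.at_zero ψ h h' h''
    ⟨_, hc.mul hd⟩
  at_one ψ h h' h'' :=
    let ⟨_, hc⟩ := hf.at_one ψ h h' h''
    let ⟨_, hd⟩ := hg.at_one ψ h h' h''
    ⟨_, hc.mul hd⟩
  at_infty ψ h h' h'' :=
    let ⟨_, hc⟩ := hf.at_infty ψ h h' h''
    let ⟨_, hd⟩ := hg.at_infty ψ h h' h''
    ⟨_, hc.mul hd⟩

theorem IsF01Infty.const_mul {f : ℂ → ℂ} (k : ℂ) (hf : IsF01Infty f) :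
    IsF01Infty (fun z => k * f z) where
  analytic z hz := analyticAt_const.fun_mul (hf.analytic z hz)
  at_zero ψ h h' h'' :=
    let ⟨_, hc⟩ := hf.at_zero ψ h h' h''
    ⟨_, hc.const_mul k⟩
  at_one ψ h h' h'' :=
    let ⟨_, hc⟩ := hf.at_one ψ h h' h''
    ⟨_, hc.const_mul k⟩
  at_infty ψ h h' h'' :=
    let ⟨_, hc⟩ := hf.at_infty ψ h h' h''
    ⟨_, hc.const_mul k⟩

/-- The complex conjugate chart `z ↦ conj (ψ (conj z))`. -/
theorem analyticAt_conj_conj {ψ : ℂ → ℂ} (h : AnalyticAt ℂ ψ 0) :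
    AnalyticAt ℂ (starRingEnd ℂ ∘ ψ ∘ starRingEnd ℂ) 0 := by
  rw [Complex.analyticAt_iff_eventually_differentiableAt] at h ⊢
  have hc : Tendsto (starRingEnd ℂ) (𝓝 0) (𝓝 0) := by
    have := (Complex.continuous_conj.tendsto 0)
    rwa [map_zero] at this
  filter_upwards [hc.eventually h] with z hz
  have := hz.conj_conj
  rwa [Complex.conj_conj] at this

theorem IsF01Infty.comp_conj {f : ℂ → ℂ} (hf : IsF01Infty f) :
    IsF01Infty (fun z => f (starRingEnd ℂ z)) := by
  have key : ∀ ψ : ℂ → ℂ, deriv ψ 0 ≠ 0 →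
      deriv (starRingEnd ℂ ∘ ψ ∘ starRingEnd ℂ) 0 ≠ 0 := by
    intro ψ h
    rw [deriv_conj_conj]
    simpa using h
  have hfin : ∀ α : ℂ, starRingEnd ℂ α = α → ConformalAt f α →
      ConformalAt (fun z => f (starRingEnd ℂ z)) α := by
    intro α hα H ψ h h' h''
    obtain ⟨c, hc⟩ := H _ (analyticAt_conj_conj h) (by simp [h', hα]) (key ψ h'')
    exact ⟨_, hc.swap.congr (.of_forall fun z => by simp)⟩
  refine ⟨fun z hz => ?_, hfin 0 (map_zero _) hf.at_zero, hfin 1 (map_one _) hf.at_one, ?_⟩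
  · refine AnalyticAt.comp (g := f) (hf.analytic _ ?_)
      (Complex.conjCLE.toContinuousLinearMap.analyticAt z)
    simp only [Set.mem_compl_iff, Set.mem_insert_iff, Set.mem_singleton_iff] at hz ⊢
    refine fun h => hz (h.imp (fun h => ?_) fun h => ?_)
    · simpa using congrArg (starRingEnd ℂ) h
    · simpa using congrArg (starRingEnd ℂ) h
  · intro ψ h h' h''
    obtain ⟨c, hc⟩ := hf.at_infty _ (analyticAt_conj_conj h) (by simp [h']) (key ψ h'')
    exact ⟨_, hc.swap.congr (.of_forall fun z => by simp)⟩

theorem isPreconnected_compl_zero_one : IsPreconnected ({0, 1}ᶜ : Set ℂ) :=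
  ((Set.toFinite ({0, 1} : Set ℂ)).countable.isConnected_compl_of_one_lt_rank
    (by rw [Complex.rank_real_complex]; norm_num)).isPreconnected

/-- A real analytic function on `ℂ \ {0, 1}` is determined by its germ at the puncture `0`. -/
theorem eqOn_of_eventuallyEq_punctured {f g : ℂ → ℂ} (hf : AnalyticOnNhd ℝ f {0, 1}ᶜ)
    (hg : AnalyticOnNhd ℝ g {0, 1}ᶜ) (h : ∀ᶠ z in 𝓝[≠] 0, f z = g z) : Set.EqOn f g {0, 1}ᶜ := by
  rw [eventually_nhdsWithin_iff, Metric.eventually_nhds_iff] at h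
  obtain ⟨ε, hε, h⟩ := h
  set δ := min ε 1 / 2 with hδ
  have hδ0 : 0 < δ := by positivity
  have hδε : δ < ε := by
    have := min_le_left ε 1
    rw [hδ]; linarith
  have hδ1 : δ < 1 := by
    have := min_le_right ε 1
    rw [hδ]; linarith
  have hmem : (δ : ℂ) ∈ ({0, 1}ᶜ : Set ℂ) := by
    simp only [Set.mem_compl_iff, Set.mem_insert_iff, Set.mem_singleton_iff, not_or]
    exact ⟨by exact_mod_cast hδ0.ne', by exact_mod_cast hδ1.ne⟩
  refine hf.eqOn_of_preconnected_of_eventuallyEq hg isPreconnected_compl_zero_one hmem ?_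
  have hne : (δ : ℂ) ≠ 0 := by exact_mod_cast hδ0.ne'
  have hball : (δ : ℂ) ∈ Metric.ball (0 : ℂ) ε := by
    simpa [abs_of_pos hδ0] using hδε
  filter_upwards [isOpen_ne.mem_nhds hne, Metric.isOpen_ball.mem_nhds hball] with z h1 h2
  exact h h2 h1

/-! ### Homogeneous components of generalized correlation functions -/

/-- The component of bidegree `(α, β)` of an element of `GCor₂` is a function
`F(z₁, z₂) = z₁^α z̄₁^β f(z₂/z₁)`. The predicate says that `c`, `e`, `d` are the expansions around
`z = 0` of `F(1, z)`, `F(1 + z, 1)` and `F(z, 1)`, for some such `F`. -/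
def IsCorrelation (α β : ℝ) (c e d : ℝ → ℝ → ℂ) : Prop :=
  ∃ f : ℂ → ℂ, IsF01Infty f ∧ IsExpansionAtZero c f ∧
    IsExpansionAtZero e (fun z => mono α β (1 + z) * f (1 + z)⁻¹) ∧
    IsExpansionAtZero d (fun z => mono α β z * f z⁻¹)

theorem IsCorrelation.zero (α β : ℝ) :
    IsCorrelation α β (fun _ _ => 0) (fun _ _ => 0) (fun _ _ => 0) :=
  ⟨_, IsF01Infty.zero, .zero, by simpa using IsExpansionAtZero.zero,
    by simpa using IsExpansionAtZero.zero⟩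

theorem IsCorrelation.add {α β : ℝ} {c e d c' e' d' : ℝ → ℝ → ℂ} (h : IsCorrelation α β c e d)
    (h' : IsCorrelation α β c' e' d') :
    IsCorrelation α β (fun s t => c s t + c' s t) (fun s t => e s t + e' s t)
      (fun s t => d s t + d' s t) := by
  obtain ⟨f, hf, hc, he, hd⟩ := h
  obtain ⟨f', hf', hc', he', hd'⟩ := h'
  exact ⟨_, hf.add hf', hc.add hc', by simpa only [mul_add] using he.add he',
    by simpa only [mul_add] using hd.add hd'⟩

theorem IsCorrelation.const_mul {α β : ℝ} {c e d : ℝ → ℝ → ℂ} (k : ℂ)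
    (h : IsCorrelation α β c e d) :
    IsCorrelation α β (fun s t => k * c s t) (fun s t => k * e s t) (fun s t => k * d s t) := by
  obtain ⟨f, hf, hc, he, hd⟩ := h
  exact ⟨_, hf.const_mul k, hc.const_mul k, by simpa only [mul_left_comm] using he.const_mul k,
    by simpa only [mul_left_comm] using hd.const_mul k⟩

theorem IsCorrelation.mul {α β α' β' : ℝ} (hα : ∃ n : ℤ, α - β = n) (hα' : ∃ n : ℤ, α' - β' = n)
    {c e d c' e' d' : ℝ → ℝ → ℂ} (h : IsCorrelation α β c e d)
    (h' : IsCorrelation α' β' c' e' d') :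
    IsCorrelation (α + α') (β + β') (conv c c') (conv e e') (conv d d') := by
  obtain ⟨f, hf, hc, he, hd⟩ := h
  obtain ⟨f', hf', hc', he', hd'⟩ := h'
  refine ⟨_, hf.mul hf', hc.mul hc', (he.mul he').congr ?_, (hd.mul hd').congr ?_⟩
  · have : ∀ᶠ z : ℂ in 𝓝 0, 1 + z ≠ 0 :=
      (continuous_const.add continuous_id).continuousAt.eventually_ne (by simp)
    filter_upwards [nhdsWithin_le_nhds this] with z hz
    rw [mono_add hα hα' hz]
    ring
  · filter_upwards [self_mem_nhdsWithin] with z hz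
    rw [mono_add hα hα' hz]
    ring

theorem expand20_eq_conv (α β : ℝ) (c : ℝ → ℝ → ℂ) (p p' : ℝ) :
    expand20 α β c p p' (α - p) (β - p') =
      conv (binom α β) (fun s t => (-1) ^ ⌊s - t⌋ * c s t) p p' := by
  classical
  rw [expand20, if_pos ⟨by ring, by ring⟩, conv]
  have : ∀ x : ℝ × ℝ, (binom α β x.1 x.2 *
      ((-1) ^ ⌊p - x.1 - (p' - x.2)⌋ * c (p - x.1) (p' - x.2))) =
      ∑ᶠ (_ : x ∈ Set.range (fun p : ℕ × ℕ => ((p.1 : ℝ), (p.2 : ℝ)))), (binom α β x.1 x.2 *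
        ((-1) ^ ⌊p - x.1 - (p' - x.2)⌋ * c (p - x.1) (p' - x.2))) := by
    intro x
    by_cases hx : x ∈ Set.range (fun p : ℕ × ℕ => ((p.1 : ℝ), (p.2 : ℝ)))
    · rw [finsum_eq_if, if_pos hx]
    · rw [finsum_eq_if, if_neg hx, binom_eq_zero α β x hx, zero_mul]
  rw [finsum_congr this, finsum_mem_range natCast_prod_injective]
  exact finsum_congr fun ij => by rw [binom_natCast]

/-- The homogeneous components of an element of `GCor₂`. The binomial factor in the expansion in
`|z₂| > |z₁ - z₂|` is the expansion of the prefactor `(1 + z)^α (1 + z̄)^β` of `F(1 + z, 1)`. -/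
theorem HasExpansions.isCorrelation {μ : Y₂ → ℂ} {e₁₂ e₂₀ e₂₁ : Series₂}
    (h : HasExpansions μ e₁₂ e₂₀ e₂₁) {α β : ℝ} (hαβ : ∃ n : ℤ, α - β = n) :
    IsCorrelation α β (fun q q' => e₁₂ (α - q) (β - q') q q')
      (fun p p' => e₂₀ p p' (α - p) (β - p')) (fun p p' => e₂₁ p p' (α - p) (β - p')) := by
  suffices H : ∀ x ∈ gcorExpansions, IsCorrelation α β (fun q q' => x.2.1 (α - q) (β - q') q q')
      (fun p p' => x.2.2.1 p p' (α - p) (β - p')) (fun p p' => x.2.2.2 p p' (α - p) (β - p')) from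
    H _ h
  intro x hx
  induction hx using Submodule.span_induction with
  | zero => exact .zero α β
  | add x y _ _ hx hy => exact hx.add hy
  | smul k x _ hx => exact hx.const_mul k
  | mem x hx =>
    obtain ⟨α', β', f, c₀, c₁, cInf, -, hf, h₀, h₁, hInf, rfl⟩ := hx
    by_cases hα : α = α' ∧ β = β'
    · obtain ⟨rfl, rfl⟩ := hα
      refine ⟨f, hf, ?_, ?_, ?_⟩
      · simpa [expand12] using h₀
      · simp only [expand20_eq_conv]
        refine (isExpansionAtZero_binom hαβ).mul ?_
        simpa using h₁.comp_neg
      · simpa [expand21] using hInf.mono_mul hαβ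
    · have h12 : (fun q q' => expand12 α' β' c₀ (α - q) (β - q') q q') = fun _ _ => 0 := by
        funext q q'
        simp only [expand12, sub_add_cancel]
        exact if_neg hα
      have h20 : (fun p p' => expand20 α' β' c₁ p p' (α - p) (β - p')) = fun _ _ => 0 := by
        funext q q'
        simp only [expand20, add_sub_cancel]
        exact if_neg hα
      have h21 : (fun p p' => expand21 α' β' cInf p p' (α - p) (β - p')) = fun _ _ => 0 := by
        funext q q'
        simp only [expand21, add_sub_cancel]
        exact if_neg hα
      dsimp only
      rw [h12, h20, h21]
      exact .zero α β

open Classical in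
/-- Conversely, a homogeneous correlation function is an element of `GCor₂`. -/
theorem IsCorrelation.hasExpansions {α β : ℝ} {c e d : ℝ → ℝ → ℂ} (h : IsCorrelation α β c e d)
    (hαβ : ∃ n : ℤ, α - β = n) :
    ∃ μ : Y₂ → ℂ, HasExpansions μ
      (fun p p' q q' => if p + q = α ∧ p' + q' = β then c q q' else 0)
      (fun p p' q q' => if p + q = α ∧ p' + q' = β then e p p' else 0)
      (fun p p' q q' => if p + q = α ∧ p' + q' = β then d p p' else 0) := by
  obtain ⟨f, hf, hc, he, hd⟩ := h
  have hψ : HasDerivAt (fun z : ℂ => (1 - z)⁻¹) 1 0 := by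
    have := ((hasDerivAt_id (0 : ℂ)).const_sub 1).fun_inv (by simp)
    simpa using this
  obtain ⟨c₁, h₁⟩ := hf.at_one (fun z => (1 - z)⁻¹)
    ((analyticAt_const.fun_sub analyticAt_id).fun_inv (by simp)) (by simp) (by simp [hψ.deriv])
  obtain ⟨cInf, hInf⟩ := hf.at_infty (fun z => z) analyticAt_id rfl (by simp)
  have e₂ : e = conv (binom α β) (fun s t => (-1) ^ ⌊s - t⌋ * c₁ s t) :=
    he.unique ((isExpansionAtZero_binom hαβ).mul h₁.comp_neg) (.of_forall fun z => by simp)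
  have e₃ : d = fun s t => cInf (s - α) (t - β) :=
    hd.unique (hInf.mono_mul hαβ) (.of_forall fun z => rfl)
  refine ⟨fun w => mono α β w.1.1 * f (w.1.2 / w.1.1), Submodule.subset_span
    ⟨α, β, f, c, c₁, cInf, hαβ, hf, hc, h₁, hInf, ?_⟩⟩
  refine Prod.ext rfl (Prod.ext rfl (Prod.ext ?_ ?_))
  · funext p p' q q'
    dsimp only
    split_ifs with hpq
    · obtain ⟨rfl, rfl⟩ := hpq
      have := expand20_eq_conv (p + q) (p' + q') c₁ p p'
      rw [add_sub_cancel_left, add_sub_cancel_left] at this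
      rw [this, e₂]
    · rw [expand20, if_neg hpq]
  · funext p p' q q'
    dsimp only
    split_ifs with hpq
    · obtain ⟨rfl, rfl⟩ := hpq
      rw [expand21, if_pos ⟨rfl, rfl⟩, e₃]
      dsimp only
      rw [sub_add_cancel_left, sub_add_cancel_left]
    · rw [expand21, if_neg hpq]

/-- Exchange of `z` and `z̄`. -/
theorem HasExpansions.swap {μ : Y₂ → ℂ} {e₁₂ e₂₀ e₂₁ : Series₂}
    (h : HasExpansions μ e₁₂ e₂₀ e₂₁) :
    ∃ μ' : Y₂ → ℂ, HasExpansions μ' (fun p p' q q' => e₁₂ p' p q' q)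
      (fun p p' q q' => e₂₀ p' p q' q) (fun p p' q q' => e₂₁ p' p q' q) := by
  suffices H : ∀ x ∈ gcorExpansions, ∃ μ' : Y₂ → ℂ,
      HasExpansions μ' (fun p p' q q' => x.2.1 p' p q' q)
      (fun p p' q q' => x.2.2.1 p' p q' q) (fun p p' q q' => x.2.2.2 p' p q' q) from H _ h
  intro x hx
  induction hx using Submodule.span_induction with
  | zero => exact ⟨0, zero_mem _⟩
  | add x y _ _ hx hy =>
    obtain ⟨μ₁, h₁⟩ := hx
    obtain ⟨μ₂, h₂⟩ := hy
    exact ⟨_, add_mem h₁ h₂⟩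
  | smul k x _ hx =>
    obtain ⟨μ₁, h₁⟩ := hx
    exact ⟨_, Submodule.smul_mem _ k h₁⟩
  | mem x hx =>
    obtain ⟨α, β, f, c₀, c₁, cInf, ⟨n, hn⟩, hf, h₀, h₁, hInf, rfl⟩ := hx
    refine ⟨_, Submodule.subset_span ⟨β, α, _, _, _, _, ⟨-n, by push_cast; linarith⟩,
      hf.comp_conj, h₀.swap, h₁.swap.congr (.of_forall fun z => by simp),
      hInf.swap.congr (.of_forall fun z => by simp), Prod.ext rfl (Prod.ext ?_ (Prod.ext ?_ ?_))⟩⟩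
    · funext p p' q q'
      simp only [expand12, and_comm]
    · funext p p' q q'
      simp only [expand20]
      refine if_congr and_comm ?_ rfl
      rw [← finsum_comp_equiv (Equiv.prodComm ℕ ℕ)]
      refine finsum_congr fun ij => ?_
      simp only [Equiv.prodComm_apply, Prod.fst_swap, Prod.snd_swap]
      rw [mul_comm (Ring.choose α _)]
      congr 1
      by_cases h0 : c₁ (p' - ij.2) (p - ij.1) = 0
      · rw [h0, mul_zero, mul_zero]
      obtain ⟨m, hm⟩ := h₁.1.integral _ _ h0
      have hm' : p - ij.1 - (p' - ij.2) = ((-m : ℤ) : ℝ) := by push_cast; linarith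
      rw [hm, hm', Int.floor_intCast, Int.floor_intCast, zpow_neg, ← inv_zpow, inv_neg, inv_one]
    · funext p p' q q'
      simp only [expand21, and_comm]

/-! ### Laurent series and the residue theorem on the thrice punctured sphere -/

/-- `g z = ∑ A n z^n`, with finite principal part, on a punctured disc around `0`. -/
structure IsLaurent (A : ℤ → ℂ) (g : ℂ → ℂ) : Prop where
  bounded : ∃ N : ℤ, ∀ n < N, A n = 0
  hasSum : ∃ R : ℝ, 0 < R ∧ Summable (fun n : ℤ => ‖A n‖ * R ^ n) ∧
    ∀ z : ℂ, z ≠ 0 → ‖z‖ < R → HasSum (fun n : ℤ => A n * z ^ n) (g z)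

theorem IsExpansionAtZero.isLaurent {c : ℝ → ℝ → ℂ} {g : ℂ → ℂ} (hg : IsExpansionAtZero c g)
    (h : ∀ s t, c s t ≠ 0 → t = 0) : IsLaurent (fun n => c n 0) g := by
  obtain ⟨hc, R, hR, hs, hz⟩ := hg
  obtain ⟨N, hN⟩ := hc.bounded
  have hinj : Function.Injective (fun n : ℤ => ((n : ℝ), (0 : ℝ))) := by
    intro m n hmn
    simpa using hmn
  have hrange : ∀ p : ℝ × ℝ, p ∉ Set.range (fun n : ℤ => ((n : ℝ), (0 : ℝ))) →
      c p.1 p.2 = 0 := by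
    intro p hp
    by_contra h0
    obtain ⟨n, hn⟩ := hc.integral _ _ h0
    refine hp ⟨n, ?_⟩
    have := h _ _ h0
    ext
    · simp only; linarith
    · exact this.symm
  refine ⟨⟨⌊N⌋, fun n hn => ?_⟩, R, hR, ?_, fun z h0 hlt => ?_⟩
  · by_contra h0
    have h1 := (hN _ _ h0).1
    have h2 := Int.floor_le N
    have h3 : (n : ℝ) < ⌊N⌋ := by exact_mod_cast hn
    linarith
  · rw [← hinj.summable_iff (fun p hp => by rw [hrange p hp]; simp)] at hs
    simpa [Function.comp_def] using hs
  · have := hz z h0 hlt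
    rw [← hinj.hasSum_iff (fun p hp => by rw [hrange p hp]; simp)] at this
    simpa [Function.comp_def, mono_int_zero] using this

/-- The coefficients of a Laurent series as limits. -/
theorem IsLaurent.tendsto {A : ℤ → ℂ} {g : ℂ → ℂ} (h : IsLaurent A g) :
    ∃ N : ℤ, (∀ n < N, A n = 0) ∧ ∀ M : ℤ,
      Tendsto (fun z => (g z - ∑ n ∈ Finset.Ico N M, A n * z ^ n) * z ^ (-M)) (𝓝[≠] 0)
        (𝓝 (A M)) := by
  obtain ⟨N, hN⟩ := h.bounded
  obtain ⟨R, hR, hs, hz⟩ := h.hasSum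
  refine ⟨N, hN, fun M => ?_⟩
  have hlt : ∀ᶠ z : ℂ in 𝓝[≠] 0, z ≠ 0 ∧ ‖z‖ < R := by
    filter_upwards [self_mem_nhdsWithin, nhdsWithin_le_nhds (Metric.ball_mem_nhds 0 hR)] with z h1 h2
    exact ⟨h1, by simpa using h2⟩
  let f : ℂ → ℤ → ℂ := fun z n => if n < M then 0 else A n * z ^ (n - M)
  have hf : ∀ᶠ z in 𝓝[≠] 0, ∑' n, f z n =
      (g z - ∑ n ∈ Finset.Ico N M, A n * z ^ n) * z ^ (-M) := by
    filter_upwards [hlt] with z ⟨h0, h1⟩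
    have e1 : HasSum (fun n => if n ∈ Finset.Ico N M then A n * z ^ n else 0)
        (∑ n ∈ Finset.Ico N M, A n * z ^ n) := by
      have := hasSum_sum_of_ne_finset_zero (s := Finset.Ico N M)
        (f := fun n => if n ∈ Finset.Ico N M then A n * z ^ n else 0)
        (L := SummationFilter.unconditional _) (fun n hn => if_neg hn)
      rwa [Finset.sum_congr rfl (fun n hn => if_pos hn)] at this
    refine (hasSum_of_eq (((hz z h0 h1).sub e1).mul_right (z ^ (-M))) fun n => ?_).tsum_eq
    simp only [f, Finset.mem_Ico]
    by_cases hnN : n < N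
    · simp [hN n hnN]
    by_cases hnM : n < M
    · simp [hnM, not_lt.1 hnN]
    · rw [if_neg (by omega), if_neg hnM, sub_zero, mul_assoc, ← zpow_add₀ h0, sub_eq_add_neg]
  have hlim : Tendsto (fun z => ∑' n, f z n) (𝓝[≠] 0) (𝓝 (∑' n, if n = M then A M else 0)) := by
    refine tendsto_tsum_of_dominated_convergence (bound := fun n => ‖A n‖ * R ^ n * R ^ (-M))
      (hs.mul_right _) (fun n => ?_) ?_
    · rcases lt_trichotomy n M with hn | rfl | hn
      · simp [f, hn, hn.ne]
      · simp [f]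
      · obtain ⟨m, hm⟩ := Int.eq_ofNat_of_zero_le (show 0 ≤ n - M by omega)
        have hm0 : m ≠ 0 := by omega
        simp only [f, hn.not_gt, hn.ne', if_false, hm, zpow_natCast]
        have : Tendsto (fun z : ℂ => A n * z ^ m) (𝓝 0) (𝓝 (A n * 0 ^ m)) :=
          (continuous_const.mul (continuous_pow m)).tendsto 0
        rw [zero_pow hm0, mul_zero] at this
        exact this.mono_left nhdsWithin_le_nhds
    · filter_upwards [hlt] with z ⟨h0, h1⟩ n
      simp only [f]
      split_ifs with hn
      · simp; positivity
      · obtain ⟨m, hm⟩ := Int.eq_ofNat_of_zero_le (show 0 ≤ n - M by omega)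
        rw [mul_assoc, ← zpow_add₀ hR.ne', ← sub_eq_add_neg, hm, norm_mul]
        simp only [zpow_natCast, norm_pow]
        gcongr
  rw [tsum_ite_eq] at hlim
  exact hlim.congr' hf

theorem IsLaurent.differentiableAt {A : ℤ → ℂ} {g : ℂ → ℂ} (h : IsLaurent A g) :
    ∀ᶠ z in 𝓝[≠] 0, DifferentiableAt ℂ g z := by
  obtain ⟨R, hR, hs, hz⟩ := h.hasSum
  filter_upwards [self_mem_nhdsWithin, nhdsWithin_le_nhds (Metric.ball_mem_nhds 0 hR)] with z h1 h2
  have h1 : z ≠ 0 := h1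
  have h2 : ‖z‖ < R := by simpa using h2
  have hpos : 0 < ‖z‖ := norm_pos_iff.2 h1
  set r := ‖z‖ / 2 with hr
  have hr0 : 0 < r := by positivity
  have hs' : Summable (fun n : ℤ => ‖A n‖ * r ^ n) := by
    have := (hz (z / 2) (by simpa using h1) (by
      rw [norm_div, Complex.norm_ofNat]; linarith)).summable.norm
    refine this.congr fun n => ?_
    rw [norm_mul, norm_zpow, norm_div, Complex.norm_ofNat]
  set U : Set ℂ := {w | r < ‖w‖ ∧ ‖w‖ < R}
  have hU : IsOpen U :=
    (isOpen_lt continuous_const continuous_norm).inter (isOpen_lt continuous_norm continuous_const)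
  have hU0 : ∀ w ∈ U, w ≠ 0 := fun w hw => norm_pos_iff.1 (hr0.trans hw.1)
  have hd : DifferentiableOn ℂ (fun w => ∑' n : ℤ, A n * w ^ n) U := by
    refine Complex.differentiableOn_tsum_of_summable_norm (hs'.add hs) (fun n w hw => ?_) hU
      fun n w hw => ?_
    · exact ((differentiableAt_zpow.2 (Or.inl (hU0 w hw))).const_mul _).differentiableWithinAt
    · rw [norm_mul, norm_zpow, ← mul_add]
      refine mul_le_mul_of_nonneg_left ?_ (norm_nonneg _)
      rcases le_total 0 n with hn | hn
      · have := zpow_le_zpow_left₀ hn (norm_nonneg w) hw.2.le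
        have h3 : 0 < r ^ n := zpow_pos hr0 n
        linarith
      · obtain ⟨m, rfl⟩ : ∃ m : ℕ, n = -m := ⟨(-n).toNat, by omega⟩
        have h3 : 0 < R ^ (-(m : ℤ)) := zpow_pos hR _
        have h4 : ‖w‖ ^ (-(m : ℤ)) ≤ r ^ (-(m : ℤ)) := by
          rw [zpow_neg, zpow_neg, zpow_natCast, zpow_natCast]
          have := hw.1.le
          gcongr
        linarith
  have hzU : z ∈ U := ⟨by rw [hr]; linarith, h2⟩
  refine ((hd z hzU).differentiableAt (hU.mem_nhds hzU)).congr_of_eventuallyEq ?_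
  filter_upwards [hU.mem_nhds hzU] with w hw
  exact ((hz w (hU0 w hw) hw.2).tsum_eq).symm

/-- A real analytic function on `ℂ \ {0, 1}` which is holomorphic near `0` is holomorphic. -/
theorem differentiableAt_of_analytic {H : ℂ → ℂ} (hH : AnalyticOnNhd ℝ H {0, 1}ᶜ)
    (h : ∀ᶠ z in 𝓝[≠] 0, DifferentiableAt ℂ H z) :
    ∀ z ∈ ({0, 1}ᶜ : Set ℂ), DifferentiableAt ℂ H z := by
  have hd := hH.fderiv
  have hv : ∀ v : ℂ, AnalyticOnNhd ℝ (fun z => fderiv ℝ H z v) {0, 1}ᶜ := fun v z hz =>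
    ((ContinuousLinearMap.apply ℝ ℂ v).analyticAt _).comp (hd z hz)
  -- the Cauchy-Riemann equation propagates by the identity theorem
  have := eqOn_of_eventuallyEq_punctured (hv Complex.I)
    (g := fun z => Complex.I • fderiv ℝ H z 1)
    (fun z hz => analyticAt_const.fun_mul (hv 1 z hz)) (by
      filter_upwards [h] with z hz
      exact (differentiableAt_complex_iff_differentiableAt_real.1 hz).2)
  intro z hz
  exact differentiableAt_complex_iff_differentiableAt_real.2
    ⟨(hH z hz).differentiableAt, this hz⟩

theorem tendsto_inv_sub_zpow (a : ℂ) {n : ℤ} (hn : n < 0) :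
    Tendsto (fun z : ℂ => (z⁻¹ - a) ^ n * z⁻¹) (𝓝[≠] 0) (𝓝 (if n = -1 then 1 else 0)) := by
  obtain ⟨m, rfl⟩ : ∃ m : ℕ, n = -1 - m := ⟨(-1 - n).toNat, by omega⟩
  have h1 : Tendsto (fun z : ℂ => z ^ m * (1 - a * z) ^ (-1 - (m : ℤ))) (𝓝 0)
      (𝓝 (0 ^ m * (1 - a * 0) ^ (-1 - (m : ℤ)))) := by
    refine ((continuous_pow m).tendsto 0).mul (ContinuousAt.tendsto (x := (0 : ℂ)) ?_)
    exact ContinuousAt.zpow₀ (by fun_prop) _ (Or.inl (by simp))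
  have h2 : (0 : ℂ) ^ m * (1 - a * 0) ^ (-1 - (m : ℤ)) = if (-1 - (m : ℤ)) = -1 then 1 else 0 := by
    rcases Nat.eq_zero_or_pos m with rfl | hm
    · simp
    · rw [zero_pow hm.ne', zero_mul, if_neg (by omega)]
  rw [h2] at h1
  refine (h1.mono_left nhdsWithin_le_nhds).congr' ?_
  filter_upwards [self_mem_nhdsWithin] with z hz
  have hz : z ≠ 0 := hz
  have : z⁻¹ - a = z⁻¹ * (1 - a * z) := by field_simp
  rw [this, mul_zpow, inv_zpow', neg_sub, sub_neg_eq_add, zpow_add₀ hz, zpow_natCast, zpow_one]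
  field_simp

theorem tendsto_principal_part (a : ℂ) (A : ℤ → ℂ) (N : ℤ) (hN : ∀ n < N, A n = 0) :
    Tendsto (fun z : ℂ => (∑ n ∈ Finset.Ico N 0, A n * (z⁻¹ - a) ^ n) * z⁻¹) (𝓝[≠] 0)
      (𝓝 (A (-1))) := by
  have h := tendsto_finsetSum (Finset.Ico N 0) fun n hn =>
    (tendsto_inv_sub_zpow a (Finset.mem_Ico.1 hn).2).const_mul (A n)
  have e : ∑ n ∈ Finset.Ico N 0, A n * (if n = -1 then (1 : ℂ) else 0) = A (-1) := by
    simp only [mul_ite, mul_one, mul_zero, Finset.sum_ite_eq', Finset.mem_Ico]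
    split_ifs with h'
    · rfl
    · exact (hN _ (by omega)).symm
  rw [e] at h
  refine h.congr fun z => ?_
  rw [Finset.sum_mul]
  exact Finset.sum_congr rfl fun n _ => by ring

/-- The sum of the residues at `0`, `1` and `∞` vanishes: after subtraction of its principal parts,
the function is entire and vanishes at infinity. -/
theorem residue_theorem {G : ℂ → ℂ} {A₀ A₁ AInf : ℤ → ℂ}
    (hG : ∀ z ∈ ({0, 1}ᶜ : Set ℂ), DifferentiableAt ℂ G z) (h₀ : IsLaurent A₀ G)
    (h₁ : IsLaurent A₁ (fun z => G (1 + z))) (hInf : IsLaurent AInf (fun z => G z⁻¹)) :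
    A₀ (-1) + A₁ (-1) = AInf 1 := by
  obtain ⟨N₀, hN₀, hL₀⟩ := h₀.tendsto
  obtain ⟨N₁, hN₁, hL₁⟩ := h₁.tendsto
  obtain ⟨N, hN, hL⟩ := hInf.tendsto
  set P₀ : ℂ → ℂ := fun z => ∑ n ∈ Finset.Ico N₀ 0, A₀ n * (z - 0) ^ n with hP₀
  set P₁ : ℂ → ℂ := fun z => ∑ n ∈ Finset.Ico N₁ 0, A₁ n * (z - 1) ^ n with hP₁
  set Q : ℂ → ℂ := fun z => ∑ n ∈ Finset.Ico N 1, AInf n * z⁻¹ ^ n with hQ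
  have dP₀ : ∀ z, z ≠ 0 → DifferentiableAt ℂ P₀ z := fun z hz =>
    DifferentiableAt.fun_sum fun n _ => ((differentiableAt_id.sub_const 0).zpow
      (Or.inl (by simpa using hz))).const_mul _
  have dP₁ : ∀ z, z ≠ 1 → DifferentiableAt ℂ P₁ z := fun z hz =>
    DifferentiableAt.fun_sum fun n _ => ((differentiableAt_id.sub_const 1).zpow
      (Or.inl (by simpa [sub_eq_zero] using hz))).const_mul _
  have dQ : ∀ z, DifferentiableAt ℂ Q z := fun z =>
    DifferentiableAt.fun_sum fun n hn => by
      have : n < 1 := (Finset.mem_Ico.1 hn).2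
      obtain ⟨m, rfl⟩ : ∃ m : ℕ, n = -m := ⟨(-n).toNat, by omega⟩
      simp only [inv_zpow', neg_neg, zpow_natCast]
      exact (differentiableAt_id.pow m).const_mul _
  -- `G` minus its principal parts extends to an entire function
  set E : ℂ → ℂ := fun z => G z - P₀ z - P₁ z - Q z with hE
  have dE : ∀ z ∈ ({0, 1}ᶜ : Set ℂ), DifferentiableAt ℂ E z := by
    intro z hz
    have hz' := hz
    simp only [Set.mem_compl_iff, Set.mem_insert_iff, Set.mem_singleton_iff, not_or] at hz'
    exact (((hG z hz).sub (dP₀ z hz'.1)).sub (dP₁ z hz'.2)).sub (dQ z)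
  have lim₀ : Tendsto E (𝓝[≠] 0) (𝓝 (A₀ 0 - P₁ 0 - Q 0)) := by
    have h := hL₀ 0
    simp only [neg_zero, zpow_zero, mul_one] at h
    have := (h.sub ((dP₁ 0 (by simp)).continuousAt.tendsto.mono_left nhdsWithin_le_nhds)).sub
      ((dQ 0).continuousAt.tendsto.mono_left nhdsWithin_le_nhds)
    simpa [hE, hP₀] using this
  have lim₁ : Tendsto E (𝓝[≠] 1) (𝓝 (A₁ 0 - P₀ 1 - Q 1)) := by
    have h := hL₁ 0
    simp only [neg_zero, zpow_zero, mul_one] at h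
    have ht : Tendsto (fun z : ℂ => z - 1) (𝓝[≠] 1) (𝓝[≠] 0) := by
      refine tendsto_nhdsWithin_of_tendsto_nhds_of_eventually_within _ ?_ ?_
      · have : Tendsto (fun z : ℂ => z - 1) (𝓝 1) (𝓝 (1 - 1)) :=
          (continuous_id.sub continuous_const).tendsto 1
        rw [sub_self] at this
        exact this.mono_left nhdsWithin_le_nhds
      · filter_upwards [self_mem_nhdsWithin] with z hz
        simpa [sub_eq_zero] using hz
    have := ((h.comp ht).sub
      ((dP₀ 1 one_ne_zero).continuousAt.tendsto.mono_left nhdsWithin_le_nhds)).sub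
      ((dQ 1).continuousAt.tendsto.mono_left nhdsWithin_le_nhds)
    refine this.congr fun z => ?_
    simp only [hE, hP₁, Function.comp, add_sub_cancel]
    ring
  set E' := Function.update (Function.update E 0 (A₀ 0 - P₁ 0 - Q 0)) 1 (A₁ 0 - P₀ 1 - Q 1)
    with hE'
  have E'_eq : ∀ z ∈ ({0, 1}ᶜ : Set ℂ), E' z = E z := by
    intro z hz
    simp only [Set.mem_compl_iff, Set.mem_insert_iff, Set.mem_singleton_iff, not_or] at hz
    rw [hE', Function.update_of_ne hz.2, Function.update_of_ne hz.1]
  have hopen : IsOpen ({0, 1}ᶜ : Set ℂ) := (Set.toFinite _).isClosed.isOpen_compl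
  have dE'1 : ∀ z ∈ ({0, 1}ᶜ : Set ℂ), DifferentiableAt ℂ E' z := by
    intro z hz
    refine (dE z hz).congr_of_eventuallyEq ?_
    filter_upwards [hopen.mem_nhds hz] with w hw using E'_eq w hw
  have near₀ : ∀ᶠ z : ℂ in 𝓝[≠] 0, z ∈ ({0, 1}ᶜ : Set ℂ) := by
    filter_upwards [self_mem_nhdsWithin,
      nhdsWithin_le_nhds (isOpen_ne.mem_nhds (zero_ne_one (α := ℂ)))] with z h1 h2
    simpa using ⟨h1, h2⟩
  have near₁ : ∀ᶠ z : ℂ in 𝓝[≠] 1, z ∈ ({0, 1}ᶜ : Set ℂ) := by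
    filter_upwards [self_mem_nhdsWithin,
      nhdsWithin_le_nhds (isOpen_ne.mem_nhds (one_ne_zero (α := ℂ)))] with z h1 h2
    simpa using ⟨h2, h1⟩
  have dE' : Differentiable ℂ E' := by
    intro z
    by_cases hz : z ∈ ({0, 1}ᶜ : Set ℂ)
    · exact dE'1 z hz
    · simp only [Set.mem_compl_iff, Set.mem_insert_iff, Set.mem_singleton_iff, not_not] at hz
      rcases hz with rfl | rfl
      · refine (Complex.analyticAt_of_differentiable_on_punctured_nhds_of_continuousAt
          (near₀.mono dE'1) ?_).differentiableAt
        rw [continuousAt_iff_punctured_nhds]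
        have e : E' 0 = A₀ 0 - P₁ 0 - Q 0 := by simp [hE']
        rw [e]
        exact lim₀.congr' (near₀.mono fun z hz => (E'_eq z hz).symm)
      · refine (Complex.analyticAt_of_differentiable_on_punctured_nhds_of_continuousAt
          (near₁.mono dE'1) ?_).differentiableAt
        rw [continuousAt_iff_punctured_nhds]
        have e : E' 1 = A₁ 0 - P₀ 1 - Q 1 := by simp [hE']
        rw [e]
        exact lim₁.congr' (near₁.mono fun z hz => (E'_eq z hz).symm)
  have hL' := hL 1
  have T₀ := tendsto_principal_part 0 A₀ N₀ hN₀
  have T₁ := tendsto_principal_part 1 A₁ N₁ hN₁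
  have hEinv : Tendsto (fun z => E z⁻¹ * z⁻¹) (𝓝[≠] 0) (𝓝 (AInf 1 - A₀ (-1) - A₁ (-1))) := by
    refine ((hL'.sub T₀).sub T₁).congr fun z => ?_
    simp only [hE, hP₀, hP₁, hQ, inv_inv, zpow_neg, zpow_one]
    ring
  have near₀' : ∀ᶠ z : ℂ in 𝓝[≠] 0, z⁻¹ ∈ ({0, 1}ᶜ : Set ℂ) := by
    filter_upwards [near₀] with z hz
    simpa using hz
  have hE'inv : Tendsto (fun z => E' z⁻¹) (𝓝[≠] 0) (𝓝 0) := by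
    have hid : Tendsto (fun z : ℂ => z) (𝓝[≠] 0) (𝓝 0) := nhdsWithin_le_nhds
    have := hEinv.mul hid
    rw [mul_zero] at this
    refine this.congr' ?_
    filter_upwards [near₀', self_mem_nhdsWithin] with z hz h0
    rw [E'_eq _ hz, mul_assoc, inv_mul_cancel₀ h0, mul_one]
  have hzero : ∀ z, E' z = 0 := by
    intro z
    refine dE'.apply_eq_of_tendsto_cocompact z ?_
    rw [← Metric.cobounded_eq_cocompact]
    have := hE'inv.comp tendsto_inv₀_cobounded'
    simpa [Function.comp_def] using this
  have : Tendsto (fun z => E z⁻¹ * z⁻¹) (𝓝[≠] 0) (𝓝 0) := by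
    refine tendsto_const_nhds.congr' ?_
    filter_upwards [near₀'] with z hz
    rw [← E'_eq _ hz, hzero, zero_mul]
  have := tendsto_nhds_unique hEinv this
  linear_combination -this

theorem conv_eq_finsum_nat {b : ℝ → ℝ → ℂ}
    (hb : ∀ s t, b s t ≠ 0 → ∃ i : ℕ, s = i ∧ t = 0) (c : ℝ → ℝ → ℂ) (s t : ℝ) :
    conv b c s t = ∑ᶠ i : ℕ, b i 0 * c (s - i) t := by
  classical
  have hinj : Function.Injective (fun i : ℕ => ((i : ℝ), (0 : ℝ))) := by
    intro i j h
    simpa using h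
  have : ∀ x : ℝ × ℝ, b x.1 x.2 * c (s - x.1) (t - x.2) =
      ∑ᶠ (_ : x ∈ Set.range (fun i : ℕ => ((i : ℝ), (0 : ℝ)))),
        b x.1 x.2 * c (s - x.1) (t - x.2) := by
    intro x
    by_cases hx : x ∈ Set.range (fun i : ℕ => ((i : ℝ), (0 : ℝ)))
    · rw [finsum_eq_if, if_pos hx]
    · rw [finsum_eq_if, if_neg hx]
      by_contra h
      obtain ⟨i, hi, h0⟩ := hb _ _ (left_ne_zero_of_mul h)
      exact hx ⟨i, Prod.ext hi.symm h0.symm⟩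
  rw [conv, finsum_congr this, finsum_mem_range hinj]
  exact finsum_congr fun i => by rw [sub_zero]

theorem exists_of_binom_zero_ne_zero {α s t : ℝ} (h : binom α 0 s t ≠ 0) :
    ∃ i : ℕ, s = i ∧ t = 0 := by
  obtain ⟨i, j, rfl, rfl⟩ := exists_of_binom_ne_zero h
  rcases Nat.eq_zero_or_pos j with rfl | hj
  · exact ⟨i, rfl, Nat.cast_zero⟩
  · rw [binom_natCast, Ring.choose_zero_pos _ hj] at h
    simp at h

theorem binom_int_zero (k : ℤ) (i : ℕ) : binom k 0 i 0 = ((Ring.choose k i : ℤ) : ℂ) := by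
  have := binom_natCast (k : ℝ) 0 i 0
  rw [Nat.cast_zero] at this
  rw [this, Ring.choose_zero_right, mul_one,
    ← (show ((Ring.choose k i : ℤ) : ℝ) = Ring.choose (k : ℝ) i from
      Ring.map_choose (Int.castRingHom ℝ) k i), Complex.ofReal_intCast]

theorem conv_binom_zero (k : ℤ) (c : ℝ → ℝ → ℂ) (s t : ℝ) :
    conv (binom k 0) c s t = ∑ᶠ i : ℕ, ((Ring.choose k i : ℤ) : ℂ) * c (s - i) t := by
  rw [conv_eq_finsum_nat fun _ _ => exists_of_binom_zero_ne_zero]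
  exact finsum_congr fun i => by rw [binom_int_zero]

theorem conv_neg_binom_zero (k : ℤ) (c : ℝ → ℝ → ℂ) (s t : ℝ) :
    conv (fun s t => (-1) ^ ⌊s - t⌋ * binom k 0 s t) c s t =
      ∑ᶠ i : ℕ, (((-1) ^ i * Ring.choose k i : ℤ) : ℂ) * c (s - i) t := by
  rw [conv_eq_finsum_nat fun _ _ h => exists_of_binom_zero_ne_zero (right_ne_zero_of_mul h)]
  exact finsum_congr fun i => by
    rw [binom_int_zero, sub_zero, Int.floor_natCast, zpow_natCast]
    push_cast
    rfl

theorem conv_support_zero {b c : ℝ → ℝ → ℂ} (hb : ∀ s t, b s t ≠ 0 → t = 0)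
    (hc : ∀ s t, c s t ≠ 0 → t = 0) (s t : ℝ) (h : conv b c s t ≠ 0) : t = 0 := by
  obtain ⟨p, h1, h2⟩ := exists_of_conv_ne_zero h
  linarith [hb _ _ h1, hc _ _ h2]

/-- If all antiholomorphic exponents in `F(z, 1)` are trivial, then `F(z, 1)` is a rational function
with poles at `0`, `1`, `∞` only, and the residues of `z^l (z - 1)^k F(z, 1)` add up to zero. -/
theorem IsCorrelation.residue {α β : ℝ} {c e d : ℝ → ℝ → ℂ} (h : IsCorrelation α β c e d)
    (hαβ : ∃ n : ℤ, α - β = n) (hc : ∀ s t, c s t ≠ 0 → t = β) (he : ∀ s t, e s t ≠ 0 → t = 0)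
    (hd : ∀ s t, d s t ≠ 0 → t = 0) (k l : ℤ) :
    ∑ᶠ i : ℕ, ((Ring.choose l i : ℤ) : ℂ) * e (-1 - k - i) 0 =
      ∑ᶠ i : ℕ, (((-1) ^ i * Ring.choose k i : ℤ) : ℂ) * c (1 + l + k - i + α) β -
        (-1) ^ k *
          ∑ᶠ i : ℕ, (((-1) ^ i * Ring.choose k i : ℤ) : ℂ) * d (-1 - l - i) 0 := by
  obtain ⟨f, hf, hc₀, he₀, hd₀⟩ := h
  obtain ⟨n, hn⟩ := hαβ
  set H : ℂ → ℂ := fun z => mono α β z * f z⁻¹ with hH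
  have hHan : AnalyticOnNhd ℝ H {0, 1}ᶜ := by
    intro z hz
    have hz' : z⁻¹ ∈ ({0, 1}ᶜ : Set ℂ) := by simpa using hz
    simp only [Set.mem_compl_iff, Set.mem_insert_iff, Set.mem_singleton_iff, not_or] at hz
    refine (analyticAt_mono α β hz.1).fun_mul ((hf.analytic _ hz').comp ?_)
    exact (analyticAt_id.fun_inv (𝕜 := ℂ) hz.1).restrictScalars
  have hHd := differentiableAt_of_analytic hHan (hd₀.isLaurent hd).differentiableAt
  have hi : ∀ m : ℤ, ∃ n : ℤ, (m : ℝ) - 0 = n := fun m => ⟨m, sub_zero _⟩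
  have hB : ∀ m : ℤ, ∀ s t, binom m 0 s t ≠ 0 → t = 0 := fun m s t h =>
    (exists_of_binom_zero_ne_zero h).choose_spec.2
  have hB' : ∀ s t, (-1) ^ ⌊s - t⌋ * binom k 0 s t ≠ 0 → t = 0 := fun s t h =>
    hB k s t (right_ne_zero_of_mul h)
  -- the expansion at infinity of `F(z, 1)`
  have hInf : IsExpansionAtZero (fun s t => c (s - -α) (t - -β)) (fun z => H z⁻¹) := by
    refine (hc₀.mono_mul (α := -α) (β := -β) ⟨-n, by push_cast; linarith⟩).congr ?_
    filter_upwards [self_mem_nhdsWithin] with z hz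
    have hz : z ≠ 0 := hz
    simp only [hH, inv_inv]
    congr 1
    have h1 := mono_add (s := -α) (t := -β) (s' := α) (t' := β) ⟨-n, by push_cast; linarith⟩
      ⟨n, hn⟩ hz
    rw [neg_add_cancel, neg_add_cancel, mono_zero_zero] at h1
    have h2 := mono_inv ⟨n, hn⟩ hz
    exact mul_right_cancel₀ (mono_ne_zero hz) (h1.symm.trans h2.symm)
  have hc' : ∀ s t, c (s - -α) (t - -β) ≠ 0 → t = 0 := fun s t h => by
    have := hc _ _ h
    linarith
  -- the expansions of `G z = z^l (z - 1)^k F(z, 1)`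
  set G : ℂ → ℂ := fun z => z ^ l * (z - 1) ^ k * H z with hG
  have hGd : ∀ z ∈ ({0, 1}ᶜ : Set ℂ), DifferentiableAt ℂ G z := by
    intro z hz
    have hz' := hz
    simp only [Set.mem_compl_iff, Set.mem_insert_iff, Set.mem_singleton_iff, not_or] at hz'
    exact (((differentiableAt_id).zpow (Or.inl hz'.1)).mul
      ((differentiableAt_id.sub_const 1).zpow
        (Or.inl (by simpa [sub_eq_zero] using hz'.2)))).mul (hHd z hz)
  have neg1 : ((-1 : ℂ) ^ k) * (-1) ^ k = 1 := by
    rw [← mul_zpow]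
    simp
  have E₀ := ((((isExpansionAtZero_binom (hi k)).comp_neg.mul hd₀).mono_mul (hi l)).const_mul
    ((-1) ^ k)).congr (h := G) (.of_forall fun z => by
      simp only [mono_int_zero, hG]
      rw [show z - 1 = -1 * (1 + -z) by ring, mul_zpow]
      ring)
  have E₁ := (((isExpansionAtZero_binom (hi l)).mul he₀).mono_mul (hi k)).congr
    (h := fun z => G (1 + z)) (.of_forall fun z => by
      simp only [mono_int_zero, hG, hH]
      rw [add_sub_cancel_left]
      ring)
  have EInf := (((isExpansionAtZero_binom (hi k)).comp_neg.mul hInf).mono_mul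
    (hi (-l - k))).congr (h := fun z => G z⁻¹) (by
      filter_upwards [self_mem_nhdsWithin] with z hz
      have hz : z ≠ 0 := hz
      simp only [mono_int_zero, hG]
      rw [show z⁻¹ - 1 = z⁻¹ * (1 + -z) by field_simp; ring, mul_zpow, inv_zpow', inv_zpow',
        sub_eq_add_neg, zpow_add₀ hz]
      ring)
  have key := residue_theorem hGd
    (E₀.isLaurent fun s t h => by
      simpa using conv_support_zero hB' hd _ _ (right_ne_zero_of_mul h))
    (E₁.isLaurent fun s t h => by simpa using conv_support_zero (hB l) he _ _ h)
    (EInf.isLaurent fun s t h => by simpa using conv_support_zero hB' hc' _ _ h)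
  simp only [conv_binom_zero, conv_neg_binom_zero] at key
  rw [eq_sub_iff_add_eq, add_comm]
  refine (congrArg₂ (· + ·) (congrArg _ (finsum_congr fun i => ?_)) (finsum_congr fun i => ?_)).trans
    (key.trans (finsum_congr fun i => ?_))
  all_goals congr 2 <;> push_cast <;> ring

/-! ### Graded vector spaces -/

section Graded

variable {ι M : Type*} [AddCommGroup M] [Module ℂ M]

/-- `π` is the family of projections onto the summands of a decomposition `M = ⨁ gr p`. -/
structure IsProjections (gr : ι → Submodule ℂ M) (π : ι → M →ₗ[ℂ] M) : Prop where
  mem : ∀ p x, π p x ∈ gr p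
  same : ∀ p, ∀ x ∈ gr p, π p x = x
  ne : ∀ p q, p ≠ q → ∀ x ∈ gr q, π p x = 0
  eq_sum : ∀ x, ∃ T : Finset ι, ∀ T', T ⊆ T' → x = ∑ p ∈ T', π p x

theorem exists_isProjections [DecidableEq ι] {gr : ι → Submodule ℂ M}
    (h : DirectSum.IsInternal gr) :
    ∃ π, IsProjections gr π := by
  let e := LinearEquiv.ofBijective (DirectSum.coeLinearMap gr) h
  have he : ∀ p (x : gr p), e.symm x = DirectSum.lof ℂ ι (fun p => gr p) p x := by
    intro p x
    rw [LinearEquiv.symm_apply_eq]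
    exact (DirectSum.coeLinearMap_lof gr p x).symm
  let π : ι → M →ₗ[ℂ] M := fun p =>
    (gr p).subtype ∘ₗ DirectSum.component ℂ ι (fun p => gr p) p ∘ₗ e.symm.toLinearMap
  have same : ∀ p, ∀ x ∈ gr p, π p x = x := by
    intro p x hx
    have := he p ⟨x, hx⟩
    simp only at this
    simp [π, this, DirectSum.component.lof_self]
  have ne : ∀ p q, p ≠ q → ∀ x ∈ gr q, π p x = 0 := by
    intro p q hpq x hx
    have := he q ⟨x, hx⟩
    simp only at this
    simp [π, this, DirectSum.component.of, hpq.symm]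
  refine ⟨π, fun p x => Subtype.property _, same, ne, fun x => ?_⟩
  have hx : x ∈ ⨆ p, gr p := h.submodule_iSup_eq_top ▸ Submodule.mem_top
  induction hx using Submodule.iSup_induction' with
  | mem p x hx =>
    refine ⟨{p}, fun T' hT' => ?_⟩
    rw [Finset.sum_eq_single_of_mem p (hT' (Finset.mem_singleton_self p))
      (fun q _ hq => ne q p hq x hx), same p x hx]
  | zero => exact ⟨∅, fun T' _ => by simp⟩
  | add x y _ _ hx hy =>
    obtain ⟨T₁, h₁⟩ := hx
    obtain ⟨T₂, h₂⟩ := hy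
    refine ⟨T₁ ∪ T₂, fun T' hT' => ?_⟩
    simp only [map_add, Finset.sum_add_distrib]
    rw [← h₁ T' (Finset.union_subset_left hT'), ← h₂ T' (Finset.union_subset_right hT')]

variable {gr : ι → Submodule ℂ M} {π : ι → M →ₗ[ℂ] M}

theorem IsProjections.eq_zero (h : IsProjections gr π) {x : M} (hx : ∀ p, π p x = 0) : x = 0 := by
  obtain ⟨T, hT⟩ := h.eq_sum x
  rw [hT T subset_rfl]
  exact Finset.sum_eq_zero fun p _ => hx p

theorem IsProjections.mem_of_forall (h : IsProjections gr π) {S : Submodule ℂ M} {x : M}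
    (hx : ∀ p, π p x ∈ S) : x ∈ S := by
  obtain ⟨T, hT⟩ := h.eq_sum x
  rw [hT T subset_rfl]
  exact Submodule.sum_mem _ fun p _ => hx p

end Graded

section GradedDual

variable {M : Type*} [AddCommGroup M] [Module ℂ M] {gr : ℝ × ℝ → Submodule ℂ M}
  {π : ℝ × ℝ → M →ₗ[ℂ] M}

theorem IsProjections.isGradedDual (h : IsProjections gr π) (φ : M →ₗ[ℂ] ℂ) (T : Finset (ℝ × ℝ)) :
    IsGradedDual gr (∑ p ∈ T, φ ∘ₗ π p) := by
  refine T.finite_toSet.subset ?_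
  rintro p ⟨x, hx, hne⟩
  by_contra hp
  refine hne ?_
  rw [LinearMap.sum_apply]
  refine Finset.sum_eq_zero fun q hq => ?_
  have : q ≠ p := fun h => hp (h ▸ hq)
  rw [LinearMap.comp_apply, h.ne q p this x hx, map_zero]

/-- `M^∨` separates the points of `M`. -/
theorem eq_of_forall_isGradedDual (h : DirectSum.IsInternal gr) {x y : M}
    (hxy : ∀ u, IsGradedDual gr u → u x = u y) : x = y := by
  obtain ⟨π, hπ⟩ := exists_isProjections h
  rw [← sub_eq_zero]
  refine hπ.eq_zero fun p => ?_
  rw [← Module.forall_dual_apply_eq_zero_iff ℂ]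
  intro φ
  have := hxy _ (hπ.isGradedDual φ {p})
  simpa [sub_eq_zero] using this

/-- A linear functional on a finite dimensional subspace extends to an element of `M^∨`. -/
theorem exists_isGradedDual_extend (h : DirectSum.IsInternal gr) (W : Submodule ℂ M)
    [FiniteDimensional ℂ W] (φ : W →ₗ[ℂ] ℂ) :
    ∃ u, IsGradedDual gr u ∧ ∀ x : W, u x = φ x := by
  obtain ⟨π, hπ⟩ := exists_isProjections h
  obtain ⟨ψ, hψ⟩ := φ.exists_extend
  let b := Module.finBasis ℂ W
  choose T hT using fun i => hπ.eq_sum (b i)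
  let T' := Finset.univ.biUnion T
  refine ⟨_, hπ.isGradedDual ψ T', fun x => ?_⟩
  have : (∑ p ∈ T', ψ ∘ₗ π p) ∘ₗ W.subtype = φ := by
    refine b.ext fun i => ?_
    have h1 := hT i T' (Finset.subset_biUnion_of_mem T (Finset.mem_univ i))
    rw [← hψ]
    simp only [LinearMap.comp_apply, LinearMap.sum_apply, Submodule.subtype_apply]
    rw [← map_sum, ← h1]
  exact LinearMap.congr_fun this x

/-- An element of `S^∨`, for a graded subspace `S`, extends to an element of `M^∨`. -/
theorem exists_isGradedDual_extend_of_graded (h : DirectSum.IsInternal gr) {S : Submodule ℂ M}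
    (hS : S = ⨆ p, S ⊓ gr p) {u : S →ₗ[ℂ] ℂ}
    (hu : IsGradedDual (fun p => (gr p).comap S.subtype) u) :
    ∃ v, IsGradedDual gr v ∧ ∀ x : S, v x = u x := by
  obtain ⟨π, hπ⟩ := exists_isProjections h
  obtain ⟨ψ, hψ⟩ := u.exists_extend
  have hψ' : ∀ x : S, ψ x = u x := fun x => LinearMap.congr_fun hψ x
  let T := Set.Finite.toFinset hu
  refine ⟨_, hπ.isGradedDual ψ T, fun x => ?_⟩
  have key : S ≤ LinearMap.ker (∑ p ∈ T, ψ ∘ₗ π p - ψ) := by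
    rw [hS]
    refine iSup_le fun p x hx => ?_
    rw [LinearMap.mem_ker, LinearMap.sub_apply, LinearMap.sum_apply, sub_eq_zero]
    simp only [LinearMap.comp_apply]
    by_cases hp : p ∈ T
    · rw [Finset.sum_eq_single_of_mem p hp
        (fun q _ hq => by rw [hπ.ne q p hq x hx.2, map_zero]), hπ.same p x hx.2]
    · have h0 : u ⟨x, hx.1⟩ = 0 := by
        by_contra h0
        exact hp ((Set.Finite.mem_toFinset hu).2 ⟨⟨x, hx.1⟩, hx.2, h0⟩)
      rw [show ψ x = 0 from (hψ' ⟨x, hx.1⟩).trans h0]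
      refine Finset.sum_eq_zero fun q hq => ?_
      rw [hπ.ne q p (fun h => hp (h ▸ hq)) x hx.2, map_zero]
  have := key x.2
  rw [LinearMap.mem_ker, LinearMap.sub_apply, sub_eq_zero] at this
  rw [this, hψ']

end GradedDual

/-! ### First consequences of the axioms -/

namespace FullVertexData

variable {F : Type*} [AddCommGroup F] [Module ℂ F] {X : FullVertexData F}

/-- The correlation function of `a`, `b`, `m`, in the component of bidegree `(α, β)`. -/
theorem IsFullVertexAlgebra.isCorrelation (hX : X.IsFullVertexAlgebra) (a b m : F) {u : F →ₗ[ℂ] ℂ}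
    (hu : IsGradedDual X.gr u) {α β : ℝ} (hαβ : ∃ n : ℤ, α - β = n) :
    IsCorrelation α β
      (fun q q' => u (X.mode (-(α - q) - 1) (-(β - q') - 1) a (X.mode (-q - 1) (-q' - 1) b m)))
      (fun p p' => u (X.mode (-(α - p) - 1) (-(β - p') - 1) (X.mode (-p - 1) (-p' - 1) a b) m))
      (fun p p' => u (X.mode (-(α - p) - 1) (-(β - p') - 1) b (X.mode (-p - 1) (-p' - 1) a m))) :=
  let ⟨_, h⟩ := hX.fv5 a b m u hu
  h.isCorrelation hαβ

theorem IsFullVertexAlgebra.integral (hX : X.IsFullVertexAlgebra) {a b : F} {r s : ℝ}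
    (h : X.mode r s a b ≠ 0) : ∃ n : ℤ, r - s = n := by
  obtain ⟨n, hn⟩ := (hX.fv1 a b).integral (-r - 1) (-s - 1)
    (by simpa only [series, neg_sub, sub_neg_eq_add, add_sub_cancel_left] using h)
  exact ⟨-n, by push_cast; linarith⟩

theorem IsFullVertexAlgebra.truncation (hX : X.IsFullVertexAlgebra) (a b : F) (r s : ℝ) :
    ∃ N : ℕ, ∀ i : ℕ, N ≤ i → X.mode (r + i) s a b = 0 := by
  obtain ⟨N, hN⟩ := (hX.fv1 a b).bounded
  refine ⟨⌈-r - N⌉₊, fun i hi => ?_⟩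
  by_contra h
  have := (hN (-(r + i) - 1) (-s - 1)
    (by simpa only [series, neg_sub, sub_neg_eq_add, add_sub_cancel_left] using h)).1
  have h1 := Nat.le_ceil (-r - N)
  have h2 : ((⌈-r - N⌉₊ : ℕ) : ℝ) ≤ i := by exact_mod_cast hi
  linarith

theorem mode_congr {r s r' s' : ℝ} (hr : r = r') (hs : s = s') :
    X.mode r s = X.mode r' s' := by
  rw [hr, hs]

end FullVertexData

theorem IsExpansionAtZero.eventuallyEq {c : ℝ → ℝ → ℂ} {g h : ℂ → ℂ} (hg : IsExpansionAtZero c g)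
    (hh : IsExpansionAtZero c h) : ∀ᶠ z in 𝓝[≠] 0, g z = h z := by
  obtain ⟨-, R, hR, -, hz⟩ := hg
  obtain ⟨-, R', hR', -, hz'⟩ := hh
  filter_upwards [self_mem_nhdsWithin, nhdsWithin_le_nhds (Metric.ball_mem_nhds 0 hR),
    nhdsWithin_le_nhds (Metric.ball_mem_nhds 0 hR')] with z h0 h1 h2
  exact (hz z h0 (by simpa using h1)).unique (hz' z h0 (by simpa using h2))

open Classical in
/-- If `F(1, z)` is constant, then `F(z₁, z₂)` is a multiple of `z₁^α z̄₁^β`. -/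
theorem IsCorrelation.of_const {α β : ℝ} {e d : ℝ → ℝ → ℂ} {K : ℂ}
    (h : IsCorrelation α β (fun s t => K * if s = 0 ∧ t = 0 then 1 else 0) e d)
    (hαβ : ∃ n : ℤ, α - β = n) : e = fun s t => K * binom α β s t := by
  obtain ⟨f, hf, hc, he, -⟩ := h
  have h0 : IsExpansionAtZero (fun s t => K * if s = 0 ∧ t = 0 then 1 else 0) (fun _ => K) :=
    ((isExpansionAtZero_mono ⟨0, by simp⟩).const_mul K).congr
      (.of_forall fun z => by rw [mono_zero_zero, mul_one])
  have hfK := eqOn_of_eventuallyEq_punctured hf.analytic (fun _ _ => analyticAt_const)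
    (hc.eventuallyEq h0)
  refine he.unique ((isExpansionAtZero_binom hαβ).const_mul K) ?_
  have : ∀ᶠ z : ℂ in 𝓝 0, 1 + z ≠ 0 :=
    (continuous_const.add continuous_id).continuousAt.eventually_ne (by simp)
  filter_upwards [nhdsWithin_le_nhds this, self_mem_nhdsWithin] with z h1 h2
  have h2 : z ≠ 0 := h2
  rw [hfK (x := (1 + z)⁻¹) (by simpa using ⟨h1, h2⟩), mul_comm]

namespace FullVertexData

variable {F : Type*} [AddCommGroup F] [Module ℂ F] {X : FullVertexData F}

/-- `Y(D̄a, z) = ∂̄ Y(a, z)`. -/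
theorem IsFullVertexAlgebra.mode_Dbar (hX : X.IsFullVertexAlgebra) (a m : F) (r s : ℝ) :
    X.mode r (s + 1) (X.Dbar a) m = ((-(s + 1) : ℝ) : ℂ) • X.mode r s a m := by
  classical
  by_cases hrs : ∃ n : ℤ, r - s = n
  swap
  · have h1 : X.mode r s a m = 0 := by
      by_contra h
      exact hrs (hX.integral h)
    have h2 : X.mode r (s + 1) (X.Dbar a) m = 0 := by
      by_contra h
      obtain ⟨n, hn⟩ := hX.integral h
      exact hrs ⟨n + 1, by push_cast; linarith⟩
    rw [h1, h2, smul_zero]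
  refine eq_of_forall_isGradedDual hX.internal fun u hu => ?_
  have hαβ : ∃ n : ℤ, (-r - 1) - (-s - 1) = n := by
    obtain ⟨n, hn⟩ := hrs
    exact ⟨-n, by push_cast; linarith⟩
  have hcor := hX.isCorrelation a X.vac m hu hαβ
  have hc : (fun q q' : ℝ => u (X.mode (-(-r - 1 - q) - 1) (-(-s - 1 - q') - 1) a
      (X.mode (-q - 1) (-q' - 1) X.vac m))) =
      fun q q' => u (X.mode r s a m) * if q = 0 ∧ q' = 0 then 1 else 0 := by
    funext q q'
    split_ifs with h
    · obtain ⟨rfl, rfl⟩ := h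
      rw [neg_zero, zero_sub, hX.fv4_id, mul_one,
        mode_congr (show -(-r - 1 - 0) - 1 = r by ring) (show -(-s - 1 - 0) - 1 = s by ring)]
    · rw [hX.fv4_zero, map_zero, map_zero, mul_zero]
      intro h'
      rw [Prod.mk.injEq] at h'
      exact h ⟨by linarith [h'.1], by linarith [h'.2]⟩
  rw [hc] at hcor
  have := congrFun (congrFun (hcor.of_const hαβ) ((0 : ℕ) : ℝ)) ((1 : ℕ) : ℝ)
  rw [binom_natCast] at this
  simp only [Ring.choose_zero_right, Ring.choose_one_right, Nat.cast_zero, Nat.cast_one, one_mul]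
    at this
  rw [mode_congr (show -(-r - 1 - 0) - 1 = r by ring) (show -(-s - 1 - 1) - 1 = s + 1 by ring),
    mode_congr (show -0 - 1 = (-1 : ℝ) by ring) (show -1 - 1 = (-2 : ℝ) by ring)] at this
  rw [map_smul, smul_eq_mul]
  refine Eq.trans this ?_
  push_cast
  ring

/-- The fields `Y(a, z)`, `a ∈ ker D̄`, are holomorphic: by `mode_Dbar`, `(s + 1) a(r, s) = 0`. -/
theorem IsFullVertexAlgebra.eq_of_mode_ne_zero (hX : X.IsFullVertexAlgebra) {a : F}
    (ha : X.Dbar a = 0) {m : F} {r s : ℝ} (h : X.mode r s a m ≠ 0) :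
    s = -1 ∧ ∃ n : ℤ, r = n := by
  have h1 := hX.mode_Dbar a m r s
  rw [ha, map_zero, LinearMap.zero_apply] at h1
  have hs : s = -1 := by
    rcases smul_eq_zero.1 h1.symm with h2 | h2
    · have : -(s + 1) = 0 := by exact_mod_cast h2
      linarith
    · exact absurd h2 h
  obtain ⟨n, hn⟩ := hX.integral h
  exact ⟨hs, n - 1, by push_cast; linarith⟩

/-- The Borcherds identity for a holomorphic field `Y(a, z)` and an arbitrary field `Y(b, z)`. -/
theorem IsFullVertexAlgebra.borcherds (hX : X.IsFullVertexAlgebra) {a : F} (ha : X.Dbar a = 0)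
    (b m : F) (k l : ℤ) (r s : ℝ) :
    ∑ᶠ i : ℕ, Ring.choose l i • X.mode (l + r - i) s (X.mode (k + i) (-1) a b) m =
      ∑ᶠ i : ℕ, ((-1 : ℤ) ^ i * Ring.choose k i) •
        (X.mode (l + k - i) (-1) a (X.mode (r + i) s b m) -
          ((-1 : ℂ) ^ k) • X.mode (r + k - i) s b (X.mode (l + i) (-1) a m)) := by
  by_cases hrs : ∃ n : ℤ, r - s = n
  swap
  · -- all terms vanish for degree reasons
    have hb : ∀ (x y : F) (j : ℤ), X.mode (r + j) s x y = 0 := by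
      intro x y j
      by_contra h
      obtain ⟨n, hn⟩ := hX.integral h
      exact hrs ⟨n - j, by push_cast; linarith⟩
    rw [finsum_eq_zero_of_forall_eq_zero, finsum_eq_zero_of_forall_eq_zero]
    · intro i
      have h1 := hb b m i
      have h2 := hb b (X.mode (l + i) (-1) a m) (k - i)
      push_cast at h1 h2
      rw [h1, add_sub_assoc r, h2]
      simp
    · intro i
      have h1 := hb (X.mode (k + i) (-1) a b) m (l - i)
      push_cast at h1
      rw [show (l : ℝ) + r - i = r + (l - i) by ring, h1, smul_zero]
  obtain ⟨N₁, hN₁⟩ := hX.truncation a b k (-1)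
  obtain ⟨N₂, hN₂⟩ := hX.truncation b m r s
  obtain ⟨N₃, hN₃⟩ := hX.truncation a m l (-1)
  have fin1 : (Function.support fun i : ℕ => Ring.choose l i •
      X.mode (l + r - i) s (X.mode (k + i) (-1) a b) m).Finite := by
    refine (Set.finite_lt_nat N₁).subset fun i hi => ?_
    by_contra h
    exact hi (by simp [hN₁ i (not_lt.1 h)])
  have fin2 : (Function.support fun i : ℕ => ((-1 : ℤ) ^ i * Ring.choose k i) •
      X.mode (l + k - i) (-1) a (X.mode (r + i) s b m)).Finite := by
    refine (Set.finite_lt_nat N₂).subset fun i hi => ?_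
    by_contra h
    exact hi (by simp [hN₂ i (not_lt.1 h)])
  have fin3 : (Function.support fun i : ℕ => ((-1 : ℤ) ^ i * Ring.choose k i) •
      X.mode (r + k - i) s b (X.mode (l + i) (-1) a m)).Finite := by
    refine (Set.finite_lt_nat N₃).subset fun i hi => ?_
    by_contra h
    exact hi (by simp [hN₃ i (not_lt.1 h)])
  have split : ∑ᶠ i : ℕ, ((-1 : ℤ) ^ i * Ring.choose k i) •
        (X.mode (l + k - i) (-1) a (X.mode (r + i) s b m) -
          ((-1 : ℂ) ^ k) • X.mode (r + k - i) s b (X.mode (l + i) (-1) a m)) =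
      ∑ᶠ i : ℕ, ((-1 : ℤ) ^ i * Ring.choose k i) •
        X.mode (l + k - i) (-1) a (X.mode (r + i) s b m) -
      ((-1 : ℂ) ^ k) • ∑ᶠ i : ℕ, ((-1 : ℤ) ^ i * Ring.choose k i) •
        X.mode (r + k - i) s b (X.mode (l + i) (-1) a m) := by
    rw [smul_finsum, ← finsum_sub_distrib fin2 (fin3.subset fun i hi h => hi (by
      dsimp only at h ⊢
      rw [h, smul_zero]))]
    exact finsum_congr fun i => by rw [smul_sub, smul_comm]
  rw [split]
  refine eq_of_forall_isGradedDual hX.internal fun u hu => ?_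
  have hmap : ∀ f : ℕ → F, (Function.support f).Finite → u (∑ᶠ i, f i) = ∑ᶠ i, u (f i) :=
    fun f hf => u.toAddMonoidHom.map_finsum hf
  rw [map_sub, map_smul, hmap _ fin1, hmap _ fin2, hmap _ fin3, smul_eq_mul]
  -- the bidegree of the component of the correlation function which contains all terms
  set α : ℝ := -k - l - r - 2 with hα
  set β : ℝ := -s - 1 with hβ
  have hαβ : ∃ n : ℤ, α - β = n := by
    obtain ⟨n, hn⟩ := hrs
    exact ⟨-k - l - n - 1, by push_cast; rw [hα, hβ]; linarith⟩
  have key := (hX.isCorrelation a b m hu hαβ).residue hαβ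
    (fun p p' h => by
      have := (hX.eq_of_mode_ne_zero ha (fun h' => h (by rw [h', map_zero]))).1
      linarith)
    (fun p p' h => by
      have := (hX.eq_of_mode_ne_zero ha (m := b) (r := -p - 1) (s := -p' - 1)
        (fun h' => h (by rw [h', map_zero, LinearMap.zero_apply, map_zero]))).1
      linarith)
    (fun p p' h => by
      have := (hX.eq_of_mode_ne_zero ha (m := m) (r := -p - 1) (s := -p' - 1)
        (fun h' => h (by rw [h', map_zero, map_zero]))).1
      linarith) k l
  refine Eq.trans (finsum_congr fun i => ?_) (key.trans (congrArg₂ (· - ·)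
    (finsum_congr fun i => ?_) (congrArg _ (finsum_congr fun i => ?_))))
  · rw [map_zsmul, zsmul_eq_mul,
      mode_congr (show -(α - (-1 - k - i)) - 1 = l + r - i by rw [hα]; ring)
        (show -(β - 0) - 1 = s by rw [hβ]; ring),
      mode_congr (show -(-1 - (k : ℝ) - i) - 1 = k + i by ring) (show -0 - 1 = (-1 : ℝ) by ring)]
  · rw [map_zsmul, zsmul_eq_mul,
      mode_congr (show -(α - (1 + l + k - i + α)) - 1 = l + k - i by ring)
        (show -(β - β) - 1 = (-1 : ℝ) by ring),
      mode_congr (show -(1 + l + k - i + α) - 1 = r + i by rw [hα]; ring)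
        (show -β - 1 = s by rw [hβ]; ring)]
  · rw [map_zsmul, zsmul_eq_mul,
      mode_congr (show -(α - (-1 - l - i)) - 1 = r + k - i by rw [hα]; ring)
        (show -(β - 0) - 1 = s by rw [hβ]; ring),
      mode_congr (show -(-1 - (l : ℝ) - i) - 1 = l + i by ring) (show -0 - 1 = (-1 : ℝ) by ring)]

end FullVertexData

namespace FullVertexData

variable {F : Type*} [AddCommGroup F] [Module ℂ F] {X : FullVertexData F}

/-! ### The subalgebra `ker D̄` -/

theorem IsFullVertexAlgebra.Dbar_mem (hX : X.IsFullVertexAlgebra) {p : ℝ × ℝ} {x : F}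
    (hx : x ∈ X.gr p) : X.Dbar x ∈ X.gr (p.1, p.2 + 1) := by
  have := hX.fv6 (-1) (-2) p.1 p.2 0 0 x hx X.vac hX.vac_mem
  rwa [show (p.1 + 0 - -1 - 1, p.2 + 0 - -2 - 1) = (p.1, p.2 + 1) by
    ext
    · simp
    · dsimp only
      ring] at this

theorem IsFullVertexAlgebra.Dbar_projection (hX : X.IsFullVertexAlgebra) {π : ℝ × ℝ → F →ₗ[ℂ] F}
    (hπ : IsProjections X.gr π) (p : ℝ × ℝ) (x : F) :
    X.Dbar (π p x) = π (p.1, p.2 + 1) (X.Dbar x) := by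
  obtain ⟨T, hT⟩ := hπ.eq_sum x
  conv_rhs => rw [hT (insert p T) (Finset.subset_insert _ _)]
  rw [map_sum, map_sum, Finset.sum_eq_single_of_mem p (Finset.mem_insert_self _ _)]
  · exact (hπ.same _ _ (hX.Dbar_mem (hπ.mem p x))).symm
  · intro q _ hq
    refine hπ.ne _ _ ?_ _ (hX.Dbar_mem (hπ.mem q x))
    intro h
    rw [Prod.mk.injEq] at h
    exact hq (Prod.ext h.1.symm (by linarith [h.2]))

theorem IsFullVertexAlgebra.Dbar_mode (hX : X.IsFullVertexAlgebra) {a b : F}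
    (ha : X.Dbar a = 0) (hb : X.Dbar b = 0) (r s : ℝ) : X.Dbar (X.mode r s a b) = 0 := by
  by_cases h : X.mode r s a b = 0
  · rw [h, map_zero]
  obtain ⟨rfl, k, rfl⟩ := hX.eq_of_mode_ne_zero ha h
  have hb0 : ∀ (r : ℝ) (m : F), X.mode r (-2) b m = 0 := by
    intro r m
    by_contra h
    have := (hX.eq_of_mode_ne_zero hb h).1
    norm_num at this
  have key := hX.borcherds ha b X.vac k 0 (-1) (-2)
  rw [finsum_eq_single _ 0 (fun i hi => by
    rw [Ring.choose_zero_pos _ (Nat.pos_of_ne_zero hi), zero_smul])] at key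
  have : X.mode (-1) (-2) (X.mode k (-1) a b) X.vac = 0 := by simpa [hb0] using key
  exact this

theorem IsFullVertexAlgebra.isSubalgebra_ker_Dbar (hX : X.IsFullVertexAlgebra) :
    X.IsSubalgebra (LinearMap.ker X.Dbar) where
  graded := by
    obtain ⟨π, hπ⟩ := exists_isProjections hX.internal
    refine le_antisymm (fun x hx => hπ.mem_of_forall fun p => ?_) (iSup_le fun p => inf_le_left)
    refine le_iSup (fun p => LinearMap.ker X.Dbar ⊓ X.gr p) p ⟨?_, hπ.mem p x⟩
    rw [SetLike.mem_coe, LinearMap.mem_ker, hX.Dbar_projection hπ, LinearMap.mem_ker.1 hx, map_zero]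
  vac_mem := hX.fv4_zero _ _ _ (by norm_num)
  mode_mem r s a ha b hb := hX.Dbar_mode ha hb r s

/-- `F` is a module over the vertex algebra `ker D̄`. -/
theorem IsFullVertexAlgebra.isVertexModule (hX : X.IsFullVertexAlgebra)
    (hK : X.IsSubalgebra (LinearMap.ker X.Dbar)) :
    IsVertexModule (fun n : ℤ => (X.restrict _ hK).mode n (-1)) (X.restrict _ hK).vac
      (fun n : ℤ => (X.mode n (-1)).domRestrict (LinearMap.ker X.Dbar)) where
  truncation a m := by
    obtain ⟨N, hN⟩ := hX.truncation a m 0 (-1)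
    refine ⟨N, fun n hn => ?_⟩
    obtain ⟨i, rfl⟩ := Int.eq_ofNat_of_zero_le (show 0 ≤ n by omega)
    have := hN i (by exact_mod_cast hn)
    rw [zero_add] at this
    exact_mod_cast this
  vacuum_id m := by
    have := hX.fv4_id m
    simpa [restrict] using this
  vacuum_zero n m hn := hX.fv4_zero _ _ _ fun h => hn (by
    rw [Prod.mk.injEq] at h
    exact_mod_cast h.1)
  borcherds k l n a b m := by
    have := hX.borcherds (LinearMap.mem_ker.1 a.2) (b : F) m k l n (-1)
    simpa [restrict] using this

/-- `ker D̄` is a vertex algebra. -/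
theorem IsFullVertexAlgebra.isVertexAlgebra (hX : X.IsFullVertexAlgebra)
    (hK : X.IsSubalgebra (LinearMap.ker X.Dbar)) :
    IsVertexAlgebra (fun n : ℤ => (X.restrict _ hK).mode n (-1)) (X.restrict _ hK).vac := by
  have hM := hX.isVertexModule hK
  have coe_finsum : ∀ f : ℕ → LinearMap.ker X.Dbar,
      ((∑ᶠ i, f i : LinearMap.ker X.Dbar) : F) = ∑ᶠ i, (f i : F) := fun f =>
    (LinearMap.ker X.Dbar).subtype.toAddMonoidHom.map_finsum_of_injective
      (LinearMap.ker X.Dbar).injective_subtype f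
  refine ⟨⟨fun a m => ?_, fun m => ?_, fun n m hn => ?_, fun k l n a b m => ?_⟩,
    fun a n hn => ?_, fun a => ?_⟩
  · obtain ⟨N, hN⟩ := hM.truncation a m
    exact ⟨N, fun n hn => Subtype.ext (hN n hn)⟩
  · exact Subtype.ext (hM.vacuum_id m)
  · exact Subtype.ext (hM.vacuum_zero n m hn)
  · refine Subtype.ext ?_
    rw [coe_finsum, coe_finsum]
    exact hM.borcherds k l n a b m
  · refine Subtype.ext ?_
    by_contra h
    obtain ⟨i, j, hi, -⟩ := hX.fv3_regular a (-n - 1) (-(-1) - 1) (by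
      simpa [series, restrict] using h)
    have h1 : (0 : ℝ) ≤ i := i.cast_nonneg
    have h2 : (0 : ℝ) ≤ n := by exact_mod_cast hn
    linarith
  · refine Subtype.ext ?_
    have := hX.fv3_limit a
    simpa [restrict] using this

/-! ### Subalgebras and modules -/

/-- Graded subalgebras of full vertex algebras are full vertex algebras. -/
theorem IsFullVertexAlgebra.restrict (hX : X.IsFullVertexAlgebra) {S : Submodule ℂ F}
    (hS : X.IsSubalgebra S) : (X.restrict S hS).IsFullVertexAlgebra where
  internal := by
    refine DirectSum.isInternal_submodule_of_iSupIndep_of_iSup_eq_top ?_ ?_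
    · obtain ⟨π, hπ⟩ := exists_isProjections hX.internal
      refine iSupIndep_def.2 fun p => Submodule.disjoint_def.2 fun x hx hx' => Subtype.ext ?_
      have : ⨆ (q) (_ : q ≠ p), (X.restrict S hS).gr q ≤ LinearMap.ker (π p ∘ₗ S.subtype) :=
        iSup₂_le fun q hq y hy => hπ.ne p q hq.symm y hy
      have h0 := this hx'
      rw [LinearMap.mem_ker, LinearMap.comp_apply] at h0
      exact (hπ.same p x hx).symm.trans h0
    · refine Submodule.map_injective_of_injective S.injective_subtype ?_
      rw [Submodule.map_iSup, Submodule.map_top, Submodule.range_subtype]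
      conv_rhs => rw [hS.graded]
      exact iSup_congr fun p => Submodule.map_comap_subtype _ _
  vac_mem := hX.vac_mem
  fv1 a b := (hX.fv1 a b).of_support fun s t h h' => h (Subtype.ext h')
  fv2 h h' hne := by
    refine hX.fv2 h h' fun hbot => hne ?_
    rw [eq_bot_iff]
    intro x hx
    have : (x : F) ∈ X.gr (h, h') := hx
    rw [hbot] at this
    exact Subtype.ext ((Submodule.mem_bot ℂ).1 this)
  fv3_regular a p p' h := hX.fv3_regular a p p' fun h' => h (Subtype.ext h')
  fv3_limit a := Subtype.ext (hX.fv3_limit a)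
  fv4_id b := Subtype.ext (hX.fv4_id b)
  fv4_zero r s b h := Subtype.ext (hX.fv4_zero r s b h)
  fv5 a b c u hu := by
    obtain ⟨v, hv, hvu⟩ := exists_isGradedDual_extend_of_graded hX.internal hS.graded hu
    obtain ⟨μ, hμ⟩ := hX.fv5 a b c v hv
    refine ⟨μ, ?_⟩
    simp only [← hvu]
    exact hμ
  fv6 r s h h' k k' a ha b hb := hX.fv6 r s h h' k k' a ha b hb

/-- A full vertex algebra is a module of each of its subalgebras. -/
theorem IsFullVertexAlgebra.isModule_restrict (hX : X.IsFullVertexAlgebra) {S : Submodule ℂ F}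
    (hS : X.IsSubalgebra S) :
    (X.restrict S hS).IsModule X.gr (fun r s => (X.mode r s).domRestrict S) where
  internal := hX.internal
  fm1 a m := hX.fv1 a m
  fm2_id m := hX.fv4_id m
  fm2_zero r s m h := hX.fv4_zero r s m h
  fm3 a b m u hu := hX.fv5 a b m u hu
  fm4 r s h h' k k' a ha m hm := hX.fv6 r s h h' k k' a ha m hm

/-! ### Exchange of the holomorphic and the antiholomorphic variable -/

/-- The structure obtained by exchanging `z` and `z̄`. -/
def swap (X : FullVertexData F) : FullVertexData F where
  gr p := X.gr p.swap
  mode r s := X.mode s r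
  vac := X.vac

theorem IsFullVertexAlgebra.swap (hX : X.IsFullVertexAlgebra) : X.swap.IsFullVertexAlgebra where
  internal := by
    refine DirectSum.isInternal_submodule_of_iSupIndep_of_iSup_eq_top
      (hX.internal.submodule_iSupIndep.comp Prod.swap_injective) ?_
    exact (Prod.swap_surjective.iSup_comp X.gr).trans hX.internal.submodule_iSup_eq_top
  vac_mem := hX.vac_mem
  fv1 a b := (hX.fv1 a b).swap
  fv2 h h' hne := by
    obtain ⟨n, hn⟩ := hX.fv2 h' h hne
    exact ⟨-n, by push_cast; linarith⟩
  fv3_regular a p p' h := by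
    obtain ⟨m, n, hm, hn⟩ := hX.fv3_regular a p' p h
    exact ⟨n, m, hn, hm⟩
  fv3_limit a := hX.fv3_limit a
  fv4_id b := hX.fv4_id b
  fv4_zero r s b h := hX.fv4_zero s r b fun h' => h (by
    rw [Prod.mk.injEq] at h' ⊢
    exact h'.symm)
  fv5 a b c u hu := by
    obtain ⟨μ, hμ⟩ := hX.fv5 a b c u (by
      have := hu.preimage (f := Prod.swap) Prod.swap_injective.injOn
      exact this)
    exact hμ.swap
  fv6 r s h h' k k' a ha b hb := hX.fv6 s r h' h k' k a ha b hb

theorem IsSubalgebra.of_swap {S : Submodule ℂ F} (hS : X.swap.IsSubalgebra S) :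
    X.IsSubalgebra S where
  graded := by
    conv_lhs => rw [hS.graded]
    exact Prod.swap_surjective.iSup_comp (fun p => S ⊓ X.gr p)
  vac_mem := hS.vac_mem
  mode_mem r s := hS.mode_mem s r

theorem IsFullVertexAlgebra.isSubalgebra_ker_D (hX : X.IsFullVertexAlgebra) :
    X.IsSubalgebra (LinearMap.ker X.D) :=
  IsSubalgebra.of_swap (X := X) hX.swap.isSubalgebra_ker_Dbar

end FullVertexData

namespace FullVertexData

variable {F : Type*} [AddCommGroup F] [Module ℂ F] {X : FullVertexData F}

/-! ### Holomorphic and antiholomorphic fields commute -/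

/-- The fields `Y(b, z)`, `b ∈ ker D`, are antiholomorphic. -/
theorem IsFullVertexAlgebra.eq_of_mode_ne_zero' (hX : X.IsFullVertexAlgebra) {b : F}
    (hb : X.D b = 0) {m : F} {r s : ℝ} (h : X.mode r s b m ≠ 0) :
    r = -1 ∧ ∃ n : ℤ, s = n :=
  hX.swap.eq_of_mode_ne_zero (a := b) (m := m) (r := s) (s := r) hb h

/-- There are no singular terms in the operator product of `Y(a, z)` and `Y(b, z)`,
for `a ∈ ker D̄` and `b ∈ ker D`. -/
theorem IsFullVertexAlgebra.mode_natCast_eq_zero (hX : X.IsFullVertexAlgebra) {a b : F}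
    (ha : X.Dbar a = 0) (hb : X.D b = 0) (n : ℕ) : X.mode n (-1) a b = 0 := by
  obtain ⟨N, hN⟩ := hX.truncation a b 0 (-1)
  simp only [zero_add] at hN
  have step : ∀ n : ℕ, (∀ i : ℕ, n < i → X.mode i (-1) a b = 0) → X.mode n (-1) a b = 0 := by
    intro n hn
    -- with this choice of exponents every term on the right hand side vanishes
    have key := hX.borcherds ha b X.vac n (n + 1) (-n - 2) (-1)
    rw [finsum_eq_single _ 0 (fun i hi => by
      have := hn (n + i) (by omega)
      push_cast at this ⊢
      rw [this]
      simp), finsum_eq_zero_of_forall_eq_zero (fun i => by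
        by_cases hi : i ≤ n
        · have hi' : (i : ℝ) ≤ n := by exact_mod_cast hi
          have h1 : X.mode (-n - 2 + i) (-1) b X.vac = 0 := by
            by_contra h
            have := (hX.eq_of_mode_ne_zero' hb h).1
            linarith
          have h2 : ∀ m, X.mode (-n - 2 + ((n : ℤ) : ℝ) - i) (-1) b m = 0 := by
            intro m
            by_contra h
            have := (hX.eq_of_mode_ne_zero' hb h).1
            push_cast at this
            linarith [(i.cast_nonneg : (0 : ℝ) ≤ i)]
          rw [h1, h2]
          simp
        · rw [Ring.choose_natCast, Nat.choose_eq_zero_of_lt (not_le.1 hi)]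
          simp)] at key
    rw [Ring.choose_zero_right, one_smul, mode_congr
      (show (((n : ℤ) + 1 : ℤ) : ℝ) + (-n - 2) - (0 : ℕ) = -1 by push_cast; ring) rfl,
      hX.fv3_limit] at key
    simpa using key
  -- by truncation the products vanish for large `n`
  have desc : ∀ j n : ℕ, N ≤ n + j → X.mode n (-1) a b = 0 := by
    intro j
    induction j with
    | zero => exact fun n hn => hN n hn
    | succ j ih => exact fun n hn => step n fun i hi => ih i (by omega)
  exact desc N n (Nat.le_add_left N n)

theorem IsFullVertexAlgebra.mode_comm (hX : X.IsFullVertexAlgebra) {a b : F}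
    (ha : X.Dbar a = 0) (hb : X.D b = 0) (l : ℤ) (r s : ℝ) (m : F) :
    X.mode l (-1) a (X.mode r s b m) = X.mode r s b (X.mode l (-1) a m) := by
  have key := hX.borcherds ha b m 0 l r s
  rw [finsum_eq_zero_of_forall_eq_zero (fun i => by
    have := hX.mode_natCast_eq_zero ha hb i
    rw [Int.cast_zero, zero_add, this]
    simp), finsum_eq_single _ 0 (fun i hi => by
      rw [Ring.choose_zero_pos _ (Nat.pos_of_ne_zero hi), mul_zero, zero_smul])] at key
  simp only [pow_zero, Ring.choose_zero_right, mul_one, one_smul, zpow_zero, Int.cast_zero,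
    Nat.cast_zero, add_zero, sub_zero] at key
  exact (sub_eq_zero.1 key.symm)

theorem neg_one_pow_mul_choose_neg_one (i : ℕ) : (-1 : ℤ) ^ i * Ring.choose (-1 : ℤ) i = 1 := by
  rw [Ring.choose_neg', Ring.multichoose_one, Int.negOnePow_def, zpow_natCast, Units.smul_def,
    smul_eq_mul, mul_one, Units.val_pow_eq_pow_val, Units.val_neg, Units.val_one, ← mul_pow]
  simp

/-- `Y(a(-1, -1) b, z) = Y(a, z) Y(b, z)` for `a ∈ ker D̄` and `b ∈ ker D`. -/
theorem IsFullVertexAlgebra.mode_product (hX : X.IsFullVertexAlgebra) {a b : F}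
    (ha : X.Dbar a = 0) (hb : X.D b = 0) (r s : ℝ) (m : F) :
    X.mode r s (X.mode (-1) (-1) a b) m = X.mode r (-1) a (X.mode (-1) s b m) := by
  have key := hX.borcherds ha b m (-1) 0 r s
  rw [finsum_eq_single _ 0 (fun i hi => by
    rw [Ring.choose_zero_pos _ (Nat.pos_of_ne_zero hi), zero_smul])] at key
  simp only [neg_one_pow_mul_choose_neg_one, Ring.choose_zero_right, one_smul, zpow_neg_one,
    inv_neg, inv_one, neg_smul, sub_neg_eq_add, Int.cast_neg, Int.cast_one, Int.cast_zero,
    Nat.cast_zero, add_zero, sub_zero, zero_add] at key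
  rw [key]
  have hb0 : ∀ (r' : ℝ) (m : F), r' ≠ -1 → X.mode r' s b m = 0 := fun r' m hr => by
    by_contra h
    exact hr (hX.eq_of_mode_ne_zero' hb h).1
  by_cases hr : ∃ n : ℤ, r = n
  swap
  · have h1 : X.mode r (-1) a (X.mode (-1) s b m) = 0 := by
      by_contra h
      exact hr (hX.eq_of_mode_ne_zero ha h).2
    rw [h1]
    refine finsum_eq_zero_of_forall_eq_zero fun i => ?_
    rw [hb0 (r + i) m fun h => hr ⟨-1 - i, by push_cast; linarith⟩,
      hb0 (r + -1 - i) _ fun h => hr ⟨i, by push_cast; linarith⟩, map_zero, add_zero]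
  obtain ⟨n, rfl⟩ := hr
  rcases le_or_gt 0 n with hn | hn
  · obtain ⟨j, rfl⟩ := Int.eq_ofNat_of_zero_le hn
    rw [finsum_eq_single _ j]
    · rw [hb0 _ m (by push_cast; linarith [(j.cast_nonneg : (0 : ℝ) ≤ j)]), map_zero, zero_add,
        mode_congr (show ((j : ℤ) : ℝ) + -1 - j = -1 by push_cast; ring) rfl]
      have := hX.mode_comm ha hb j (-1) s m
      rw [this, Int.cast_natCast]
    · intro i hi
      rw [hb0 _ m (by push_cast; linarith [(j.cast_nonneg : (0 : ℝ) ≤ j),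
        (i.cast_nonneg : (0 : ℝ) ≤ i)]), hb0 _ _ (fun h => hi (by
          push_cast at h
          exact_mod_cast (show (i : ℝ) = j by linarith))), map_zero, add_zero]
  · obtain ⟨j, rfl⟩ : ∃ j : ℕ, n = -1 - j := ⟨(-1 - n).toNat, by omega⟩
    have hb1 : ∀ (i : ℕ) m, X.mode (((-1 - j : ℤ) : ℝ) + -1 - i) s b m = 0 := fun i m =>
      hb0 _ m (by push_cast; linarith [(j.cast_nonneg : (0 : ℝ) ≤ j),
        (i.cast_nonneg : (0 : ℝ) ≤ i)])
    simp only [hb1, add_zero]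
    rw [finsum_eq_single _ j]
    · rw [mode_congr (show ((-1 - j : ℤ) : ℝ) + j = -1 by push_cast; ring) rfl]
      push_cast
      rfl
    · intro i hi
      rw [hb0 _ m (fun h => hi (by
          push_cast at h
          exact_mod_cast (show (i : ℝ) = j by linarith))), map_zero]

/-- Since `a(i, -1) d = c(i, -1) d = 0` for `i ≥ 0`, the associativity formula has a single
term when it is applied to `d ∈ ker D`. -/
theorem IsFullVertexAlgebra.mode_mode_of_mem_ker (hX : X.IsFullVertexAlgebra) {a c d : F}
    (ha : X.Dbar a = 0) (hc : X.Dbar c = 0) (hd : X.D d = 0) (k : ℤ) :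
    X.mode (-1) (-1) (X.mode k (-1) a c) d = X.mode k (-1) a (X.mode (-1) (-1) c d) := by
  have key := hX.borcherds ha c d k 0 (-1) (-1)
  rw [finsum_eq_single _ 0 (fun i hi => by
    rw [Ring.choose_zero_pos _ (Nat.pos_of_ne_zero hi), zero_smul]),
    finsum_eq_single _ 0 (fun i hi => by
      have h1 := hX.mode_natCast_eq_zero ha hd i
      have h2 := hX.mode_natCast_eq_zero hc hd (i - 1)
      rw [Nat.cast_sub (Nat.one_le_iff_ne_zero.2 hi), Nat.cast_one] at h2
      rw [Int.cast_zero, zero_add, zero_add, h1, neg_add_eq_sub, h2]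
      simp)] at key
  have h0 := hX.mode_natCast_eq_zero ha hd 0
  rw [Nat.cast_zero] at h0
  simpa [h0] using key

end FullVertexData

/-! ### Correlation functions with values in a finite dimensional space -/

namespace FullVertexData

variable {F : Type*} [AddCommGroup F] [Module ℂ F] {X : FullVertexData F}

/-- The coefficients of total degree `(α, β)` in the three expansions of the two-point function of
`a`, `b`, `m` lie in a common finite dimensional space. -/
def HasFiniteSpan (X : FullVertexData F) (a b m : F) (α β : ℝ) : Prop :=
  ∃ W : Submodule ℂ F, FiniteDimensional ℂ W ∧ ∀ p p',
    X.mode (-(α - p) - 1) (-(β - p') - 1) a (X.mode (-p - 1) (-p' - 1) b m) ∈ W ∧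
    X.mode (-(α - p) - 1) (-(β - p') - 1) (X.mode (-p - 1) (-p' - 1) a b) m ∈ W ∧
    X.mode (-(α - p) - 1) (-(β - p') - 1) b (X.mode (-p - 1) (-p' - 1) a m) ∈ W

theorem HasFiniteSpan.of_swap {a b m : F} {α β : ℝ} (h : X.swap.HasFiniteSpan a b m β α) :
    X.HasFiniteSpan a b m α β :=
  let ⟨W, hW, h⟩ := h
  ⟨W, hW, fun p p' => h p' p⟩

/-- By truncation, the commutator formula and the associativity formula, all coefficients are linear
combinations of finitely many of them. -/
theorem IsFullVertexAlgebra.exists_finiteDimensional (hX : X.IsFullVertexAlgebra) {a : F}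
    (ha : X.Dbar a = 0) (b m : F) (γ s : ℝ) :
    ∃ W : Submodule ℂ F, FiniteDimensional ℂ W ∧ ∀ n : ℤ,
      X.mode n (-1) a (X.mode (γ - n) s b m) ∈ W ∧ X.mode (γ - n) s (X.mode n (-1) a b) m ∈ W ∧
      X.mode (γ - n) s b (X.mode n (-1) a m) ∈ W := by
  obtain ⟨N₁, hN₁⟩ := hX.truncation a b 0 (-1)
  obtain ⟨N₂, hN₂⟩ := hX.truncation b m γ s
  obtain ⟨N₃, hN₃⟩ := hX.truncation a m 0 (-1)
  simp only [zero_add] at hN₁ hN₃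
  set A : ℤ → F := fun n => X.mode n (-1) a (X.mode (γ - n) s b m) with hA
  set B : ℤ → F := fun n => X.mode (γ - n) s b (X.mode n (-1) a m) with hB
  set C : ℤ → F := fun n => X.mode (γ - n) s (X.mode n (-1) a b) m with hC
  -- `A n = 0` for `n ≤ -N₂`, `B n = 0` for `n ≥ N₃`, and the commutators `A n - B n` are combinations
  -- of the `C i` with `0 ≤ i < N₁`
  set W := Submodule.span ℂ (A '' Set.Ioo (-N₂ : ℤ) N₃ ∪ C '' Set.Ico 0 (N₁ : ℤ)) with hW
  have mem_finsum : ∀ f : ℕ → F, (∀ i, f i ∈ W) → ∑ᶠ i, f i ∈ W := fun f hf =>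
    finsum_induction (· ∈ W) (zero_mem _) (fun _ _ => add_mem) hf
  have hC0 : ∀ i : ℕ, C i ∈ W := by
    intro i
    by_cases hi : i < N₁
    · exact Submodule.subset_span (Or.inr ⟨i, ⟨by omega, by exact_mod_cast hi⟩, rfl⟩)
    · have : C i = 0 := by
        have := hN₁ i (not_lt.1 hi)
        simp [hC, this]
      rw [this]
      exact zero_mem _
  have hcomm : ∀ n : ℤ, A n - B n ∈ W := by
    intro n
    have key := hX.borcherds ha b m 0 n (γ - n) s
    rw [finsum_eq_single (fun i : ℕ => ((-1 : ℤ) ^ i * Ring.choose (0 : ℤ) i) • _) 0 (fun i hi => by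
      rw [Ring.choose_zero_pos _ (Nat.pos_of_ne_zero hi), mul_zero, zero_smul])] at key
    simp only [pow_zero, Ring.choose_zero_right, mul_one, one_smul, zpow_zero, Int.cast_zero,
      Nat.cast_zero, add_zero, sub_zero, zero_add, add_sub_cancel] at key
    rw [hA, hB]
    dsimp only
    rw [← key]
    refine mem_finsum _ fun i => zsmul_mem ?_ _
    have := hC0 i
    simpa only [hC, Int.cast_natCast] using this
  have hA' : ∀ n : ℤ, A n ∈ W := by
    intro n
    by_cases h1 : -N₂ < n
    · by_cases h2 : n < N₃
      · exact Submodule.subset_span (Or.inl ⟨n, ⟨h1, h2⟩, rfl⟩)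
      · obtain ⟨j, rfl⟩ := Int.eq_ofNat_of_zero_le (show 0 ≤ n by omega)
        have h3 : B j = 0 := by
          have := hN₃ j (by omega)
          simp [hB, this]
        simpa [h3] using hcomm j
    · obtain ⟨j, rfl⟩ : ∃ j : ℕ, n = -j := ⟨(-n).toNat, by omega⟩
      have h3 : A (-j) = 0 := by
        have := hN₂ j (by omega)
        simp [hA, this]
      rw [h3]
      exact zero_mem _
  have hB' : ∀ n : ℤ, B n ∈ W := fun n => by
    have := sub_mem (hA' n) (hcomm n)
    rwa [sub_sub_cancel] at this
  refine ⟨W, FiniteDimensional.span_of_finite ℂ (((Set.finite_Ioo _ _).image _).union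
    ((Set.finite_Ico _ _).image _)), fun n => ⟨hA' n, ?_, hB' n⟩⟩
  have key := hX.borcherds ha b m n 0 (γ - n) s
  rw [finsum_eq_single (fun i : ℕ => Ring.choose (0 : ℤ) i • _) 0 (fun i hi => by
    rw [Ring.choose_zero_pos _ (Nat.pos_of_ne_zero hi), zero_smul])] at key
  simp only [Ring.choose_zero_right, one_smul, Int.cast_zero, Nat.cast_zero, add_zero, sub_zero,
    zero_add, sub_add_cancel] at key
  rw [key]
  refine mem_finsum _ fun i => zsmul_mem (sub_mem ?_ (Submodule.smul_mem _ _ ?_)) _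
  · have := hA' (n - i)
    simp only [hA] at this
    push_cast at this
    rwa [show γ - (n - i) = γ - n + i by ring] at this
  · have := hB' i
    simpa only [hB, Int.cast_natCast] using this

theorem IsFullVertexAlgebra.hasFiniteSpan (hX : X.IsFullVertexAlgebra) {a : F}
    (ha : X.Dbar a = 0) (b m : F) (α β : ℝ) : X.HasFiniteSpan a b m α β := by
  obtain ⟨W, hW, h⟩ := hX.exists_finiteDimensional ha b m (-α - 2) (-β - 1)
  refine ⟨W, hW, fun p p' => ⟨?_, ?_, ?_⟩⟩
  · by_cases h0 : X.mode (-(α - p) - 1) (-(β - p') - 1) a (X.mode (-p - 1) (-p' - 1) b m) = 0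
    · rw [h0]
      exact zero_mem _
    have h1 := hX.eq_of_mode_ne_zero ha h0
    obtain ⟨hs, n, hn⟩ := h1
    rw [hs, hn, mode_congr (show -p - 1 = -α - 2 - n by linarith)
      (show -p' - 1 = -β - 1 by linarith)]
    exact (h n).1
  · by_cases h0 : X.mode (-p - 1) (-p' - 1) a b = 0
    · rw [h0, map_zero]
      exact zero_mem _
    obtain ⟨hs, n, hn⟩ := hX.eq_of_mode_ne_zero ha h0
    rw [hs, hn, mode_congr (show -(α - p) - 1 = -α - 2 - n by linarith)
      (show -(β - p') - 1 = -β - 1 by linarith)]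
    exact (h n).2.1
  · by_cases h0 : X.mode (-p - 1) (-p' - 1) a m = 0
    · rw [h0, map_zero]
      exact zero_mem _
    obtain ⟨hs, n, hn⟩ := hX.eq_of_mode_ne_zero ha h0
    rw [hs, hn, mode_congr (show -(α - p) - 1 = -α - 2 - n by linarith)
      (show -(β - p') - 1 = -β - 1 by linarith)]
    exact (h n).2.2

/-- The vector-valued correlation function of bidegree `(α, β)`, in coordinates. -/
theorem IsFullVertexAlgebra.exists_isCorrelation_coord (hX : X.IsFullVertexAlgebra) {a b m : F}
    {α β : ℝ} (h : X.HasFiniteSpan a b m α β) (hαβ : ∃ n : ℤ, α - β = n) :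
    ∃ (n : ℕ) (w : Fin n → F) (u : Fin n → F →ₗ[ℂ] ℂ),
      (∀ i, IsCorrelation α β
        (fun p p' => u i (X.mode (-(α - p) - 1) (-(β - p') - 1) a
          (X.mode (-p - 1) (-p' - 1) b m)))
        (fun p p' => u i (X.mode (-(α - p) - 1) (-(β - p') - 1)
          (X.mode (-p - 1) (-p' - 1) a b) m))
        (fun p p' => u i (X.mode (-(α - p) - 1) (-(β - p') - 1) b
          (X.mode (-p - 1) (-p' - 1) a m)))) ∧
      ∀ p p',
        (X.mode (-(α - p) - 1) (-(β - p') - 1) a (X.mode (-p - 1) (-p' - 1) b m) =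
          ∑ i, u i (X.mode (-(α - p) - 1) (-(β - p') - 1) a
            (X.mode (-p - 1) (-p' - 1) b m)) • w i) ∧
        (X.mode (-(α - p) - 1) (-(β - p') - 1) (X.mode (-p - 1) (-p' - 1) a b) m =
          ∑ i, u i (X.mode (-(α - p) - 1) (-(β - p') - 1)
            (X.mode (-p - 1) (-p' - 1) a b) m) • w i) ∧
        (X.mode (-(α - p) - 1) (-(β - p') - 1) b (X.mode (-p - 1) (-p' - 1) a m) =
          ∑ i, u i (X.mode (-(α - p) - 1) (-(β - p') - 1) b
            (X.mode (-p - 1) (-p' - 1) a m)) • w i) := by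
  obtain ⟨W, hW, h⟩ := h
  let w := Module.finBasis ℂ W
  choose u hu huw using fun i => exists_isGradedDual_extend hX.internal W (w.coord i)
  have key : ∀ x ∈ W, x = ∑ i, u i x • (w i : F) := by
    intro x hx
    have := congrArg (Submodule.subtype W) (w.sum_repr ⟨x, hx⟩)
    rw [map_sum] at this
    refine this.symm.trans (Finset.sum_congr rfl fun i _ => ?_)
    rw [map_smul, huw i ⟨x, hx⟩]
    rfl
  exact ⟨_, fun i => w i, u, fun i => hX.isCorrelation a b m (hu i) hαβ, fun p p' =>
    ⟨key _ (h p p').1, key _ (h p p').2.1, key _ (h p p').2.2⟩⟩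

end FullVertexData

theorem IsCorrelation.sum {ι : Type*} (T : Finset ι) {α β : ℝ} {c e d : ι → ℝ → ℝ → ℂ}
    (h : ∀ i ∈ T, IsCorrelation α β (c i) (e i) (d i)) :
    IsCorrelation α β (fun s t => ∑ i ∈ T, c i s t) (fun s t => ∑ i ∈ T, e i s t)
      (fun s t => ∑ i ∈ T, d i s t) := by
  classical
  induction T using Finset.induction_on with
  | empty => simpa using IsCorrelation.zero α β
  | insert i T hi ih =>
    simp only [Finset.sum_insert hi]
    exact (h i (Finset.mem_insert_self _ _)).add (ih fun j hj => h j (Finset.mem_insert_of_mem hj))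

theorem exists_hasExpansions_sum {ι : Type*} (T : Finset ι) {e₁₂ e₂₀ e₂₁ : ι → Series₂}
    (h : ∀ i ∈ T, ∃ μ : Y₂ → ℂ, HasExpansions μ (e₁₂ i) (e₂₀ i) (e₂₁ i)) :
    ∃ μ : Y₂ → ℂ, HasExpansions μ (fun p p' q q' => ∑ i ∈ T, e₁₂ i p p' q q')
      (fun p p' q q' => ∑ i ∈ T, e₂₀ i p p' q q') (fun p p' q q' => ∑ i ∈ T, e₂₁ i p p' q q') := by
  classical
  induction T using Finset.induction_on with
  | empty => exact ⟨0, zero_mem _⟩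
  | insert i T hi ih =>
    obtain ⟨μ₁, h₁⟩ := h i (Finset.mem_insert_self _ _)
    obtain ⟨μ₂, h₂⟩ := ih fun j hj => h j (Finset.mem_insert_of_mem hj)
    simp only [Finset.sum_insert hi]
    exact ⟨_, add_mem h₁ h₂⟩

/-- Three series with finitely many homogeneous components are the expansions of an element of
`GCor₂` as soon as this holds for each homogeneous component. -/
theorem exists_hasExpansions_of_isCorrelation {e₁₂ e₂₀ e₂₁ : Series₂} (T : Finset (ℝ × ℝ))
    (hT : ∀ p p' q q', (p + q, p' + q') ∉ T →
      e₁₂ p p' q q' = 0 ∧ e₂₀ p p' q q' = 0 ∧ e₂₁ p p' q q' = 0)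
    (h : ∀ x ∈ T, (∃ n : ℤ, x.1 - x.2 = n) ∧
      IsCorrelation x.1 x.2 (fun q q' => e₁₂ (x.1 - q) (x.2 - q') q q')
        (fun p p' => e₂₀ p p' (x.1 - p) (x.2 - p'))
        (fun p p' => e₂₁ p p' (x.1 - p) (x.2 - p'))) :
    ∃ μ : Y₂ → ℂ, HasExpansions μ e₁₂ e₂₀ e₂₁ := by
  classical
  obtain ⟨μ, hμ⟩ := exists_hasExpansions_sum T fun x hx => (h x hx).2.hasExpansions (h x hx).1
  refine ⟨μ, ?_⟩
  have key : ∀ (e : Series₂) (f : ℝ × ℝ → ℂ) (p p' q q' : ℝ),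
      ((p + q, p' + q') ∉ T → e p p' q q' = 0) → f (p + q, p' + q') = e p p' q q' →
      (∑ x ∈ T, if p + q = x.1 ∧ p' + q' = x.2 then f x else 0) = e p p' q q' := by
    intro e f p p' q q' h0 hf
    have : ∀ x : ℝ × ℝ, (p + q = x.1 ∧ p' + q' = x.2) ↔ (p + q, p' + q') = x := fun x => by
      rw [Prod.ext_iff]
    simp only [this, Finset.sum_ite_eq]
    split_ifs with hmem
    · exact hf
    · exact (h0 hmem).symm
  have h1 : (fun p p' q q' => ∑ x ∈ T, if p + q = x.1 ∧ p' + q' = x.2 then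
      e₁₂ (x.1 - q) (x.2 - q') q q' else 0) = e₁₂ := by
    funext p p' q q'
    refine key e₁₂ (fun x => e₁₂ (x.1 - q) (x.2 - q') q q') p p' q q'
      (fun h => (hT p p' q q' h).1) ?_
    simp only [add_sub_cancel_right]
  have h2 : (fun p p' q q' => ∑ x ∈ T, if p + q = x.1 ∧ p' + q' = x.2 then
      e₂₀ p p' (x.1 - p) (x.2 - p') else 0) = e₂₀ := by
    funext p p' q q'
    refine key e₂₀ (fun x => e₂₀ p p' (x.1 - p) (x.2 - p')) p p' q q'
      (fun h => (hT p p' q q' h).2.1) ?_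
    simp only [add_sub_cancel_left]
  have h3 : (fun p p' q q' => ∑ x ∈ T, if p + q = x.1 ∧ p' + q' = x.2 then
      e₂₁ p p' (x.1 - p) (x.2 - p') else 0) = e₂₁ := by
    funext p p' q q'
    refine key e₂₁ (fun x => e₂₁ p p' (x.1 - p) (x.2 - p')) p p' q q'
      (fun h => (hT p p' q q' h).2.2) ?_
    simp only [add_sub_cancel_left]
  rw [h1, h2, h3] at hμ
  exact hμ

open FullVertexData

/-! ### The tensor product of a holomorphic and an antiholomorphic full vertex algebra -/

/-- The product of a series in `z` and a series in `z̄`. -/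
theorem conv_of_axes {c d : ℝ → ℝ → ℂ} (hc : ∀ s t, c s t ≠ 0 → t = 0)
    (hd : ∀ s t, d s t ≠ 0 → s = 0) (s t : ℝ) : conv c d s t = c s 0 * d 0 t := by
  rw [conv, finsum_eq_single _ (s, 0)]
  · simp
  · rintro ⟨s', t'⟩ hne
    by_contra h
    have h1 := hc _ _ (left_ne_zero_of_mul h)
    have h2 := hd _ _ (right_ne_zero_of_mul h)
    dsimp only at h1 h2
    exact hne (Prod.ext (by dsimp only; linarith) h1)

section Tensor

variable {F₁ F₂ : Type*} [AddCommGroup F₁] [Module ℂ F₁] [AddCommGroup F₂] [Module ℂ F₂]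
  {X₁ : FullVertexData F₁} {X₂ : FullVertexData F₂}

theorem tensor_gr_le (h₁ : ∀ a b, IsFormal (series X₁.mode a b))
    (h₂ : ∀ a b, IsFormal (series X₂.mode a b)) {p : ℝ × ℝ} {S : Submodule ℂ (F₁ ⊗[ℂ] F₂)}
    (h : ∀ q, ∀ a ∈ X₁.gr q, ∀ b ∈ X₂.gr (p - q), a ⊗ₜ[ℂ] b ∈ S) :
    (tensor X₁ X₂ h₁ h₂).gr p ≤ S := by
  refine iSup_le fun q => ?_
  rintro _ ⟨x, rfl⟩
  induction x with
  | zero => rw [map_zero]; exact zero_mem _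
  | add x y hx hy => rw [map_add]; exact add_mem hx hy
  | tmul a b => exact h q a a.2 b b.2

theorem tmul_mem_tensor_gr (h₁ : ∀ a b, IsFormal (series X₁.mode a b))
    (h₂ : ∀ a b, IsFormal (series X₂.mode a b)) {p q : ℝ × ℝ} {a : F₁} {b : F₂}
    (ha : a ∈ X₁.gr p) (hb : b ∈ X₂.gr q) : a ⊗ₜ[ℂ] b ∈ (tensor X₁ X₂ h₁ h₂).gr (p + q) := by
  refine le_iSup (fun r : ℝ × ℝ => LinearMap.range
    (TensorProduct.map (X₁.gr r).subtype (X₂.gr (p + q - r)).subtype)) p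
    ⟨(⟨a, ha⟩ : X₁.gr p) ⊗ₜ[ℂ] ⟨b, by rwa [add_sub_cancel_left]⟩, ?_⟩
  simp

/-- Linear induction on tensor products of homogeneous vectors. -/
theorem homogeneous_induction (h₁ : DirectSum.IsInternal X₁.gr) (h₂ : DirectSum.IsInternal X₂.gr)
    {S : Submodule ℂ (F₁ ⊗[ℂ] F₂)}
    (h : ∀ p q, ∀ a ∈ X₁.gr p, ∀ b ∈ X₂.gr q, a ⊗ₜ[ℂ] b ∈ S) (x : F₁ ⊗[ℂ] F₂) : x ∈ S := by
  obtain ⟨π₁, hπ₁⟩ := exists_isProjections h₁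
  obtain ⟨π₂, hπ₂⟩ := exists_isProjections h₂
  induction x with
  | zero => exact zero_mem _
  | add x y hx hy => exact add_mem hx hy
  | tmul a b =>
    obtain ⟨T₁, hT₁⟩ := hπ₁.eq_sum a
    obtain ⟨T₂, hT₂⟩ := hπ₂.eq_sum b
    rw [hT₁ T₁ subset_rfl, hT₂ T₂ subset_rfl, TensorProduct.sum_tmul]
    refine Submodule.sum_mem _ fun p _ => ?_
    rw [TensorProduct.tmul_sum]
    exact Submodule.sum_mem _ fun q _ => h p q _ (hπ₁.mem p a) _ (hπ₂.mem q b)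

theorem tensor_isInternal (h₁ : DirectSum.IsInternal X₁.gr) (h₂ : DirectSum.IsInternal X₂.gr)
    (f₁ : ∀ a b, IsFormal (series X₁.mode a b)) (f₂ : ∀ a b, IsFormal (series X₂.mode a b)) :
    DirectSum.IsInternal (tensor X₁ X₂ f₁ f₂).gr := by
  obtain ⟨π₁, hπ₁⟩ := exists_isProjections h₁
  obtain ⟨π₂, hπ₂⟩ := exists_isProjections h₂
  -- the projections onto the bihomogeneous components detect zero
  have eq_sum : ∀ x : F₁ ⊗[ℂ] F₂, ∃ T : Finset ((ℝ × ℝ) × (ℝ × ℝ)), ∀ T', T ⊆ T' →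
      x = ∑ p ∈ T', TensorProduct.map (π₁ p.1) (π₂ p.2) x := by
    intro x
    refine homogeneous_induction h₁ h₂ (S :=
      { carrier := {x | ∃ T : Finset ((ℝ × ℝ) × (ℝ × ℝ)), ∀ T', T ⊆ T' →
          x = ∑ p ∈ T', TensorProduct.map (π₁ p.1) (π₂ p.2) x}
        add_mem' := ?_, zero_mem' := ?_, smul_mem' := ?_ }) (fun p q a ha b hb => ?_) x
    · rintro x y ⟨T₁, hT₁⟩ ⟨T₂, hT₂⟩
      refine ⟨T₁ ∪ T₂, fun T' hT' => ?_⟩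
      simp only [map_add, Finset.sum_add_distrib]
      rw [← hT₁ T' (Finset.union_subset_left hT'), ← hT₂ T' (Finset.union_subset_right hT')]
    · exact ⟨∅, fun T' _ => by simp⟩
    · rintro k x ⟨T, hT⟩
      refine ⟨T, fun T' hT' => ?_⟩
      simp only [map_smul, ← Finset.smul_sum]
      rw [← hT T' hT']
    · refine ⟨{(p, q)}, fun T' hT' => ?_⟩
      rw [Finset.sum_eq_single_of_mem (p, q) (hT' (Finset.mem_singleton_self _))]
      · rw [TensorProduct.map_tmul, hπ₁.same p a ha, hπ₂.same q b hb]
      · rintro ⟨p', q'⟩ - hne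
        rw [TensorProduct.map_tmul]
        by_cases hp : p' = p
        · rw [hπ₂.ne q' q (fun hq => hne (by rw [hp, hq])) b hb, TensorProduct.tmul_zero]
        · rw [hπ₁.ne p' p hp a ha, TensorProduct.zero_tmul]
  have hker : ∀ (r : (ℝ × ℝ) × (ℝ × ℝ)) (p : ℝ × ℝ), r.1 + r.2 ≠ p →
      (tensor X₁ X₂ f₁ f₂).gr p ≤ LinearMap.ker (TensorProduct.map (π₁ r.1) (π₂ r.2)) := by
    intro r p hr
    refine tensor_gr_le f₁ f₂ fun q a ha b hb => ?_
    rw [LinearMap.mem_ker, TensorProduct.map_tmul]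
    by_cases hp : r.1 = q
    · rw [hπ₂.ne r.2 (p - q) (fun hq => hr (by rw [hp, hq, add_sub_cancel])) b hb,
        TensorProduct.tmul_zero]
    · rw [hπ₁.ne r.1 q hp a ha, TensorProduct.zero_tmul]
  refine DirectSum.isInternal_submodule_of_iSupIndep_of_iSup_eq_top
    (iSupIndep_def.2 fun p => Submodule.disjoint_def.2 fun x hx hx' => ?_) ?_
  · obtain ⟨T, hT⟩ := eq_sum x
    rw [hT T subset_rfl]
    refine Finset.sum_eq_zero fun r _ => ?_
    by_cases hr : r.1 + r.2 = p
    · have : ⨆ (q) (_ : q ≠ p), (tensor X₁ X₂ f₁ f₂).gr q ≤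
          LinearMap.ker (TensorProduct.map (π₁ r.1) (π₂ r.2)) :=
        iSup₂_le fun q hq => hker r q (hr ▸ hq.symm)
      exact this hx'
    · exact hker r p hr hx
  · refine eq_top_iff.2 fun x _ => homogeneous_induction h₁ h₂ (fun p q a ha b hb => ?_) x
    exact le_iSup (tensor X₁ X₂ f₁ f₂).gr (p + q) (tmul_mem_tensor_gr f₁ f₂ ha hb)

/-- If only the modes `a(r, -1)` and `b(-1, s)` are nonzero, the product has a single term. -/
theorem tensor_mode_tmul (f₁ : ∀ a b, IsFormal (series X₁.mode a b))
    (f₂ : ∀ a b, IsFormal (series X₂.mode a b))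
    (m₁ : ∀ r s a b, X₁.mode r s a b ≠ 0 → s = -1) (m₂ : ∀ r s a b, X₂.mode r s a b ≠ 0 → r = -1)
    (r s : ℝ) (a c : F₁) (b d : F₂) :
    (tensor X₁ X₂ f₁ f₂).mode r s (a ⊗ₜ[ℂ] b) (c ⊗ₜ[ℂ] d) =
      X₁.mode r (-1) a c ⊗ₜ[ℂ] X₂.mode (-1) s b d := by
  change ∑ᶠ p : ℝ × ℝ, tensorTerm X₁ X₂ r s p (a ⊗ₜ[ℂ] b) (c ⊗ₜ[ℂ] d) = _
  rw [finsum_eq_single _ (r, -1)]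
  · rw [tensorTerm, TensorProduct.map₂_apply_tmul, TensorProduct.map_tmul]
    dsimp only
    rw [mode_congr (X := X₂) (show r - 1 - r = -1 by ring) (show s - 1 - -1 = s by ring)]
  · rintro ⟨p, q⟩ hne
    rw [tensorTerm, TensorProduct.map₂_apply_tmul, TensorProduct.map_tmul]
    dsimp only
    by_cases h1 : X₁.mode p q a c = 0
    · rw [h1, TensorProduct.zero_tmul]
    by_cases h2 : X₂.mode (r - 1 - p) (s - 1 - q) b d = 0
    · rw [h2, TensorProduct.tmul_zero]
    refine absurd (Prod.ext ?_ (m₁ _ _ _ _ h1)) hne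
    have := m₂ _ _ _ _ h2
    dsimp only
    linarith

/-- The components of bidegree `(α, β)` of the correlation functions of the tensor product are
products of those of the factors, of bidegree `(α, 0)` and `(0, β)`. -/
theorem tensor_isCorrelation (h₁ : X₁.IsFullVertexAlgebra) (h₂ : X₂.IsFullVertexAlgebra)
    (d₁ : ∀ a, X₁.Dbar a = 0) (d₂ : ∀ b, X₂.D b = 0) (a b c : F₁) (a' b' c' : F₂)
    (u : F₁ ⊗[ℂ] F₂ →ₗ[ℂ] ℂ) (m n : ℤ) :
    IsCorrelation m n
      (fun q q' => u (X₁.mode (-(m - q) - 1) (-1) a (X₁.mode (-q - 1) (-1) b c) ⊗ₜ[ℂ]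
        X₂.mode (-1) (-(n - q') - 1) a' (X₂.mode (-1) (-q' - 1) b' c')))
      (fun q q' => u (X₁.mode (-(m - q) - 1) (-1) (X₁.mode (-q - 1) (-1) a b) c ⊗ₜ[ℂ]
        X₂.mode (-1) (-(n - q') - 1) (X₂.mode (-1) (-q' - 1) a' b') c'))
      (fun q q' => u (X₁.mode (-(m - q) - 1) (-1) b (X₁.mode (-q - 1) (-1) a c) ⊗ₜ[ℂ]
        X₂.mode (-1) (-(n - q') - 1) b' (X₂.mode (-1) (-q' - 1) a' c'))) := by
  obtain ⟨N₁, w₁, u₁, H₁, K₁⟩ := h₁.exists_isCorrelation_coord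
    (h₁.hasFiniteSpan (d₁ a) b c m 0) ⟨m, sub_zero _⟩
  obtain ⟨N₂, w₂, u₂, H₂, K₂⟩ := h₂.exists_isCorrelation_coord
    (HasFiniteSpan.of_swap (h₂.swap.hasFiniteSpan (d₂ a') b' c' n 0)) ⟨-n, by push_cast; ring⟩
  have m₁ : ∀ {r s : ℝ} {x y : F₁}, X₁.mode r s x y ≠ 0 → s = -1 := fun {r s x y} h =>
    (h₁.eq_of_mode_ne_zero (d₁ x) h).1
  have m₂ : ∀ {r s : ℝ} {x y : F₂}, X₂.mode r s x y ≠ 0 → r = -1 := fun {r s x y} h =>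
    (h₂.eq_of_mode_ne_zero' (d₂ x) h).1
  have hm : ∃ k : ℤ, (m : ℝ) - 0 = k := ⟨m, sub_zero _⟩
  have hn : ∃ k : ℤ, (0 : ℝ) - n = k := ⟨-n, by push_cast; ring⟩
  have key := IsCorrelation.sum Finset.univ fun (i : Fin N₁) _ =>
    IsCorrelation.sum Finset.univ fun (j : Fin N₂) _ =>
      ((H₁ i).mul hm hn (H₂ j)).const_mul (u (w₁ i ⊗ₜ[ℂ] w₂ j))
  rw [add_zero, zero_add] at key
  -- expansion of `u (x ⊗ y)` in coordinates
  have expand : ∀ (x : F₁) (y : F₂), x = ∑ i, u₁ i x • w₁ i → y = ∑ j, u₂ j y • w₂ j →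
      u (x ⊗ₜ[ℂ] y) = ∑ i, ∑ j, u (w₁ i ⊗ₜ[ℂ] w₂ j) * (u₁ i x * u₂ j y) := by
    intro x y hx hy
    conv_lhs => rw [hx, hy]
    rw [TensorProduct.sum_tmul, map_sum]
    refine Finset.sum_congr rfl fun i _ => ?_
    rw [TensorProduct.tmul_sum, map_sum]
    refine Finset.sum_congr rfl fun j _ => ?_
    rw [TensorProduct.smul_tmul_smul, map_smul, smul_eq_mul, mul_comm]
  have z0 : (-(0 - 0) - 1 : ℝ) = -1 := by ring
  have z1 : (-0 - 1 : ℝ) = -1 := by ring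
  convert key using 3 with q q' q q' q q'
  · have k₁ := (K₁ q 0).1
    have k₂ := (K₂ 0 q').1
    rw [z0, z1] at k₁ k₂
    rw [expand _ _ k₁ k₂]
    refine Finset.sum_congr rfl fun i _ => Finset.sum_congr rfl fun j _ => ?_
    rw [conv_of_axes]
    · rw [z0, z1]
    · intro s t h
      have := m₁ (r := -s - 1) (s := -t - 1) (x := b) (y := c) fun h' => h (by simp [h'])
      linarith
    · intro s t h
      have := m₂ (r := -s - 1) (s := -t - 1) (x := b') (y := c') fun h' => h (by simp [h'])
      linarith
  · have k₁ := (K₁ q 0).2.1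
    have k₂ := (K₂ 0 q').2.1
    rw [z0, z1] at k₁ k₂
    rw [expand _ _ k₁ k₂]
    refine Finset.sum_congr rfl fun i _ => Finset.sum_congr rfl fun j _ => ?_
    rw [conv_of_axes]
    · rw [z0, z1]
    · intro s t h
      have := m₁ (r := -s - 1) (s := -t - 1) (x := a) (y := b) fun h' => h (by simp [h'])
      linarith
    · intro s t h
      have := m₂ (r := -s - 1) (s := -t - 1) (x := a') (y := b') fun h' => h (by simp [h'])
      linarith
  · have k₁ := (K₁ q 0).2.2
    have k₂ := (K₂ 0 q').2.2
    rw [z0, z1] at k₁ k₂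
    rw [expand _ _ k₁ k₂]
    refine Finset.sum_congr rfl fun i _ => Finset.sum_congr rfl fun j _ => ?_
    rw [conv_of_axes]
    · rw [z0, z1]
    · intro s t h
      have := m₁ (r := -s - 1) (s := -t - 1) (x := a) (y := c) fun h' => h (by simp [h'])
      linarith
    · intro s t h
      have := m₂ (r := -s - 1) (s := -t - 1) (x := a') (y := c') fun h' => h (by simp [h'])
      linarith

/-- The expansions of elements of `GCor₂` form a linear space. -/
theorem mem_expansions_iff {e : Series₂ × Series₂ × Series₂} :
    e ∈ gcorExpansions.map (LinearMap.snd ℂ (Y₂ → ℂ) (Series₂ × Series₂ × Series₂)) ↔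
      ∃ μ, HasExpansions μ e.1 e.2.1 e.2.2 := by
  constructor
  · rintro ⟨⟨μ, e'⟩, h, rfl⟩
    exact ⟨μ, h⟩
  · rintro ⟨μ, h⟩
    exact ⟨(μ, e), h, rfl⟩

/-- The existence of correlation functions for homogeneous vectors: `u` vanishes on all but finitely
many graded pieces, so finitely many bidegrees occur, and in each of them
`tensor_isCorrelation` applies. -/
theorem tensor_fv5_homogeneous (h₁ : X₁.IsFullVertexAlgebra) (h₂ : X₂.IsFullVertexAlgebra)
    (d₁ : ∀ a, X₁.Dbar a = 0) (d₂ : ∀ b, X₂.D b = 0) {u : F₁ ⊗[ℂ] F₂ →ₗ[ℂ] ℂ}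
    (hu : IsGradedDual (tensor X₁ X₂ h₁.fv1 h₂.fv1).gr u) {p₁ p₂ p₃ q₁ q₂ q₃ : ℝ × ℝ}
    {a b c : F₁} (ha : a ∈ X₁.gr p₁) (hb : b ∈ X₁.gr p₂) (hc : c ∈ X₁.gr p₃)
    {a' b' c' : F₂} (ha' : a' ∈ X₂.gr q₁) (hb' : b' ∈ X₂.gr q₂) (hc' : c' ∈ X₂.gr q₃) :
    ∃ μ : Y₂ → ℂ, HasExpansions μ
      (fun p p' q q' => u (X₁.mode (-p - 1) (-1) a (X₁.mode (-q - 1) (-1) b c) ⊗ₜ[ℂ]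
        X₂.mode (-1) (-p' - 1) a' (X₂.mode (-1) (-q' - 1) b' c')))
      (fun p p' q q' => u (X₁.mode (-q - 1) (-1) (X₁.mode (-p - 1) (-1) a b) c ⊗ₜ[ℂ]
        X₂.mode (-1) (-q' - 1) (X₂.mode (-1) (-p' - 1) a' b') c'))
      (fun p p' q q' => u (X₁.mode (-q - 1) (-1) b (X₁.mode (-p - 1) (-1) a c) ⊗ₜ[ℂ]
        X₂.mode (-1) (-q' - 1) b' (X₂.mode (-1) (-p' - 1) a' c'))) := by
  classical
  -- only finitely many bidegrees occur: the weight of the vectors is determined by the bidegree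
  have hfin : {x : ℝ × ℝ | x + (p₁ + p₂ + p₃ + (q₁ + q₂ + q₃)) ∈
      {p : ℝ × ℝ | ∃ x ∈ (tensor X₁ X₂ h₁.fv1 h₂.fv1).gr p, u x ≠ 0}}.Finite :=
    hu.preimage (add_left_injective _).injOn
  set T := hfin.toFinset.filter fun x : ℝ × ℝ =>
    (∃ m : ℤ, x.1 = (m : ℝ)) ∧ ∃ n : ℤ, x.2 = (n : ℝ) with hT
  have i₁ : ∀ {r : ℝ} {x y : F₁}, X₁.mode (-r - 1) (-1) x y ≠ 0 → ∃ m : ℤ, r = m := by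
    intro r x y h
    obtain ⟨m, hm⟩ := (h₁.eq_of_mode_ne_zero (d₁ x) h).2
    exact ⟨-m - 1, by push_cast; linarith⟩
  have i₂ : ∀ {r : ℝ} {x y : F₂}, X₂.mode (-1) (-r - 1) x y ≠ 0 → ∃ m : ℤ, r = m := by
    intro r x y h
    obtain ⟨m, hm⟩ := (h₂.eq_of_mode_ne_zero' (d₂ x) h).2
    exact ⟨-m - 1, by push_cast; linarith⟩
  have deg₁ : ∀ {r : ℝ} {p q : ℝ × ℝ} {x y : F₁}, x ∈ X₁.gr p → y ∈ X₁.gr q →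
      X₁.mode (-r - 1) (-1) x y ∈ X₁.gr (p + q + (r, 0)) := by
    intro r p q x y hx hy
    have := h₁.fv6 (-r - 1) (-1) p.1 p.2 q.1 q.2 x hx y hy
    rwa [show (p.1 + q.1 - (-r - 1) - 1, p.2 + q.2 - -1 - 1) = p + q + (r, 0) by
      ext <;> simp; ring] at this
  have deg₂ : ∀ {r : ℝ} {p q : ℝ × ℝ} {x y : F₂}, x ∈ X₂.gr p → y ∈ X₂.gr q →
      X₂.mode (-1) (-r - 1) x y ∈ X₂.gr (p + q + (0, r)) := by
    intro r p q x y hx hy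
    have := h₂.fv6 (-1) (-r - 1) p.1 p.2 q.1 q.2 x hx y hy
    rwa [show (p.1 + q.1 - -1 - 1, p.2 + q.2 - (-r - 1) - 1) = p + q + (0, r) by
      ext <;> simp; ring] at this
  have memT : ∀ {x : F₁} {y : F₂} {p p' q q' : ℝ} {P Q : ℝ × ℝ}, x ∈ X₁.gr P → y ∈ X₂.gr Q →
      P + Q = (p + q, p' + q') + (p₁ + p₂ + p₃ + (q₁ + q₂ + q₃)) →
      (∃ m : ℤ, p = m) → (∃ m : ℤ, q = m) → (∃ m : ℤ, p' = m) → (∃ m : ℤ, q' = m) →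
      u (x ⊗ₜ[ℂ] y) ≠ 0 → (p + q, p' + q') ∈ T := by
    rintro x y p p' q q' P Q hx hy hPQ ⟨m₁, rfl⟩ ⟨m₂, rfl⟩ ⟨m₃, rfl⟩ ⟨m₄, rfl⟩ hne
    rw [hT, Finset.mem_filter, Set.Finite.mem_toFinset]
    refine ⟨⟨x ⊗ₜ[ℂ] y, ?_, hne⟩, ⟨m₁ + m₂, by push_cast; rfl⟩, ⟨m₃ + m₄, by push_cast; rfl⟩⟩
    rw [← hPQ]
    exact tmul_mem_tensor_gr h₁.fv1 h₂.fv1 hx hy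
  have tz : ∀ {x : F₁} {y : F₂}, u (x ⊗ₜ[ℂ] y) ≠ 0 → x ≠ 0 ∧ y ≠ 0 := by
    refine fun h => ⟨fun h0 => h ?_, fun h0 => h ?_⟩
    · rw [h0, TensorProduct.zero_tmul, map_zero]
    · rw [h0, TensorProduct.tmul_zero, map_zero]
  refine exists_hasExpansions_of_isCorrelation T (fun p p' q q' hmem => ⟨?_, ?_, ?_⟩) ?_
  · by_contra h
    obtain ⟨hx, hy⟩ := tz h
    refine hmem (memT (deg₁ ha (deg₁ hb hc)) (deg₂ ha' (deg₂ hb' hc')) ?_ (i₁ hx)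
      (i₁ fun h0 => hx (by rw [h0, map_zero])) (i₂ hy)
      (i₂ fun h0 => hy (by rw [h0, map_zero])) h)
    ext <;> simp <;> ring
  · by_contra h
    obtain ⟨hx, hy⟩ := tz h
    refine hmem (memT (deg₁ (deg₁ ha hb) hc) (deg₂ (deg₂ ha' hb') hc') ?_
      (i₁ fun h0 => hx (by rw [h0, map_zero, LinearMap.zero_apply])) (i₁ hx)
      (i₂ fun h0 => hy (by rw [h0, map_zero, LinearMap.zero_apply])) (i₂ hy) h)
    ext <;> simp <;> ring
  · by_contra h
    obtain ⟨hx, hy⟩ := tz h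
    refine hmem (memT (deg₁ hb (deg₁ ha hc)) (deg₂ hb' (deg₂ ha' hc')) ?_
      (i₁ fun h0 => hx (by rw [h0, map_zero])) (i₁ hx)
      (i₂ fun h0 => hy (by rw [h0, map_zero])) (i₂ hy) h)
    ext <;> simp <;> ring
  · rintro ⟨α, β⟩ hx
    obtain ⟨⟨m, hm⟩, n, hn⟩ := (Finset.mem_filter.1 hx).2
    dsimp only at hm hn
    subst hm hn
    exact ⟨⟨m - n, by push_cast; rfl⟩, tensor_isCorrelation h₁ h₂ d₁ d₂ a b c a' b' c' u m n⟩

theorem tensor_fv5 (h₁ : X₁.IsFullVertexAlgebra) (h₂ : X₂.IsFullVertexAlgebra)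
    (d₁ : ∀ a, X₁.Dbar a = 0) (d₂ : ∀ b, X₂.D b = 0) (x y z : F₁ ⊗[ℂ] F₂)
    {u : F₁ ⊗[ℂ] F₂ →ₗ[ℂ] ℂ} (hu : IsGradedDual (tensor X₁ X₂ h₁.fv1 h₂.fv1).gr u) :
    ∃ μ : Y₂ → ℂ, HasExpansions μ
      (fun p p' q q' => u ((tensor X₁ X₂ h₁.fv1 h₂.fv1).mode (-p - 1) (-p' - 1) x
        ((tensor X₁ X₂ h₁.fv1 h₂.fv1).mode (-q - 1) (-q' - 1) y z)))
      (fun p p' q q' => u ((tensor X₁ X₂ h₁.fv1 h₂.fv1).mode (-q - 1) (-q' - 1)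
        ((tensor X₁ X₂ h₁.fv1 h₂.fv1).mode (-p - 1) (-p' - 1) x y) z))
      (fun p p' q q' => u ((tensor X₁ X₂ h₁.fv1 h₂.fv1).mode (-q - 1) (-q' - 1) y
        ((tensor X₁ X₂ h₁.fv1 h₂.fv1).mode (-p - 1) (-p' - 1) x z))) := by
  have hmode := tensor_mode_tmul h₁.fv1 h₂.fv1
    (fun r s a b h => (h₁.eq_of_mode_ne_zero (d₁ a) h).1)
    (fun r s a b h => (h₂.eq_of_mode_ne_zero' (d₂ a) h).1)
  set Z := tensor X₁ X₂ h₁.fv1 h₂.fv1 with hZ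
  -- the expansions depend linearly on each of the three vectors
  let E : F₁ ⊗[ℂ] F₂ → F₁ ⊗[ℂ] F₂ → F₁ ⊗[ℂ] F₂ → Series₂ × Series₂ × Series₂ := fun x y z =>
    (fun p p' q q' => u (Z.mode (-p - 1) (-p' - 1) x (Z.mode (-q - 1) (-q' - 1) y z)),
      fun p p' q q' => u (Z.mode (-q - 1) (-q' - 1) (Z.mode (-p - 1) (-p' - 1) x y) z),
      fun p p' q q' => u (Z.mode (-q - 1) (-q' - 1) y (Z.mode (-p - 1) (-p' - 1) x z)))
  have lin₁ : ∀ y z, IsLinearMap ℂ fun x => E x y z := fun y z =>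
    ⟨fun x x' => by simp only [E, map_add, LinearMap.add_apply]; rfl,
      fun k x => by simp only [E, map_smul, LinearMap.smul_apply]; rfl⟩
  have lin₂ : ∀ x z, IsLinearMap ℂ fun y => E x y z := fun x z =>
    ⟨fun y y' => by simp only [E, map_add, LinearMap.add_apply]; rfl,
      fun k y => by simp only [E, map_smul, LinearMap.smul_apply]; rfl⟩
  have lin₃ : ∀ x y, IsLinearMap ℂ fun z => E x y z := fun x y =>
    ⟨fun z z' => by simp only [E, map_add]; rfl,
      fun k z => by simp only [E, map_smul]; rfl⟩
  let G := gcorExpansions.map (LinearMap.snd ℂ (Y₂ → ℂ) (Series₂ × Series₂ × Series₂))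
  suffices H : E x y z ∈ G from mem_expansions_iff.1 H
  refine homogeneous_induction h₁.internal h₂.internal (S := G.comap (lin₁ y z).mk')
    (fun p₁ q₁ a ha a' ha' => ?_) x
  refine homogeneous_induction h₁.internal h₂.internal (S := G.comap (lin₂ (a ⊗ₜ a') z).mk')
    (fun p₂ q₂ b hb b' hb' => ?_) y
  refine homogeneous_induction h₁.internal h₂.internal
    (S := G.comap (lin₃ (a ⊗ₜ a') (b ⊗ₜ b')).mk') (fun p₃ q₃ c hc c' hc' => ?_) z
  rw [Submodule.mem_comap, IsLinearMap.mk'_apply]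
  refine mem_expansions_iff.2 ?_
  simp only [E, hmode]
  exact tensor_fv5_homogeneous h₁ h₂ d₁ d₂ hu ha hb hc ha' hb' hc'

theorem tensor_isFullVertexAlgebra (h₁ : X₁.IsFullVertexAlgebra) (h₂ : X₂.IsFullVertexAlgebra)
    (d₁ : ∀ a, X₁.Dbar a = 0) (d₂ : ∀ b, X₂.D b = 0) :
    (tensor X₁ X₂ h₁.fv1 h₂.fv1).IsFullVertexAlgebra := by
  have hmode := tensor_mode_tmul h₁.fv1 h₂.fv1
    (fun r s a b h => (h₁.eq_of_mode_ne_zero (d₁ a) h).1)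
    (fun r s a b h => (h₂.eq_of_mode_ne_zero' (d₂ a) h).1)
  have hle := fun p S => tensor_gr_le (p := p) (S := S) h₁.fv1 h₂.fv1
  have hgr := fun p q a b => tmul_mem_tensor_gr (p := p) (q := q) (a := a) (b := b) h₁.fv1 h₂.fv1
  have hind := fun S => homogeneous_induction (S := S) h₁.internal h₂.internal
  have hint := tensor_isInternal h₁.internal h₂.internal h₁.fv1 h₂.fv1
  have hfv5 := fun x y z u => tensor_fv5 h₁ h₂ d₁ d₂ x y z (u := u)
  have hvac : (tensor X₁ X₂ h₁.fv1 h₂.fv1).vac = X₁.vac ⊗ₜ[ℂ] X₂.vac := rfl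
  have hbot : ∀ p, (∀ q, X₁.gr q = ⊥ ∨ X₂.gr (p - q) = ⊥) →
      (tensor X₁ X₂ h₁.fv1 h₂.fv1).gr p = ⊥ := by
    intro p h
    refine eq_bot_iff.2 (hle p ⊥ fun q a ha b hb => ?_)
    rcases h q with h | h
    · rw [h, Submodule.mem_bot] at ha
      rw [ha, TensorProduct.zero_tmul]
      exact zero_mem _
    · rw [h, Submodule.mem_bot] at hb
      rw [hb, TensorProduct.tmul_zero]
      exact zero_mem _
  generalize tensor X₁ X₂ h₁.fv1 h₂.fv1 = Z at *
  refine ⟨hint, ?_, fun x y => ?_, fun h h' hne => ?_, fun x p p' hne => ?_, fun x => ?_,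
    fun x => ?_, fun r s x hrs => ?_, hfv5, ?_⟩
  · rw [hvac]
    have := hgr _ _ _ _ h₁.vac_mem h₂.vac_mem
    simpa using this
  · induction x with
    | zero =>
      rw [show series Z.mode 0 y = fun _ _ => 0 by funext s t; simp [series]]
      exact IsFormal.zero
    | add x x' hx hx' =>
      rw [show series Z.mode (x + x') y = fun s t => series Z.mode x y s t + series Z.mode x' y s t
        by funext s t; simp [series]]
      exact hx.add hx'
    | tmul a b =>
      induction y with
      | zero =>
        rw [show series Z.mode (a ⊗ₜ b) 0 = fun _ _ => 0 by funext s t; simp [series]]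
        exact IsFormal.zero
      | add y y' hy hy' =>
        rw [show series Z.mode (a ⊗ₜ b) (y + y') = fun s t =>
          series Z.mode (a ⊗ₜ b) y s t + series Z.mode (a ⊗ₜ b) y' s t by
          funext s t; simp [series]]
        exact hy.add hy'
      | tmul c d =>
        -- the coefficient at `(s, t)` is a product of coefficients of two series on the axes
        have key : ∀ {s t : ℝ}, series Z.mode (a ⊗ₜ b) (c ⊗ₜ d) s t ≠ 0 →
            series X₁.mode a c s 0 ≠ 0 ∧ series X₂.mode b d 0 t ≠ 0 := by
          intro s t h
          simp only [series, hmode] at h ⊢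
          rw [neg_zero, zero_sub]
          exact ⟨fun h0 => h (by rw [h0, TensorProduct.zero_tmul]),
            fun h0 => h (by rw [h0, TensorProduct.tmul_zero])⟩
        obtain ⟨N₁, hN₁⟩ := (h₁.fv1 a c).bounded
        obtain ⟨N₂, hN₂⟩ := (h₂.fv1 b d).bounded
        refine ⟨fun s t h => ?_, fun H => ?_, min N₁ N₂, fun s t h => ?_⟩
        · obtain ⟨k₁, k₂⟩ := key h
          obtain ⟨m, hm⟩ := (h₁.fv1 a c).integral _ _ k₁
          obtain ⟨n, hn⟩ := (h₂.fv1 b d).integral _ _ k₂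
          exact ⟨m + n, by push_cast; linarith⟩
        · refine ((((h₁.fv1 a c).finite (H - N₂)).image Prod.fst).prod
            (((h₂.fv1 b d).finite (H - N₁)).image Prod.snd)).subset ?_
          rintro ⟨s, t⟩ ⟨h, hst⟩
          obtain ⟨k₁, k₂⟩ := key h
          have l₁ := (hN₁ _ _ k₁).1
          have l₂ := (hN₂ _ _ k₂).2
          dsimp only at hst
          exact ⟨⟨(s, 0), ⟨k₁, by dsimp only; linarith⟩, rfl⟩,
            ⟨(0, t), ⟨k₂, by dsimp only; linarith⟩, rfl⟩⟩
        · obtain ⟨k₁, k₂⟩ := key h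
          exact ⟨(min_le_left _ _).trans (hN₁ _ _ k₁).1, (min_le_right _ _).trans (hN₂ _ _ k₂).2⟩
  · by_contra hn
    refine hne (hbot _ fun q => ?_)
    by_contra! hq
    obtain ⟨m, hm⟩ := h₁.fv2 q.1 q.2 hq.1
    obtain ⟨n, hn'⟩ := h₂.fv2 _ _ hq.2
    dsimp only at hn'
    exact hn ⟨m + n, by push_cast; linarith⟩
  · by_contra hn
    refine hne (hind (LinearMap.ker ((Z.mode (-p - 1) (-p' - 1)).flip Z.vac))
      (fun q q' a _ b _ => ?_) x)
    rw [LinearMap.mem_ker, LinearMap.flip_apply, hvac, hmode]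
    by_contra h0
    have ha : X₁.mode (-p - 1) (-0 - 1) a X₁.vac ≠ 0 := fun h => h0 (by
      rw [neg_zero, zero_sub] at h
      rw [h, TensorProduct.zero_tmul])
    have hb : X₂.mode (-0 - 1) (-p' - 1) b X₂.vac ≠ 0 := fun h => h0 (by
      rw [neg_zero, zero_sub] at h
      rw [h, TensorProduct.tmul_zero])
    obtain ⟨m, -, hm, -⟩ := h₁.fv3_regular a p 0 ha
    obtain ⟨-, n, -, hn'⟩ := h₂.fv3_regular b 0 p' hb
    exact hn ⟨m, n, hm, hn'⟩
  · have := hind (LinearMap.ker ((Z.mode (-1) (-1)).flip Z.vac - LinearMap.id))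
      (fun q q' a _ b _ => by
        rw [LinearMap.mem_ker, LinearMap.sub_apply, LinearMap.flip_apply, hvac, hmode,
          h₁.fv3_limit, h₂.fv3_limit, LinearMap.id_apply, sub_self]) x
    rw [LinearMap.mem_ker, LinearMap.sub_apply, sub_eq_zero] at this
    exact this
  · have := hind (LinearMap.ker (Z.mode (-1) (-1) Z.vac - LinearMap.id))
      (fun q q' a _ b _ => by
        rw [LinearMap.mem_ker, LinearMap.sub_apply, hvac, hmode,
          h₁.fv4_id, h₂.fv4_id, LinearMap.id_apply, sub_self]) x
    rw [LinearMap.mem_ker, LinearMap.sub_apply, sub_eq_zero] at this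
    exact this
  · refine hind (LinearMap.ker (Z.mode r s Z.vac)) (fun q q' a _ b _ => ?_) x
    rw [LinearMap.mem_ker, hvac, hmode]
    by_cases hr : r = -1
    · rw [h₂.fv4_zero _ _ _ fun h => hrs (by rw [hr]; exact h), TensorProduct.tmul_zero]
    · rw [h₁.fv4_zero _ _ _ fun h => hr (Prod.ext_iff.1 h).1, TensorProduct.zero_tmul]
  · intro r s h h' k k' x hx y hy
    refine hle _ ((Z.gr (h + k - r - 1, h' + k' - s - 1)).comap ((Z.mode r s).flip y))
      (fun p a ha b hb => ?_) hx
    rw [Submodule.mem_comap, LinearMap.flip_apply]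
    refine hle _ ((Z.gr (h + k - r - 1, h' + k' - s - 1)).comap (Z.mode r s (a ⊗ₜ b)))
      (fun q c hc d hd => ?_) hy
    rw [Submodule.mem_comap, hmode]
    have := hgr _ _ _ _ (h₁.fv6 r (-1) p.1 p.2 q.1 q.2 a ha c hc)
      (h₂.fv6 (-1) s _ _ _ _ b hb d hd)
    convert this using 2
    ext <;> simp <;> ring

end Tensor

/-! ### The product map `ker D̄ ⊗ ker D → F` -/

namespace FullVertexData

variable {F : Type*} [AddCommGroup F] [Module ℂ F] {X : FullVertexData F}

theorem Dbar_restrict_ker {S : Submodule ℂ F} (hS : X.IsSubalgebra S)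
    (h : S ≤ LinearMap.ker X.Dbar) (a : S) : (X.restrict S hS).Dbar a = 0 :=
  Subtype.ext (h a.2)

theorem D_restrict_ker {S : Submodule ℂ F} (hS : X.IsSubalgebra S)
    (h : S ≤ LinearMap.ker X.D) (a : S) : (X.restrict S hS).D a = 0 :=
  Subtype.ext (h a.2)

/-- Both sides of the homomorphism property reduce to `a(r, -1) c(-1, -1) b(-1, s) d`. -/
theorem IsFullVertexAlgebra.mode_product_product (hX : X.IsFullVertexAlgebra)
    (hL : X.IsSubalgebra (LinearMap.ker X.D)) {a b c d : F} (ha : X.Dbar a = 0)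
    (hb : X.D b = 0) (hc : X.Dbar c = 0) (hd : X.D d = 0) (r s : ℝ) :
    X.mode (-1) (-1) (X.mode r (-1) a c) (X.mode (-1) s b d) =
      X.mode r s (X.mode (-1) (-1) a b) (X.mode (-1) (-1) c d) := by
  have hcomm := hX.mode_comm hc hb (-1) (-1) s d
  rw [Int.cast_neg, Int.cast_one] at hcomm
  rw [hX.mode_product ha hb, ← hcomm]
  by_cases hr : ∃ k : ℤ, r = k
  · obtain ⟨k, rfl⟩ := hr
    exact hX.mode_mode_of_mem_ker ha hc (hL.mode_mem _ _ b hb d hd) k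
  · have hz : ∀ m, X.mode r (-1) a m = 0 := fun m => by
      by_contra h
      exact hr (hX.eq_of_mode_ne_zero ha h).2
    rw [hz, hz, map_zero, LinearMap.zero_apply]

theorem IsFullVertexAlgebra.isHom_productMap (hX : X.IsFullVertexAlgebra)
    (hK : X.IsSubalgebra (LinearMap.ker X.Dbar)) (hL : X.IsSubalgebra (LinearMap.ker X.D))
    (h₁ : (X.restrict _ hK).IsFullVertexAlgebra) (h₂ : (X.restrict _ hL).IsFullVertexAlgebra) :
    IsHom (tensor (X.restrict _ hK) (X.restrict _ hL) h₁.fv1 h₂.fv1) X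
      (X.productMap (LinearMap.ker X.Dbar) (LinearMap.ker X.D)) where
  map_vac := hX.fv4_id X.vac
  map_mode r s x y := by
    have hmode := tensor_mode_tmul h₁.fv1 h₂.fv1
      (fun r s a b h => (h₁.eq_of_mode_ne_zero (Dbar_restrict_ker hK le_rfl a) h).1)
      (fun r s a b h => (h₂.eq_of_mode_ne_zero' (D_restrict_ker hL le_rfl a) h).1) r s
    generalize tensor (X.restrict _ hK) (X.restrict _ hL) h₁.fv1 h₂.fv1 = Z at *
    induction x with
    | zero => simp only [map_zero, LinearMap.zero_apply]
    | add x x' hx hx' => simp only [map_add, LinearMap.add_apply, hx, hx']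
    | tmul a b =>
      induction y with
      | zero => simp only [map_zero]
      | add y y' hy hy' => simp only [map_add, hy, hy']
      | tmul c d =>
        rw [hmode]
        exact hX.mode_product_product hL a.2 b.2 c.2 d.2 r s

end FullVertexData
end FullVA

theorem mainTheorem7 {F : Type*} [AddCommGroup F] [Module ℂ F] (X : FullVA.FullVertexData F)
    (hX : X.IsFullVertexAlgebra) :
    ∃ (hK : X.IsSubalgebra (LinearMap.ker X.Dbar)) (hL : X.IsSubalgebra (LinearMap.ker X.D)),
      -- for `a ∈ ker D̄`, only the modes `a(n, -1)`, `n ∈ ℤ`, occur in `Y(a, z)`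
      (∀ a ∈ LinearMap.ker X.Dbar, ∀ r s : ℝ,
        X.mode r s a ≠ 0 → s = -1 ∧ ∃ n : ℤ, r = n) ∧
      -- `ker D̄` is a vertex algebra
      FullVA.IsVertexAlgebra (fun n : ℤ => (X.restrict _ hK).mode n (-1)) (X.restrict _ hK).vac ∧
      -- `F` is a module of the vertex algebra `ker D̄`
      FullVA.IsVertexModule (fun n : ℤ => (X.restrict _ hK).mode n (-1)) (X.restrict _ hK).vac
        (fun n : ℤ => (X.mode n (-1)).domRestrict (LinearMap.ker X.Dbar)) ∧
      -- `ker D̄` and `ker D` are full vertex algebras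
      ∃ (h₁ : (X.restrict _ hK).IsFullVertexAlgebra) (h₂ : (X.restrict _ hL).IsFullVertexAlgebra),
        -- `F` is a module of the full vertex algebra `ker D̄`
        (X.restrict _ hK).IsModule X.gr
          (fun r s => (X.mode r s).domRestrict (LinearMap.ker X.Dbar)) ∧
        -- `ker D̄ ⊗ ker D` is a full vertex algebra
        (FullVA.tensor (X.restrict _ hK) (X.restrict _ hL) h₁.fv1 h₂.fv1).IsFullVertexAlgebra ∧
        -- `a ⊗ b ↦ a(-1, -1) b` is a homomorphism of full vertex algebras
        FullVA.IsHom (FullVA.tensor (X.restrict _ hK) (X.restrict _ hL) h₁.fv1 h₂.fv1) X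
          (X.productMap (LinearMap.ker X.Dbar) (LinearMap.ker X.D)) := by
  have hK := hX.isSubalgebra_ker_Dbar
  have hL := hX.isSubalgebra_ker_D
  have h₁ := hX.restrict hK
  have h₂ := hX.restrict hL
  refine ⟨hK, hL, fun a ha r s h => ?_, hX.isVertexAlgebra hK, hX.isVertexModule hK,
    h₁, h₂, hX.isModule_restrict hK, FullVA.tensor_isFullVertexAlgebra h₁ h₂
      (FullVA.FullVertexData.Dbar_restrict_ker hK le_rfl)
      (FullVA.FullVertexData.D_restrict_ker hL le_rfl), hX.isHom_productMap hK hL h₁ h₂⟩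
  obtain ⟨m, hm⟩ := DFunLike.ne_iff.1 h
  exact hX.eq_of_mode_ne_zero ha hm
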